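/- Let $\omega$ be an irrational number of bounded type: its continued fraction convergents $p_n/q_n$ satisfy $q_{n+1}<Mq_n$ for all $n$, for some $M\ge\frac{\sqrt5+1}{2}$. Write $\mathbb S^1=\mathbb R/2\pi\mathbb Z$, $Tx=x+2\pi\omega$. For a map $A:\mathbb S^1\to SL(2,\mathbb R)$ put $A^n(x)=A(T^{n-1}x)\cdots A(x)$ and $A^{-n}(x)=A(T^{-n}x)^{-1}\cdots A(T^{-1}x)^{-1}$ ($n\ge 1$). A matrix $B\in SL(2,\mathbb R)$ is hyperbolic if $\|B\|>1$ (Euclidean operator norm); then $s(B)\in\mathbb{RP}^1=\mathbb R/\pi\mathbb Z$ denotes its most contracted direction. Let $R_\theta$ be the rotation by $\theta$ and, for $\lambda>0$, $\Lambda=\mathrm{diag}(\lambda,\lambda^{-1})$. Fix $0<a<\frac1{10}$, $c_1\in[0,\pi)$, $c_2=c_1+\pi$, $0<\delta_0<\frac{\pi}{2}$, and $d\in\{0,1\}$. Let $\phi_{0i}(x)=\mathrm{sgn}(x-c_i)\,e^{-1/|x-c_i|^a}$ (with value $0$ at $c_i$), and let the $2\pi$-periodic function $\phi_0$ be $\phi_{01}$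 near $c_1$, and near $c_2$ be $-\phi_{02}$ if $d=0$, $\phi_{02}$ if $d=1$. Let $\phi\in C^\infty(\mathbb R)$ satisfy: $\phi(x+2\pi)=\phi(x)+2\pi d$; $\phi=\phi_{01}$ for $|x-c_1|\le\delta_0$; for $|x-c_2|\le\delta_0$, $\phi=-\phi_{02}$ if $d=0$ and $\phi=\pi+\phi_{02}$ if $d=1$; and $|\phi(x)-k\pi|>e^{-1/\delta_0^a}$ for all $k\in\mathbb Z$ whenever $x$ has distance $>\delta_0$ from $c_1$ and from $c_2$ on $\mathbb S^1$. For $C\ge1$ let $\frac{I_n}{C}\subset\mathbb S^1$ be the set of points at distance at most $\frac1{Cq_n^2}$ from $c_1$ or $c_2$, and $I_n=\frac{I_n}{1}$; let $r_n^{\pm}$ be the smallest $j\ge1$ such that $T^{\pm j}x\in I_n$ for some $x\in I_n$. By cutoffs for $N$ we mean $2\pi$-periodic $f_n\in C^\infty$ $(n\ge N)$ with $f_n=1$ on $\frac{I_n}{10}$, $f_n\in[0,1]$ on $I_n\setminus\frac{I_n}{10}$, $f_n=0$ off $I_n$, and $|f_n^{(r)}|\le q_n^{3r}$ for $0\le r\le[q_n^{1/10}]$.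 Given $N$, $\lambda$ and cutoffs $(f_n)_{n\ge N}$, define $\phi_n$ and $A_n=\Lambda R_{\frac\pi2-\phi_n}$, $n\ge N$, inductively, starting from $\phi_{N-1}:=\phi$, $A_{N-1}:=\Lambda R_{\frac\pi2-\phi}$, by $$\phi_n=\phi_{n-1}+e_nf_n,$$ where for $x\in I_n$ the number $e_n(x)\in(-\frac\pi2,\frac\pi2]$ is the representative modulo $\pi$ of $$g_n(x)-\Big(s\big(A_{n-1}^{r_n^+}(x)\big)-s\big(A_{n-1}^{-r_n^-}(x)\big)\Big),$$ with $g_N=\phi_0$ and $g_n(x)=s\big(A_{n-1}^{r_{n-1}^+}(x)\big)-s\big(A_{n-1}^{-r_{n-1}^-}(x)\big)$ for $n>N$ (and $e_nf_n:=0$ off $I_n$). Then there is $N_0$ such that for every $N\ge N_0$ cutoffs for $N$ exist, and there is $\lambda_0$ such that for every $\lambda\ge\lambda_0$ and every choice of cutoffs for $N$ the construction is well defined: for every $n\ge N$ and $x\in I_n$ the matrices $A_{n-1}^{r_n^+}(x)$, $A_{n-1}^{-r_n^-}(x)$, $A_n^{r_n^+}(x)$, $A_n^{-r_n^-}(x)$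 are hyperbolic, and every $A_n$ is a $C^\infty$ map $\mathbb S^1\to SL(2,\mathbb R)$. Moreover there is $D_\infty\in C^\infty(\mathbb S^1,SL(2,\mathbb R))$ such that $A_N,A_{N+1},\dots$ converges to $D_\infty$ in the $C^k$ topology for every $k\in\mathbb N$, i.e. in the $C^\infty$ topology. -/

import Mathlib

open scoped ContDiff

noncomputable section

namespace FlatCocycle

/-! Functions on the circle `ℝ / 2πℤ` are written as `2π`-periodic functions on `ℝ`, and
subsets of the circle as `2π`-periodic subsets of `ℝ`.  The rotation is `T x = x + 2πw`, with `w` its frequency. -/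

/-- Denominator `q_n` of the `n`-th continued fraction convergent of `w`. -/
def q (w : ℝ) (n : ℕ) : ℝ := (GenContFract.of w).dens n

/-- Irrational numbers of bounded type. -/
def IsBoundedType (w : ℝ) : Prop :=
  Irrational w ∧ ∃ M : ℝ, (Real.sqrt 5 + 1) / 2 ≤ M ∧ ∀ n : ℕ, q w (n + 1) < M * q w n

/-! ### Matrices, contracted directions -/

abbrev Mat := Matrix (Fin 2) (Fin 2) ℝ

/-- Rotation by the angle `θ`. -/
def rot (θ : ℝ) : Mat := !![Real.cos θ, -Real.sin θ; Real.sin θ, Real.cos θ]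

/-- The unit vector of angle `θ` in the Euclidean plane. -/
def unitVec (θ : ℝ) : EuclideanSpace ℝ (Fin 2) := !₂[Real.cos θ, Real.sin θ]

/-- A matrix as an operator on the Euclidean plane. -/
def op (A : Mat) : EuclideanSpace ℝ (Fin 2) →L[ℝ] EuclideanSpace ℝ (Fin 2) :=
  Matrix.toEuclideanCLM (n := Fin 2) (𝕜 := ℝ) A

/-- A matrix of `SL(2, ℝ)` is hyperbolic if its Euclidean operator norm is larger than one. -/
def IsHyperbolic (A : Mat) : Prop := A.det = 1 ∧ 1 < ‖op A‖

theorem exists_contracted (A : Mat) :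
    ∃ θ : ℝ, ∀ η : ℝ, ‖op A (unitVec θ)‖ ≤ ‖op A (unitVec η)‖ := by
  have hc : Continuous fun θ : ℝ => ‖op A (unitVec θ)‖ := by
    refine ((op A).continuous.comp ?_).norm
    refine (PiLp.continuous_toLp 2 _).comp (continuous_pi fun i => ?_)
    fin_cases i
    · exact Real.continuous_cos
    · exact Real.continuous_sin
  have hp : Function.Periodic (fun θ : ℝ => ‖op A (unitVec θ)‖) (2 * Real.pi) := by
    intro θ
    simp [unitVec]
  obtain ⟨m, ⟨θ, rfl⟩, hm⟩ := (hp.compact_of_continuous Real.two_pi_pos.ne' hc).exists_isLeast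
    (Set.range_nonempty _)
  exact ⟨θ, fun η => hm ⟨η, rfl⟩⟩

/-- An angle of the most contracted direction `s(A)`.  It is unique modulo `π` when `A` is
hyperbolic, and is only used modulo `π`, that is, as a point of the projective line. -/
def contracted (A : Mat) : ℝ := (exists_contracted A).choose

/-- The representative in `(-π/2, π/2]` of a number modulo `π`. -/
def rep (θ : ℝ) : ℝ := toIocMod Real.pi_pos (-(Real.pi / 2)) θ

/-! ### Cocycles -/

/-- The cocycle `Λ · R_{π/2 - φ(x)}` with `Λ = diag(lam, 1/lam)`. -/
def cocycle (lam : ℝ) (φ : ℝ → ℝ) (x : ℝ) : Mat :=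
  !![lam, 0; 0, lam⁻¹] * rot (Real.pi / 2 - φ x)

/-- `A^n(x) = A(T^{n-1} x) ⋯ A(T x) A(x)`. -/
def fwd (w : ℝ) (A : ℝ → Mat) : ℕ → ℝ → Mat
  | 0, _ => 1
  | n + 1, x => A (x + 2 * Real.pi * w * n) * fwd w A n x

/-- `A^{-n}(x) = A(T^{-n} x)⁻¹ ⋯ A(T^{-1} x)⁻¹`. -/
def bwd (w : ℝ) (A : ℝ → Mat) : ℕ → ℝ → Mat
  | 0, _ => 1
  | n + 1, x => (A (x - 2 * Real.pi * w * (n + 1)))⁻¹ * bwd w A n x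

/-- The points of the circle at distance at most `ρ` from `c₁` or from `c₂ = c₁ + π`. -/
def nearCrit (c₁ ρ : ℝ) : Set ℝ := {x | ∃ k : ℤ, |x - (c₁ + k * Real.pi)| ≤ ρ}

/-- `critInt w c₁ n C` is the set `I_n / C`; in particular `I_n` itself for `C = 1`. -/
def critInt (w c₁ : ℝ) (n : ℕ) (C : ℝ) : Set ℝ := nearCrit c₁ (1 / (C * q w n ^ 2))

/-- `r_n^+`: the smallest first return time to `I_n` under `T`, over all points of `I_n`. -/
def rPlus (w c₁ : ℝ) (n : ℕ) : ℕ :=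
  sInf {j : ℕ | 0 < j ∧ ∃ x ∈ critInt w c₁ n 1, x + 2 * Real.pi * w * j ∈ critInt w c₁ n 1}

/-- `r_n^-`: the smallest first return time to `I_n` under the inverse of `T`. -/
def rMinus (w c₁ : ℝ) (n : ℕ) : ℕ :=
  sInf {j : ℕ | 0 < j ∧ ∃ x ∈ critInt w c₁ n 1, x - 2 * Real.pi * w * j ∈ critInt w c₁ n 1}

/-- `s(A^{r_n^+}(x)) - s(A^{-r_n^-}(x))` (modulo `π`) for the cocycle `A` of angle function `φ`. -/
def gap (w c₁ lam : ℝ) (n : ℕ) (φ : ℝ → ℝ) (x : ℝ) : ℝ :=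
  contracted (fwd w (cocycle lam φ) (rPlus w c₁ n) x)
    - contracted (bwd w (cocycle lam φ) (rMinus w c₁ n) x)

/-- The matrices whose contracted directions enter `gap` are hyperbolic at all points of `I_n`. -/
def GapDefined (w c₁ lam : ℝ) (n : ℕ) (φ : ℝ → ℝ) : Prop :=
  ∀ x ∈ critInt w c₁ n 1,
    IsHyperbolic (fwd w (cocycle lam φ) (rPlus w c₁ n) x) ∧
    IsHyperbolic (bwd w (cocycle lam φ) (rMinus w c₁ n) x)

/-! ### The starting cocycle -/

/-- The flat function `sgn(t) exp(-1/|t|^a)`, equal to `0` at `t = 0`. -/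
def flat (a t : ℝ) : ℝ := Real.sign t * Real.exp (-(1 / |t| ^ a))

/-- The function `φ_0` near `c₁` and `c₂ = c₁ + π`, as a `2π`-periodic function: it is
`flat (x - c₁)` near `c₁`, and near `c₂` it is `-flat (x - c₂)` if `d = 0`
and `flat (x - c₂)` if `d = 1`.  Only its values near `c₁` and `c₂` are used. -/
def phi0 (d : ℕ) (a c₁ x : ℝ) : ℝ :=
  let t := toIcoMod Real.two_pi_pos (-(Real.pi / 2)) (x - c₁)
  if t < Real.pi / 2 then flat a t else (2 * d - 1) * flat a (t - Real.pi)

/-- The starting angle function `φ`: `d = 0` is the case homotopic to the identity (`φ` is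
`2π`-periodic), `d = 1` the other case (`φ` is the identity plus a `2π`-periodic function). -/
structure IsStart (d : ℕ) (a c₁ δ₀ : ℝ) (φ : ℝ → ℝ) : Prop where
  smooth : ContDiff ℝ ∞ φ
  lift : ∀ x, φ (x + 2 * Real.pi) = φ x + 2 * Real.pi * d
  near₁ : ∀ x, |x - c₁| ≤ δ₀ → φ x = flat a (x - c₁)
  near₂ : ∀ x, |x - (c₁ + Real.pi)| ≤ δ₀ →
    φ x = d * Real.pi + (2 * d - 1) * flat a (x - (c₁ + Real.pi))
  away : ∀ x, x ∉ nearCrit c₁ δ₀ →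
    ∀ k : ℤ, Real.exp (-(1 / δ₀ ^ a)) < |φ x - k * Real.pi|

/-! ### Cutoffs and the inductive construction -/

/-- The smooth cutoffs `f_n`, `n ≥ N`. -/
structure IsCutoff (w c₁ : ℝ) (N : ℕ) (f : ℕ → ℝ → ℝ) : Prop where
  smooth : ∀ n ≥ N, ContDiff ℝ ∞ (f n)
  periodic : ∀ n ≥ N, Function.Periodic (f n) (2 * Real.pi)
  one : ∀ n ≥ N, ∀ x ∈ critInt w c₁ n 10, f n x = 1
  mem : ∀ n ≥ N, ∀ x ∈ critInt w c₁ n 1 \ critInt w c₁ n 10, f n x ∈ Set.Icc (0 : ℝ) 1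
  zero : ∀ n ≥ N, ∀ x ∉ critInt w c₁ n 1, f n x = 0
  deriv_le : ∀ n ≥ N, ∀ r : ℕ, r ≤ ⌊q w n ^ (1 / 10 : ℝ)⌋₊ →
    ∀ x, |iteratedDeriv r (f n) x| ≤ q w n ^ (3 * r)

/-- One step: `φ ↦ φ + e · f_n`, where `e` is the small representative modulo `π` of
`g - (s(A^{r_n^+}) - s(A^{-r_n^-}))` and `A` is the cocycle of `φ`. -/
def correct (w c₁ lam : ℝ) (f : ℕ → ℝ → ℝ) (n : ℕ) (g φ : ℝ → ℝ) (x : ℝ) : ℝ :=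
  φ x + rep (g x - gap w c₁ lam n φ x) * f n x

/-- The angle functions: `angle … j` is `φ_{N+j}`. -/
def angle (w : ℝ) (d : ℕ) (a c₁ lam : ℝ) (φ : ℝ → ℝ) (N : ℕ) (f : ℕ → ℝ → ℝ) : ℕ → ℝ → ℝ
  | 0 => correct w c₁ lam f N (phi0 d a c₁) φ
  | j + 1 => correct w c₁ lam f (N + j + 1)
      (gap w c₁ lam (N + j) (angle w d a c₁ lam φ N f j)) (angle w d a c₁ lam φ N f j)

/-! ### Smooth cocycles and their topology -/

/-- `A` is a `C^∞` map from the circle to `SL(2, ℝ)`. -/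
def IsSmoothCocycle (A : ℝ → Mat) : Prop :=
  (∀ x, (A x).det = 1) ∧ Function.Periodic A (2 * Real.pi) ∧
    ∀ i j, ContDiff ℝ ∞ fun x => A x i j

/-- Convergence in the `C^k` topology: all derivatives of order at most `k` converge uniformly. -/
def TendstoCk (k : ℕ) (A : ℕ → ℝ → Mat) (D : ℝ → Mat) : Prop :=
  ∀ r ≤ k, ∀ i j, TendstoUniformly (fun n => iteratedDeriv r fun x => A n x i j)
    (iteratedDeriv r fun x => D x i j) Filter.atTop

end FlatCocycle

end

open FlatCocycle

/-!
The directions contracted by the forward and by the backward products at a point near the critical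
set `c₁ + ℤ π` differ, modulo `π`, by the angle function plus an *offset* (`offset`): an explicit
smooth function of two orbit segments that avoid the point itself. The offset is the difference of
two small direction slopes, and two pairs of segments of lengths of size `X` have offsets that
agree up to `exp (-c X log lam)` (`JetGood.offset_sub`). In these terms the construction subtracts
an offset and then exchanges it for the offsets of longer and longer segments (`Scheme.angle_eq`),
so that the `n`-th correction is exponentially small in the return time, which has size `q_n ^ 2`.
The whole difficulty is that this needs growth along the segments used, although the starting
angle function is infinitely flat at the critical points.

*Growth.* A segment is split at its point nearest to the critical set. As `w` is badly
approximable, a point at distance `t` from the critical set is about `1 / t` steps away from the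
ends of a clean segment (`IsClean.split`), so the two halves have growth `lam ^ (c / t)`, whereas
gluing them costs at most a factor equal to the sine of the angle at which their directions meet.
This sine is at least of the order of `exp (-1 / √t)`, as the exponent `a < 1 / 10` of the
flatness is less than one half. Hence the losses along a segment of length `m` add up to at most
`K m`, with `K` independent of `lam`, while the growth without losses is `m log lam`
(`isGood_of_transversal`). The lower bound on the sine survives the induction: near the critical
set the angle at which two long segments meet is, up to an exponentially small error, the one for
a reference segment whose length is adapted to the distance `t`, and there the corrections have
restored the angle of the starting function up to an error that is small as well
(`Scheme.psi_add_offset`, `Scheme.transv_of_near`, `Scheme.trans`).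

*Derivatives.* Jets are measured by the weighted norms `∑ ρ ^ r / r! |f^(r)|`, which are
submultiplicative. If the angle function oscillates by at most `η` in such a norm, then the growth
along a clean segment of length `m` has relative jet oscillation at most `η m exp (c √m)`, up to
constants (`relJet_of_transversal`). Suppose that the derivatives of order at most `k` are bounded
and that the next one is at most `L`. Taking for `ρ` a small multiple of
`L ^ (-1 / (k + 1)) exp (-c √X)` makes the relative oscillation small along all clean segments of
lengths of size `X`, and returning from the weighted norm to `C^(k+1)` costs `ρ⁻¹ ^ (k + 1)`, that
is, `L exp (c (k + 1) √X)` up to a constant. The exponential decay of the corrections in `X` beats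
this for large `X`, and the bound is linear in `L` (`Scheme.exists_step_bound`), so that the
derivatives of order `k + 1` remain bounded as well (`Scheme.exists_uniform_bound`). No condition
on `lam` depends on `k`. The steps are then summable in every `C^k` (`Scheme.exists_step_le`), and
the limit is smooth (`exists_limit_cocycle`).

The cutoffs are iterated window averages of a plateau function: each average controls one more
derivative, by the reciprocal of the radius of its window (`exists_isCutoff`).
-/

open scoped ContDiff

noncomputable section

namespace FlatCocycle

/-! ### Weighted jet seminorms -/

section JetNorm

open Finset

/-- The seminorm `∑_{r ≤ k} ρ ^ r / r! * |f^(r)(x)|` of the `k`-jet of `f` at `x`. -/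
def jetNorm (k : ℕ) (ρ x : ℝ) (f : ℝ → ℝ) : ℝ :=
  ∑ r ∈ range (k + 1), ρ ^ r / r.factorial * |iteratedDeriv r f x|

/-- The part of `jetNorm` that comes from the derivatives of positive order. -/
def jetOsc (k : ℕ) (ρ x : ℝ) (f : ℝ → ℝ) : ℝ :=
  ∑ r ∈ range k, ρ ^ (r + 1) / (r + 1).factorial * |iteratedDeriv (r + 1) f x|

variable {k : ℕ} {ρ x : ℝ} {f g : ℝ → ℝ}

theorem jetNorm_eq : jetNorm k ρ x f = |f x| + jetOsc k ρ x f := by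
  rw [jetNorm, Finset.sum_range_succ', jetOsc]
  simp [add_comm]

theorem jetNorm_nonneg (hρ : 0 ≤ ρ) : 0 ≤ jetNorm k ρ x f :=
  Finset.sum_nonneg fun r _ => by positivity

theorem jetOsc_nonneg (hρ : 0 ≤ ρ) : 0 ≤ jetOsc k ρ x f :=
  Finset.sum_nonneg fun r _ => by positivity

theorem jetNorm_zero_order : jetNorm 0 ρ x f = |f x| := by simp [jetNorm]

theorem abs_le_jetNorm (hρ : 0 ≤ ρ) : |f x| ≤ jetNorm k ρ x f := by
  rw [jetNorm_eq]; linarith [jetOsc_nonneg (k := k) (x := x) (f := f) hρ]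

theorem jetNorm_mono (hρ : 0 ≤ ρ) {k' : ℕ} (h : k ≤ k') :
    jetNorm k ρ x f ≤ jetNorm k' ρ x f :=
  Finset.sum_le_sum_of_subset_of_nonneg (by simpa using h) fun r _ _ => by positivity

theorem jetNorm_congr (h : f =ᶠ[nhds x] g) : jetNorm k ρ x f = jetNorm k ρ x g := by
  refine Finset.sum_congr rfl fun r _ => ?_
  rw [h.iteratedDeriv_eq]

theorem jetOsc_congr (h : f =ᶠ[nhds x] g) : jetOsc k ρ x f = jetOsc k ρ x g := by
  refine Finset.sum_congr rfl fun r _ => ?_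
  rw [h.iteratedDeriv_eq]

theorem jetNorm_comp_add (s : ℝ) :
    jetNorm k ρ x (fun z => f (z + s)) = jetNorm k ρ (x + s) f := by
  refine Finset.sum_congr rfl fun r _ => ?_
  rw [iteratedDeriv_comp_add_const]

theorem jetOsc_comp_add (s : ℝ) :
    jetOsc k ρ x (fun z => f (z + s)) = jetOsc k ρ (x + s) f := by
  refine Finset.sum_congr rfl fun r _ => ?_
  rw [iteratedDeriv_comp_add_const]

theorem contDiffAt_nat (hf : ContDiffAt ℝ ∞ f x) (n : ℕ) : ContDiffAt ℝ n f x :=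
  hf.of_le (by exact_mod_cast le_top)

theorem jetOsc_const (c : ℝ) : jetOsc k ρ x (fun _ => c) = 0 := by
  refine Finset.sum_eq_zero fun r _ => ?_
  simp [iteratedDeriv_const]

theorem jetNorm_const (c : ℝ) : jetNorm k ρ x (fun _ => c) = |c| := by
  rw [jetNorm_eq, jetOsc_const, add_zero]

theorem jetOsc_add_le (hρ : 0 ≤ ρ) (hf : ContDiffAt ℝ ∞ f x) (hg : ContDiffAt ℝ ∞ g x) :
    jetOsc k ρ x (fun z => f z + g z) ≤ jetOsc k ρ x f + jetOsc k ρ x g := by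
  rw [jetOsc, jetOsc, jetOsc, ← Finset.sum_add_distrib]
  refine Finset.sum_le_sum fun r _ => ?_
  have : iteratedDeriv (r + 1) (fun z => f z + g z) x
      = iteratedDeriv (r + 1) f x + iteratedDeriv (r + 1) g x :=
    iteratedDeriv_add (contDiffAt_nat hf _) (contDiffAt_nat hg _)
  rw [this, ← mul_add]
  gcongr
  exact abs_add_le _ _

theorem jetNorm_add_le (hρ : 0 ≤ ρ) (hf : ContDiffAt ℝ ∞ f x) (hg : ContDiffAt ℝ ∞ g x) :
    jetNorm k ρ x (fun z => f z + g z) ≤ jetNorm k ρ x f + jetNorm k ρ x g := by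
  simp only [jetNorm_eq]
  linarith [jetOsc_add_le (k := k) hρ hf hg, abs_add_le (f x) (g x)]

theorem jetOsc_const_mul (c : ℝ) :
    jetOsc k ρ x (fun z => c * f z) = |c| * jetOsc k ρ x f := by
  rw [jetOsc, jetOsc, Finset.mul_sum]
  refine Finset.sum_congr rfl fun r _ => ?_
  rw [iteratedDeriv_const_mul_field, abs_mul]; ring

theorem jetNorm_const_mul (c : ℝ) :
    jetNorm k ρ x (fun z => c * f z) = |c| * jetNorm k ρ x f := by
  rw [jetNorm_eq, jetNorm_eq, jetOsc_const_mul, abs_mul]; ring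

theorem jetOsc_neg : jetOsc k ρ x (fun z => - f z) = jetOsc k ρ x f := by
  simpa using jetOsc_const_mul (k := k) (ρ := ρ) (x := x) (f := f) (-1)

theorem jetNorm_neg : jetNorm k ρ x (fun z => - f z) = jetNorm k ρ x f := by
  simpa using jetNorm_const_mul (k := k) (ρ := ρ) (x := x) (f := f) (-1)

theorem jetOsc_sub_le (hρ : 0 ≤ ρ) (hf : ContDiffAt ℝ ∞ f x) (hg : ContDiffAt ℝ ∞ g x) :
    jetOsc k ρ x (fun z => f z - g z) ≤ jetOsc k ρ x f + jetOsc k ρ x g := by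
  have := jetOsc_add_le (k := k) hρ hf hg.neg
  simpa only [sub_eq_add_neg, jetOsc_neg] using this

theorem jetNorm_sub_le (hρ : 0 ≤ ρ) (hf : ContDiffAt ℝ ∞ f x) (hg : ContDiffAt ℝ ∞ g x) :
    jetNorm k ρ x (fun z => f z - g z) ≤ jetNorm k ρ x f + jetNorm k ρ x g := by
  have := jetNorm_add_le (k := k) hρ hf hg.neg
  simpa only [sub_eq_add_neg, jetNorm_neg] using this

/-- The jet seminorm is submultiplicative, by the Leibniz rule. -/
theorem jetNorm_mul_le (hρ : 0 ≤ ρ) (hf : ContDiffAt ℝ ∞ f x) (hg : ContDiffAt ℝ ∞ g x) :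
    jetNorm k ρ x (fun z => f z * g z) ≤ jetNorm k ρ x f * jetNorm k ρ x g := by
  set a : ℕ → ℝ := fun r => ρ ^ r / r.factorial * |iteratedDeriv r f x| with ha
  set b : ℕ → ℝ := fun r => ρ ^ r / r.factorial * |iteratedDeriv r g x| with hb
  have ha0 : ∀ r, 0 ≤ a r := fun r => by positivity
  have hb0 : ∀ r, 0 ≤ b r := fun r => by positivity
  have key : ∀ n, ρ ^ n / n.factorial * |iteratedDeriv n (fun z => f z * g z) x|
      ≤ ∑ p ∈ antidiagonal n, a p.1 * b p.2 := by
    intro n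
    have : iteratedDeriv n (fun z => f z * g z) x = ∑ i ∈ range (n + 1),
        n.choose i * iteratedDeriv i f x * iteratedDeriv (n - i) g x :=
      iteratedDeriv_mul (contDiffAt_nat hf _) (contDiffAt_nat hg _)
    rw [this, Finset.Nat.sum_antidiagonal_eq_sum_range_succ (fun i j => a i * b j)]
    calc _ ≤ ρ ^ n / n.factorial * ∑ i ∈ range (n + 1),
          |n.choose i * iteratedDeriv i f x * iteratedDeriv (n - i) g x| := by
          gcongr; exact Finset.abs_sum_le_sum_abs _ _
      _ = _ := by
          rw [Finset.mul_sum]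
          refine Finset.sum_congr rfl fun i hi => ?_
          have hi' : i ≤ n := by simpa [Nat.lt_succ_iff] using hi
          rw [abs_mul, abs_mul, Nat.abs_cast, Nat.cast_choose ℝ hi']
          simp only [ha, hb]
          have : ρ ^ n = ρ ^ i * ρ ^ (n - i) := by rw [← pow_add]; congr 1; omega
          rw [this]
          field_simp
  calc jetNorm k ρ x (fun z => f z * g z)
      ≤ ∑ n ∈ range (k + 1), ∑ p ∈ antidiagonal n, a p.1 * b p.2 :=
        Finset.sum_le_sum fun n _ => key n
    _ ≤ ∑ n ∈ range (k + 1), ∑ p ∈ (range (k + 1) ×ˢ range (k + 1)) with p.1 + p.2 = n,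
          a p.1 * b p.2 := by
        refine Finset.sum_le_sum fun n hn => ?_
        refine Finset.sum_le_sum_of_subset_of_nonneg ?_ fun p _ _ => mul_nonneg (ha0 _) (hb0 _)
        intro p hp
        simp only [HasAntidiagonal.mem_antidiagonal, mem_range, mem_filter, mem_product] at *
        omega
    _ ≤ ∑ p ∈ range (k + 1) ×ˢ range (k + 1), a p.1 * b p.2 := by
        refine Finset.sum_fiberwise_le_sum_of_sum_fiber_nonneg fun n _ => ?_
        exact Finset.sum_nonneg fun p _ => mul_nonneg (ha0 _) (hb0 _)
    _ = _ := by rw [jetNorm, jetNorm, Finset.sum_mul_sum, Finset.sum_product]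

theorem jetNorm_sub_const : jetNorm k ρ x (fun z => f z - f x) = jetOsc k ρ x f := by
  rw [jetNorm_eq]
  simp only [sub_self, abs_zero, zero_add]
  refine Finset.sum_congr rfl fun r _ => ?_
  have : iteratedDeriv (r + 1) (fun z => f z - f x) x = iteratedDeriv (r + 1) f x := by
    simp [iteratedDeriv_succ', deriv_sub_const_fun]
  rw [this]

theorem jetOsc_mul_le (hρ : 0 ≤ ρ) (hf : ContDiffAt ℝ ∞ f x) (hg : ContDiffAt ℝ ∞ g x) :
    jetOsc k ρ x (fun z => f z * g z)
      ≤ jetOsc k ρ x f * jetNorm k ρ x g + |f x| * jetOsc k ρ x g := by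
  have h1 : (fun z => f z * g z) = fun z => (f z - f x) * g z + f x * g z := by
    ext z; ring
  have hf' : ContDiffAt ℝ ∞ (fun z => f z - f x) x := hf.sub contDiffAt_const
  rw [h1]
  refine (jetOsc_add_le hρ (hf'.mul hg) (contDiffAt_const.mul hg)).trans ?_
  rw [jetOsc_const_mul]
  have h2 : jetOsc k ρ x (fun z => (f z - f x) * g z)
      ≤ jetNorm k ρ x (fun z => (f z - f x) * g z) := by
    rw [jetNorm_eq]; simp
  have h3 := jetNorm_mul_le (k := k) hρ hf' hg
  rw [jetNorm_sub_const] at h3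
  linarith

theorem jetNorm_inv_mul_le (hρ : 0 ≤ ρ) (hf : ContDiffAt ℝ ∞ f x) (h0 : f x ≠ 0) :
    jetNorm k ρ x (fun z => (f z)⁻¹) * (|f x| - jetOsc k ρ x f) ≤ 1 := by
  have hi : ContDiffAt ℝ ∞ (fun z => (f z)⁻¹) x := hf.inv h0
  have hf' : ContDiffAt ℝ ∞ (fun z => f z - f x) x := hf.sub contDiffAt_const
  have hc : (fun z => f x * (f z)⁻¹) =ᶠ[nhds x] fun z => 1 - (f z - f x) * (f z)⁻¹ := by
    filter_upwards [hf.continuousAt.eventually_ne h0] with z hz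
    field_simp
    ring
  have h1 := jetNorm_congr (k := k) (ρ := ρ) hc
  rw [jetNorm_const_mul] at h1
  have h2 := jetNorm_sub_le (k := k) hρ (contDiffAt_const (c := (1 : ℝ))) (hf'.mul hi)
  have h3 := jetNorm_mul_le (k := k) hρ hf' hi
  rw [jetNorm_sub_const] at h3
  rw [jetNorm_const, abs_one] at h2
  nlinarith

theorem jetNorm_inv_le (hρ : 0 ≤ ρ) (hf : ContDiffAt ℝ ∞ f x)
    (h : jetOsc k ρ x f < |f x|) :
    jetNorm k ρ x (fun z => (f z)⁻¹) ≤ (|f x| - jetOsc k ρ x f)⁻¹ := by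
  have h0 : f x ≠ 0 := by
    intro h0; rw [h0, abs_zero] at h; exact absurd h (not_lt.2 (jetOsc_nonneg hρ))
  rw [← one_div, le_div_iff₀ (by linarith)]
  exact jetNorm_inv_mul_le hρ hf h0

theorem jetOsc_succ_le_deriv (hρ : 0 ≤ ρ) :
    jetOsc (k + 1) ρ x f ≤ ρ * jetNorm k ρ x (deriv f) := by
  rw [jetOsc, jetNorm, Finset.mul_sum]
  refine Finset.sum_le_sum fun r _ => ?_
  rw [iteratedDeriv_succ', ← mul_assoc]
  gcongr
  rw [pow_succ', mul_div_assoc]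
  gcongr
  omega

theorem deriv_le_jetOsc_succ (hρ : 0 ≤ ρ) :
    ρ * jetNorm k ρ x (deriv f) ≤ (k + 1) * jetOsc (k + 1) ρ x f := by
  rw [jetOsc, jetNorm, Finset.mul_sum, Finset.mul_sum]
  refine Finset.sum_le_sum fun r hr => ?_
  rw [iteratedDeriv_succ', ← mul_assoc, ← mul_assoc]
  refine mul_le_mul_of_nonneg_right ?_ (abs_nonneg _)
  have hr' : (r : ℝ) + 1 ≤ k + 1 := by
    have : r < k + 1 := by simpa using hr
    exact_mod_cast this
  rw [Nat.factorial_succ, Nat.cast_mul, pow_succ']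
  have h1 : (0 : ℝ) < r.factorial := by positivity
  have : (↑k + 1) * (ρ * ρ ^ r / (((r + 1 : ℕ) : ℝ) * r.factorial))
     = ρ * (ρ ^ r / r.factorial) * ((k + 1) / (r + 1)) := by
    push_cast; field_simp
  rw [this]
  refine le_mul_of_one_le_right (by positivity) ?_
  rw [le_div_iff₀ (by positivity)]; linarith

theorem contDiffAt_deriv (hf : ContDiffAt ℝ ∞ f x) : ContDiffAt ℝ ∞ (deriv f) x := by
  have h : ContDiffAt ℝ ∞ (fun z => fderiv ℝ f z 1) x :=
    (hf.fderiv_right (m := ∞) (by simp)).clm_apply contDiffAt_const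
  exact h

theorem eventually_differentiableAt (hf : ContDiffAt ℝ ∞ f x) :
    ∀ᶠ z in nhds x, DifferentiableAt ℝ f z := by
  have := (contDiffAt_nat hf 1).eventually (by simp)
  filter_upwards [this] with z hz
  exact hz.differentiableAt (by simp)

/-- A bound for the composition with a function whose derivative is a product. -/
theorem jetOsc_succ_le_of_deriv (hρ : 0 ≤ ρ) {G H : ℝ → ℝ} (hf : ContDiffAt ℝ ∞ f x)
    (hH : ContDiffAt ℝ ∞ H x)
    (hd : deriv G =ᶠ[nhds x] fun z => deriv f z * H z) :
    jetOsc (k + 1) ρ x G ≤ (k + 1) * jetOsc (k + 1) ρ x f * jetNorm k ρ x H := by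
  refine (jetOsc_succ_le_deriv hρ).trans ?_
  rw [jetNorm_congr hd]
  have h1 := jetNorm_mul_le (k := k) hρ (contDiffAt_deriv hf) hH
  calc _ ≤ ρ * (jetNorm k ρ x (deriv f) * jetNorm k ρ x H) := by gcongr
    _ = (ρ * jetNorm k ρ x (deriv f)) * jetNorm k ρ x H := by ring
    _ ≤ _ := by
      exact mul_le_mul_of_nonneg_right (deriv_le_jetOsc_succ hρ) (jetNorm_nonneg hρ)

theorem abs_arctan_le (u : ℝ) : |Real.arctan u| ≤ |u| := by
  have key : ∀ v : ℝ, 0 ≤ v → Real.arctan v ≤ v := fun v hv => by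
    have := Real.le_tan (Real.arctan_nonneg.2 hv) (Real.arctan_lt_pi_div_two v)
    rwa [Real.tan_arctan] at this
  rcases le_total 0 u with hu | hu
  · rw [abs_of_nonneg hu, abs_of_nonneg (Real.arctan_nonneg.2 hu)]; exact key u hu
  · rw [abs_of_nonpos hu, abs_of_nonpos (Real.arctan_le_zero.2 hu), ← Real.arctan_neg]
    exact key (-u) (by linarith)

theorem jetNorm_arctan_le (hρ : 0 ≤ ρ) (hf : ContDiffAt ℝ ∞ f x) (h : jetNorm k ρ x f ≤ 1 / 2) :
    jetNorm k ρ x (fun z => Real.arctan (f z)) ≤ (2 * k + 1) * jetNorm k ρ x f := by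
  have h0 : |Real.arctan (f x)| ≤ |f x| := abs_arctan_le _
  cases k with
  | zero => simpa [jetNorm_zero_order] using h0
  | succ k =>
    have hsq : ContDiffAt ℝ ∞ (fun z => 1 + f z ^ 2) x := contDiffAt_const.add (hf.pow 2)
    have hne : ∀ z, 1 + f z ^ 2 ≠ 0 := fun z => by positivity
    have hH : ContDiffAt ℝ ∞ (fun z => (1 + f z ^ 2)⁻¹) x := hsq.inv (hne x)
    have hn : jetNorm (k + 1) ρ x (fun z => (1 + f z ^ 2)⁻¹) ≤ 2 := by
      have ho : jetOsc (k + 1) ρ x (fun z => 1 + f z ^ 2) ≤ 1 / 2 := by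
        refine (jetOsc_add_le hρ contDiffAt_const (hf.pow 2)).trans ?_
        rw [jetOsc_const, zero_add]
        have h2 := jetNorm_mul_le (k := k + 1) hρ hf hf
        have h3 : jetOsc (k + 1) ρ x (fun z => f z ^ 2)
            ≤ jetNorm (k + 1) ρ x (fun z => f z * f z) := by
          simp only [← sq]
          rw [jetNorm_eq]; linarith [abs_nonneg (f x ^ 2)]
        nlinarith [jetNorm_nonneg (k := k + 1) (x := x) (f := f) hρ]
      have h1 : (1 : ℝ) ≤ |1 + f x ^ 2| := by
        rw [abs_of_pos (by positivity)]; nlinarith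
      refine (jetNorm_inv_le hρ hsq (by linarith)).trans ?_
      rw [inv_le_comm₀ (by linarith) (by norm_num)]
      linarith
    have hd : deriv (fun z => Real.arctan (f z)) =ᶠ[nhds x]
        fun z => deriv f z * (1 + f z ^ 2)⁻¹ := by
      filter_upwards [eventually_differentiableAt hf] with z hz
      rw [deriv_arctan hz]; simp [mul_comm]
    have h5 := jetOsc_succ_le_of_deriv (k := k) hρ hf hH hd
    have h6 : jetNorm k ρ x (fun z => (1 + f z ^ 2)⁻¹) ≤ 2 :=
      (jetNorm_mono hρ (Nat.le_succ k)).trans hn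
    have h7 := jetOsc_nonneg (k := k + 1) (x := x) (f := f) hρ
    rw [jetNorm_eq, jetNorm_eq]
    push_cast
    nlinarith [mul_le_mul_of_nonneg_left h6
      (mul_nonneg (by positivity : (0 : ℝ) ≤ k + 1) h7), abs_nonneg (f x)]

/-- Jets of the sine and the cosine of a function of small oscillation. -/
theorem jet_sin_cos (hρ : 0 ≤ ρ) (hf : ContDiffAt ℝ ∞ f x)
    (h : k * jetOsc k ρ x f ≤ 1 / 2) :
    jetOsc k ρ x (fun z => Real.sin (f z)) ≤ 2 * k * jetOsc k ρ x f ∧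
    jetOsc k ρ x (fun z => Real.cos (f z)) ≤ 2 * k * jetOsc k ρ x f := by
  cases k with
  | zero => simp [jetOsc]
  | succ k =>
    set o := jetOsc (k + 1) ρ x f
    have ho : 0 ≤ o := jetOsc_nonneg hρ
    have hs : ContDiffAt ℝ ∞ (fun z => Real.sin (f z)) x := hf.sin
    have hc : ContDiffAt ℝ ∞ (fun z => Real.cos (f z)) x := hf.cos
    have hds : deriv (fun z => Real.sin (f z)) =ᶠ[nhds x] fun z => deriv f z * Real.cos (f z) := by
      filter_upwards [eventually_differentiableAt hf] with z hz
      rw [deriv_sin hz]; ring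
    have hdc : deriv (fun z => Real.cos (f z)) =ᶠ[nhds x]
        fun z => deriv f z * (- Real.sin (f z)) := by
      filter_upwards [eventually_differentiableAt hf] with z hz
      rw [deriv_cos hz]; ring
    have h1 := jetOsc_succ_le_of_deriv (k := k) hρ hf hc hds
    have h2 := jetOsc_succ_le_of_deriv (k := k) hρ hf hs.neg hdc
    rw [jetNorm_neg] at h2
    have m1 := jetNorm_mono (x := x) (f := fun z => Real.cos (f z)) hρ (Nat.le_succ k)
    have m2 := jetNorm_mono (x := x) (f := fun z => Real.sin (f z)) hρ (Nat.le_succ k)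
    have e1 := jetNorm_eq (k := k + 1) (ρ := ρ) (x := x) (f := fun z => Real.sin (f z))
    have e2 := jetNorm_eq (k := k + 1) (ρ := ρ) (x := x) (f := fun z => Real.cos (f z))
    have b1 := Real.abs_sin_le_one (f x)
    have b2 := Real.abs_cos_le_one (f x)
    set X := jetNorm (k + 1) ρ x (fun z => Real.sin (f z))
    set Y := jetNorm (k + 1) ρ x (fun z => Real.cos (f z))
    push_cast at h h1 h2 ⊢
    have hk : 0 ≤ ((k : ℝ) + 1) * o := by positivity
    have g1 : X ≤ 1 + (k + 1) * o * Y := by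
      have := mul_le_mul_of_nonneg_left m1 hk
      linarith
    have g2 : Y ≤ 1 + (k + 1) * o * X := by
      have := mul_le_mul_of_nonneg_left m2 hk
      linarith
    have hX0 : 0 ≤ X := jetNorm_nonneg hρ
    have hY0 : 0 ≤ Y := jetNorm_nonneg hρ
    have hX : X ≤ 2 := by nlinarith
    have hY : Y ≤ 2 := by nlinarith
    constructor
    · nlinarith [mul_le_mul_of_nonneg_left (m1.trans hY) hk]
    · nlinarith [mul_le_mul_of_nonneg_left (m2.trans hX) hk]

end JetNorm

/-! ### Products along orbit segments -/

section Products

variable {w lam : ℝ} {φ : ℝ → ℝ}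

theorem cocycle_eq (lam : ℝ) (φ : ℝ → ℝ) (x : ℝ) : cocycle lam φ x =
    !![lam * Real.sin (φ x), -(lam * Real.cos (φ x));
      lam⁻¹ * Real.cos (φ x), lam⁻¹ * Real.sin (φ x)] := by
  simp [cocycle, rot, Real.cos_pi_div_two_sub, Real.sin_pi_div_two_sub]

theorem det_cocycle (hl : lam ≠ 0) (x : ℝ) : (cocycle lam φ x).det = 1 := by
  rw [cocycle_eq, Matrix.det_fin_two_of]
  field_simp
  nlinarith [Real.sin_sq_add_cos_sq (φ x)]

theorem det_fwd {A : ℝ → Mat} (hA : ∀ x, (A x).det = 1) (m : ℕ) (y : ℝ) :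
    (fwd w A m y).det = 1 := by
  induction m with
  | zero => simp [fwd]
  | succ m ih => rw [fwd, Matrix.det_mul, hA, ih, one_mul]

theorem fwd_add (A : ℝ → Mat) (m n : ℕ) (y : ℝ) :
    fwd w A (m + n) y = fwd w A n (y + 2 * Real.pi * w * m) * fwd w A m y := by
  induction n with
  | zero => simp [fwd]
  | succ n ih =>
    rw [← add_assoc, fwd, ih, fwd, Matrix.mul_assoc]
    congr 2
    push_cast; ring

theorem fwd_one (A : ℝ → Mat) (y : ℝ) : fwd w A 1 y = A y := by simp [fwd]

theorem fwd_congr {A B : ℝ → Mat} {m : ℕ} {y : ℝ}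
    (h : ∀ i < m, A (y + 2 * Real.pi * w * i) = B (y + 2 * Real.pi * w * i)) :
    fwd w A m y = fwd w B m y := by
  induction m with
  | zero => rfl
  | succ m ih =>
    rw [fwd, fwd, ih fun i hi => h i (by omega), h m (by omega)]

theorem inv_of_det_eq_one {A : Mat} (h : A.det = 1) :
    A⁻¹ = !![A 1 1, -A 0 1; -A 1 0, A 0 0] := by
  rw [Matrix.inv_def, h, Matrix.adjugate_fin_two]; simp

theorem bwd_eq_inv {A : ℝ → Mat} (m : ℕ) (x : ℝ) :
    bwd w A m x = (fwd w A m (x - 2 * Real.pi * w * m))⁻¹ := by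
  induction m with
  | zero => simp [fwd, bwd]
  | succ m ih =>
    rw [bwd, ih, add_comm m 1, fwd_add, fwd_one, Matrix.mul_inv_rev]
    congr 3
    all_goals push_cast; ring_nf

/-- The slope of the image of the horizontal direction under the product along the orbit segment
of length `m` that starts at `y`. -/
def slopeEnd (w lam : ℝ) (φ : ℝ → ℝ) (m : ℕ) (y : ℝ) : ℝ :=
  fwd w (cocycle lam φ) m y 1 0 / fwd w (cocycle lam φ) m y 0 0

/-- The time-reversed counterpart of `slopeEnd`, attached to the start of the segment. -/
def slopeStart (w lam : ℝ) (φ : ℝ → ℝ) (m : ℕ) (y : ℝ) : ℝ :=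
  lam⁻¹ ^ 2 * (fwd w (cocycle lam φ) m y 0 1 / fwd w (cocycle lam φ) m y 0 0)

/-- The upper left entry of the product along an orbit segment. -/
def growth (w lam : ℝ) (φ : ℝ → ℝ) (m : ℕ) (y : ℝ) : ℝ := fwd w (cocycle lam φ) m y 0 0

/-- The transversality factor at a point of angle `θ` between a past that arrives with
slope `t` and a future with start slope `u`. -/
def transv (θ t u : ℝ) : ℝ :=
  Real.sin θ - t * Real.cos θ + u * (Real.cos θ + t * Real.sin θ)

theorem transv_eq (θ t u : ℝ) : transv θ t u =
    Real.sin (θ + Real.arctan u - Real.arctan t)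
      * (Real.sqrt (1 + t ^ 2) * Real.sqrt (1 + u ^ 2)) := by
  have h1 : (0 : ℝ) < Real.sqrt (1 + t ^ 2) := Real.sqrt_pos.2 (by positivity)
  have h2 : (0 : ℝ) < Real.sqrt (1 + u ^ 2) := Real.sqrt_pos.2 (by positivity)
  rw [Real.sin_sub, Real.sin_add, Real.cos_add, Real.sin_arctan, Real.cos_arctan,
    Real.sin_arctan, Real.cos_arctan, transv]
  field_simp
  ring

section Split

variable {m n i : ℕ} {y : ℝ}

theorem growth_zero : growth w lam φ 0 y = 1 := by simp [growth, fwd]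
theorem slopeEnd_zero : slopeEnd w lam φ 0 y = 0 := by simp [slopeEnd, fwd]
theorem slopeStart_zero : slopeStart w lam φ 0 y = 0 := by simp [slopeStart, fwd]

/-- The matrix of the product along `i + 1 + n` points, split at the `i`-th point. -/
theorem fwd_split (A : ℝ → Mat) (i n : ℕ) (y : ℝ) :
    fwd w A (i + 1 + n) y = fwd w A n (y + 2 * Real.pi * w * (i + 1 : ℕ)) *
      (A (y + 2 * Real.pi * w * i) * fwd w A i y) := by
  rw [fwd_add, fwd_add, fwd_one]

theorem growth_split (hi : growth w lam φ i y ≠ 0) (hl : lam ≠ 0)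
    (hn : growth w lam φ n (y + 2 * Real.pi * w * (i + 1 : ℕ)) ≠ 0) :
    growth w lam φ (i + 1 + n) y =
      lam * growth w lam φ n (y + 2 * Real.pi * w * (i + 1 : ℕ)) * growth w lam φ i y *
        transv (φ (y + 2 * Real.pi * w * i)) (slopeEnd w lam φ i y)
          (slopeStart w lam φ n (y + 2 * Real.pi * w * (i + 1 : ℕ))) := by
  unfold growth at *
  rw [fwd_split, slopeEnd, slopeStart, transv, cocycle_eq]
  generalize fwd w (cocycle lam φ) i y = B at *
  generalize fwd w (cocycle lam φ) n (y + 2 * Real.pi * w * (i + 1 : ℕ)) = C at *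
  simp only [Matrix.mul_apply, Fin.sum_univ_two, Matrix.of_apply, Matrix.cons_val', Matrix.cons_val_zero,
    Matrix.cons_val_one, Matrix.cons_val_fin_one]
  field_simp
  ring

theorem slopeEnd_split (hl : lam ≠ 0) (hi : growth w lam φ i y ≠ 0)
    (hn : growth w lam φ n (y + 2 * Real.pi * w * (i + 1 : ℕ)) ≠ 0)
    (hg : growth w lam φ (i + 1 + n) y ≠ 0) :
    slopeEnd w lam φ (i + 1 + n) y =
      slopeEnd w lam φ n (y + 2 * Real.pi * w * (i + 1 : ℕ)) + lam⁻¹ ^ 2 *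
        ((Real.cos (φ (y + 2 * Real.pi * w * i)) + slopeEnd w lam φ i y *
            Real.sin (φ (y + 2 * Real.pi * w * i))) *
          ((growth w lam φ n (y + 2 * Real.pi * w * (i + 1 : ℕ)))⁻¹ *
           (growth w lam φ n (y + 2 * Real.pi * w * (i + 1 : ℕ)))⁻¹ *
          (transv (φ (y + 2 * Real.pi * w * i)) (slopeEnd w lam φ i y)
          (slopeStart w lam φ n (y + 2 * Real.pi * w * (i + 1 : ℕ))))⁻¹)) := by
  have h1 := growth_split hi hl hn
  have hG : transv (φ (y + 2 * Real.pi * w * i)) (slopeEnd w lam φ i y)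
          (slopeStart w lam φ n (y + 2 * Real.pi * w * (i + 1 : ℕ))) ≠ 0 := by
    intro h0; rw [h0, mul_zero] at h1; exact hg h1
  have hd : (fwd w (cocycle lam φ) n (y + 2 * Real.pi * w * (i + 1 : ℕ))).det = 1 :=
    det_fwd (fun x => det_cocycle hl x) _ _
  have e1 : slopeEnd w lam φ (i + 1 + n) y =
    fwd w (cocycle lam φ) (i + 1 + n) y 1 0 / growth w lam φ (i + 1 + n) y := rfl
  rw [e1, h1, div_eq_iff (by rw [← h1]; exact hg)]
  generalize hGd : transv (φ (y + 2 * Real.pi * w * i)) (slopeEnd w lam φ i y)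
          (slopeStart w lam φ n (y + 2 * Real.pi * w * (i + 1 : ℕ))) = G at *
  rw [add_mul]
  have e2 : ∀ X Pn Pi t : ℝ, Pn ≠ 0 → lam⁻¹ ^ 2 * (X * (Pn⁻¹ * Pn⁻¹ * G⁻¹)) * (lam * Pn * Pi * G)
      = lam⁻¹ * X * Pi / Pn := by
    intro X Pn Pi t hP; field_simp
  rw [e2 _ _ _ 0 hn]
  subst hGd
  unfold growth at *
  rw [fwd_split, slopeEnd, slopeStart, slopeEnd, transv, cocycle_eq]
  rw [Matrix.det_fin_two] at hd
  clear h1 hg e1 e2 hG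
  generalize fwd w (cocycle lam φ) i y = B at *
  generalize fwd w (cocycle lam φ) n (y + 2 * Real.pi * w * (i + 1 : ℕ)) = C at *
  simp only [Matrix.mul_apply, Fin.sum_univ_two, Matrix.of_apply, Matrix.cons_val', Matrix.cons_val_zero,
    Matrix.cons_val_one, Matrix.cons_val_fin_one]
  have hC : C 1 1 = (1 + C 0 1 * C 1 0) / C 0 0 := by field_simp; linarith
  rw [hC]
  field_simp
  ring

theorem slopeStart_split (hl : lam ≠ 0) (hi : growth w lam φ i y ≠ 0)
    (hn : growth w lam φ n (y + 2 * Real.pi * w * (i + 1 : ℕ)) ≠ 0)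
    (hg : growth w lam φ (i + 1 + n) y ≠ 0) :
    slopeStart w lam φ (i + 1 + n) y =
      slopeStart w lam φ i y + lam⁻¹ ^ 2 *
        ((-Real.cos (φ (y + 2 * Real.pi * w * i)) +
            slopeStart w lam φ n (y + 2 * Real.pi * w * (i + 1 : ℕ)) *
            Real.sin (φ (y + 2 * Real.pi * w * i))) *
          ((growth w lam φ i y)⁻¹ * (growth w lam φ i y)⁻¹ *
          (transv (φ (y + 2 * Real.pi * w * i)) (slopeEnd w lam φ i y)
          (slopeStart w lam φ n (y + 2 * Real.pi * w * (i + 1 : ℕ))))⁻¹)) := by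
  have h1 := growth_split hi hl hn
  have hG : transv (φ (y + 2 * Real.pi * w * i)) (slopeEnd w lam φ i y)
          (slopeStart w lam φ n (y + 2 * Real.pi * w * (i + 1 : ℕ))) ≠ 0 := by
    intro h0; rw [h0, mul_zero] at h1; exact hg h1
  have hd : (fwd w (cocycle lam φ) i y).det = 1 := det_fwd (fun x => det_cocycle hl x) _ _
  have e1 : slopeStart w lam φ (i + 1 + n) y = lam⁻¹ ^ 2 *
    (fwd w (cocycle lam φ) (i + 1 + n) y 0 1 / growth w lam φ (i + 1 + n) y) := rfl
  have e3 : slopeStart w lam φ i y = lam⁻¹ ^ 2 *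
    (fwd w (cocycle lam φ) i y 0 1 / growth w lam φ i y) := rfl
  rw [e1, e3, ← mul_add, h1]
  congr 1
  rw [div_eq_iff (by rw [← h1]; exact hg)]
  generalize hGd : transv (φ (y + 2 * Real.pi * w * i)) (slopeEnd w lam φ i y)
          (slopeStart w lam φ n (y + 2 * Real.pi * w * (i + 1 : ℕ))) = G at *
  rw [add_mul]
  have e2 : ∀ X Pn Pi : ℝ, Pi ≠ 0 → (X * (Pi⁻¹ * Pi⁻¹ * G⁻¹)) * (lam * Pn * Pi * G)
      = lam * X * Pn / Pi := by
    intro X Pn Pi hP; field_simp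
  rw [e2 _ _ _ hi]
  subst hGd
  unfold growth at *
  rw [fwd_split, slopeEnd, slopeStart, transv, cocycle_eq]
  rw [Matrix.det_fin_two] at hd
  clear h1 hg e1 e2 hG e3
  generalize fwd w (cocycle lam φ) i y = B at *
  generalize fwd w (cocycle lam φ) n (y + 2 * Real.pi * w * (i + 1 : ℕ)) = C at *
  simp only [Matrix.mul_apply, Fin.sum_univ_two, Matrix.of_apply, Matrix.cons_val', Matrix.cons_val_zero,
    Matrix.cons_val_one, Matrix.cons_val_fin_one]
  have hC : B 1 1 = (1 + B 0 1 * B 1 0) / B 0 0 := by field_simp; linarith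
  rw [hC]
  field_simp
  ring

/-- Prolonging a segment in the future changes its start slope by a small amount. -/
theorem slopeStart_add (hl : lam ≠ 0) (hm : growth w lam φ m y ≠ 0)
    (hg : growth w lam φ (m + n) y ≠ 0) :
    slopeStart w lam φ (m + n) y - slopeStart w lam φ m y = lam⁻¹ ^ 2 *
      (fwd w (cocycle lam φ) n (y + 2 * Real.pi * w * m) 0 1 *
        ((growth w lam φ m y)⁻¹ * (growth w lam φ (m + n) y)⁻¹)) := by
  have hd : (fwd w (cocycle lam φ) m y).det = 1 := det_fwd (fun x => det_cocycle hl x) _ _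
  rw [Matrix.det_fin_two] at hd
  unfold growth slopeStart at *
  rw [fwd_add] at *
  generalize fwd w (cocycle lam φ) m y = B at *
  generalize fwd w (cocycle lam φ) n (y + 2 * Real.pi * w * m) = C at *
  simp only [Matrix.mul_apply, Fin.sum_univ_two] at *
  rw [← mul_sub]
  congr 1
  field_simp
  linear_combination (C 0 1) * hd

/-- Prolonging a segment in the past changes its end slope by a small amount. -/
theorem slopeEnd_add (hl : lam ≠ 0)
    (hn : growth w lam φ n (y + 2 * Real.pi * w * m) ≠ 0)
    (hg : growth w lam φ (m + n) y ≠ 0) :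
    slopeEnd w lam φ (m + n) y - slopeEnd w lam φ n (y + 2 * Real.pi * w * m) =
      fwd w (cocycle lam φ) m y 1 0 *
        ((growth w lam φ n (y + 2 * Real.pi * w * m))⁻¹ * (growth w lam φ (m + n) y)⁻¹) := by
  have hd : (fwd w (cocycle lam φ) n (y + 2 * Real.pi * w * m)).det = 1 :=
    det_fwd (fun x => det_cocycle hl x) _ _
  rw [Matrix.det_fin_two] at hd
  unfold growth slopeEnd at *
  rw [fwd_add] at *
  generalize fwd w (cocycle lam φ) m y = B at *
  generalize fwd w (cocycle lam φ) n (y + 2 * Real.pi * w * m) = C at *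
  simp only [Matrix.mul_apply, Fin.sum_univ_two] at *
  rw [div_sub_div _ _ hg hn, ← mul_inv, ← div_eq_mul_inv, mul_comm (C 0 0) (_ + _)]
  congr 1
  linear_combination (B 1 0) * hd

end Split

/-! ### Contracted directions -/

theorem norm_op_unitVec (A : Mat) (θ : ℝ) : ‖op A (unitVec θ)‖ ^ 2 =
    (A 0 0 * Real.cos θ + A 0 1 * Real.sin θ) ^ 2
      + (A 1 0 * Real.cos θ + A 1 1 * Real.sin θ) ^ 2 := by
  rw [EuclideanSpace.norm_sq_eq, Fin.sum_univ_two]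
  simp [op, unitVec]

theorem norm_unitVec (θ : ℝ) : ‖unitVec θ‖ = 1 := by
  have : ‖unitVec θ‖ ^ 2 = 1 := by
    rw [EuclideanSpace.norm_sq_eq, Fin.sum_univ_two]
    simp [unitVec]
  nlinarith [norm_nonneg (unitVec θ)]

theorem contracted_eq_of_norm_sq {A : Mat} {θ₀ c r : ℝ} (hr : 0 < r)
    (h : ∀ θ, ‖op A (unitVec θ)‖ ^ 2 = c - r * Real.cos (2 * (θ - θ₀))) :
    ∃ k : ℤ, contracted A = θ₀ + k * Real.pi := by
  have hmin := (exists_contracted A).choose_spec θ₀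
  have h1 := pow_le_pow_left₀ (norm_nonneg _) hmin 2
  change ‖op A (unitVec (contracted A))‖ ^ 2 ≤ _ at h1
  rw [h, h] at h1
  simp only [sub_self, mul_zero, Real.cos_zero, mul_one] at h1
  have h2 : Real.cos (2 * (contracted A - θ₀)) = 1 :=
    le_antisymm (Real.cos_le_one _) (by
      by_contra hc
      push Not at hc
      nlinarith)
  obtain ⟨k, hk⟩ := (Real.cos_eq_one_iff _).1 h2
  exact ⟨k, by linarith⟩

/-- Angle between the most contracted direction and the kernel of the dominant row, in terms
of the slopes `u` and `v` and of the inverse square `h` of the growth. -/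
def skew (u v h : ℝ) : ℝ := Real.arctan (2 * (h * (v * (1 + u ^ 2) + u * h) *
  ((1 + u ^ 2) ^ 2 + (v * (1 + u ^ 2) + u * h) ^ 2 - h ^ 2)⁻¹)) / 2

/-- The contracted direction of a matrix whose rows, applied to the unit vector of angle
`β + α`, are `p sin α - q cos α` and `r sin α - s cos α` up to the order and the sign. -/
theorem contracted_eq_skew {A : Mat} {β p q r s : ℝ}
    (hA : ∀ α, ‖op A (unitVec (β + α))‖ ^ 2 = (p * Real.sin α - q * Real.cos α) ^ 2
      + (r * Real.sin α - s * Real.cos α) ^ 2)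
    (hdet : p * s - q * r = 1) (hp : 1 < p ^ 2) :
    ∃ k : ℤ, contracted A =
      β + (Real.arctan (q / p) + skew (q / p) (r / p) (p ^ 2)⁻¹) + k * Real.pi := by
  have hp0 : p ≠ 0 := by rintro rfl; norm_num at hp
  set u := q / p
  set v := r / p
  set h := (p ^ 2)⁻¹
  have hq : q = u * p := by simp only [u]; field_simp
  have hr : r = v * p := by simp only [v]; field_simp
  have hh : h * p ^ 2 = 1 := by simp only [h]; field_simp
  have hh1 : h < 1 := inv_lt_one_of_one_lt₀ hp
  have hh0 : 0 < h := by positivity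
  have hs : s = (h + u * v) * p := by
    apply mul_left_cancel₀ hp0
    have : p * ((h + u * v) * p) = h * p ^ 2 + (u * p) * (v * p) := by ring
    rw [this, hh, ← hq, ← hr]; linarith
  set D := (1 + u ^ 2) ^ 2 + (v * (1 + u ^ 2) + u * h) ^ 2 - h ^ 2 with hD
  set y := v * (1 + u ^ 2) + u * h with hy
  have hDpos : 0 < D := by
    have : h ^ 2 < 1 := by nlinarith
    have : (1 : ℝ) ≤ (1 + u ^ 2) ^ 2 := by nlinarith [sq_nonneg u, sq_nonneg (u ^ 2)]
    nlinarith [sq_nonneg y]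
  set Z := 2 * (h * y * D⁻¹) with hZ
  have hZD : Z * D = 2 * h * y := by rw [hZ]; field_simp
  have hU : (0 : ℝ) < 1 + u ^ 2 := by positivity
  have hW : (0 : ℝ) < Real.sqrt (1 + Z ^ 2) := Real.sqrt_pos.2 (by positivity)
  have hW2 : Real.sqrt (1 + Z ^ 2) ^ 2 = 1 + Z ^ 2 := Real.sq_sqrt (by positivity)
  refine contracted_eq_of_norm_sq (c := (p ^ 2 + q ^ 2 + r ^ 2 + s ^ 2) / 2)
    (r := p ^ 2 * D / (1 + u ^ 2) * Real.sqrt (1 + Z ^ 2) / 2) (by positivity) fun θ => ?_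
  obtain ⟨α, rfl⟩ : ∃ α, θ = β + α := ⟨θ - β, by ring⟩
  rw [hA]
  have e : 2 * (β + α - (β + (Real.arctan u + skew u v h)))
      = (2 * α - 2 * Real.arctan u) - Real.arctan Z := by
    rw [skew]; simp only [hZ, hD]; ring
  rw [e, Real.cos_sub, Real.cos_arctan, Real.sin_arctan, Real.cos_sub, Real.sin_sub,
    Real.cos_two_mul (Real.arctan u), Real.sin_two_mul (Real.arctan u), Real.cos_two_mul α,
    Real.sin_two_mul α]
  have c2 : Real.cos (Real.arctan u) ^ 2 = 1 / (1 + u ^ 2) := by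
    rw [Real.cos_arctan, div_pow, Real.sq_sqrt hU.le, one_pow]
  have sc : 2 * Real.sin (Real.arctan u) * Real.cos (Real.arctan u) = 2 * u / (1 + u ^ 2) := by
    rw [Real.cos_arctan, Real.sin_arctan]
    have := Real.sq_sqrt hU.le
    have h3 : (0 : ℝ) < Real.sqrt (1 + u ^ 2) := Real.sqrt_pos.2 hU
    field_simp
    rw [this]
  rw [c2, sc]
  have hsin : Real.sin α ^ 2 = 1 - Real.cos α ^ 2 := by rw [← Real.sin_sq_add_cos_sq α]; ring
  generalize Real.sin α = S at *
  generalize Real.cos α = C at *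
  have e3 : p ^ 2 * D / (1 + u ^ 2) * Real.sqrt (1 + Z ^ 2) / 2 *
      (((2 * C ^ 2 - 1) * (2 * (1 / (1 + u ^ 2)) - 1) + 2 * S * C * (2 * u / (1 + u ^ 2))) *
      (1 / Real.sqrt (1 + Z ^ 2)) +
      (2 * S * C * (2 * (1 / (1 + u ^ 2)) - 1) - (2 * C ^ 2 - 1) * (2 * u / (1 + u ^ 2))) *
      (Z / Real.sqrt (1 + Z ^ 2))) =
      p ^ 2 / (1 + u ^ 2) ^ 2 / 2 *
      (((2 * C ^ 2 - 1) * (1 - u ^ 2) + 2 * S * C * (2 * u)) * D +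
      (2 * S * C * (1 - u ^ 2) - (2 * C ^ 2 - 1) * (2 * u)) * (Z * D)) := by
    field_simp
    ring
  rw [e3, hZD, hq, hr, hs]
  have e4 : ∀ X Y Y' : ℝ, (1 + u ^ 2) ^ 2 * (X - Y) = p ^ 2 / 2 * Y' →
      Y = X - p ^ 2 / (1 + u ^ 2) ^ 2 / 2 * Y' := by
    intro X Y Y' hXY
    field_simp
    linear_combination (-2) * hXY
  refine e4 _ _ _ ?_
  rw [hD, hy]
  linear_combination (-(1 + u ^ 2) ^ 2 * p ^ 2 * (1 + v ^ 2)) * hsin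

/-- The contracted direction of the forward product, relative to the angle of the first matrix. -/
def dirStart (w lam : ℝ) (φ : ℝ → ℝ) (m : ℕ) (y : ℝ) : ℝ :=
  Real.arctan (slopeStart w lam φ m y) +
    skew (slopeStart w lam φ m y) (slopeEnd w lam φ m y) (((lam * growth w lam φ m y) ^ 2)⁻¹)

/-- The contracted direction of the backward product. -/
def dirEnd (w lam : ℝ) (φ : ℝ → ℝ) (m : ℕ) (y : ℝ) : ℝ :=
  Real.arctan (slopeEnd w lam φ m y) +
    skew (slopeEnd w lam φ m y) (slopeStart w lam φ m y) (((lam * growth w lam φ m y) ^ 2)⁻¹)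

theorem norm_fwd_succ (m : ℕ) (x α : ℝ) :
    ‖op (fwd w (cocycle lam φ) (m + 1) x) (unitVec (φ x + α))‖ ^ 2 =
    (lam * growth w lam φ m (x + 2 * Real.pi * w) * Real.sin α -
      lam⁻¹ * fwd w (cocycle lam φ) m (x + 2 * Real.pi * w) 0 1 * Real.cos α) ^ 2 +
    (lam * fwd w (cocycle lam φ) m (x + 2 * Real.pi * w) 1 0 * Real.sin α -
      lam⁻¹ * fwd w (cocycle lam φ) m (x + 2 * Real.pi * w) 1 1 * Real.cos α) ^ 2 := by
  have hx : x + 2 * Real.pi * w * (1 : ℕ) = x + 2 * Real.pi * w := by push_cast; ring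
  rw [norm_op_unitVec, add_comm m 1, fwd_add, fwd_one, hx, growth, cocycle_eq]
  generalize fwd w (cocycle lam φ) m (x + 2 * Real.pi * w) = B
  simp only [Matrix.mul_apply, Fin.sum_univ_two, Matrix.of_apply, Matrix.cons_val', Matrix.cons_val_zero,
    Matrix.cons_val_one, Matrix.cons_val_fin_one]
  have h1 : Real.sin (φ x) * Real.cos (φ x + α) - Real.cos (φ x) * Real.sin (φ x + α)
      = - Real.sin α := by
    rw [← Real.sin_sub, ← Real.sin_neg]; congr 1; ring
  have h2 : Real.cos (φ x) * Real.cos (φ x + α) + Real.sin (φ x) * Real.sin (φ x + α)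
      = Real.cos α := by
    rw [← Real.cos_neg α, ← Real.cos_sub]; congr 1; ring
  have h3 : ∀ b c : ℝ, (b * (lam * Real.sin (φ x)) + c * (lam⁻¹ * Real.cos (φ x))) * Real.cos (φ x + α)
      + (b * -(lam * Real.cos (φ x)) + c * (lam⁻¹ * Real.sin (φ x))) * Real.sin (φ x + α)
      = - (lam * b * Real.sin α - lam⁻¹ * c * Real.cos α) := by
    intro b c
    linear_combination (b * lam) * h1 + (c * lam⁻¹) * h2
  rw [h3, h3, neg_sq, neg_sq]

theorem norm_bwd_succ (hl : lam ≠ 0) (m : ℕ) (x α : ℝ) :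
    ‖op (bwd w (cocycle lam φ) (m + 1) x) (unitVec (0 + α))‖ ^ 2 =
    (lam * growth w lam φ m (x - 2 * Real.pi * w * m) * Real.sin α -
      lam * fwd w (cocycle lam φ) m (x - 2 * Real.pi * w * m) 1 0 * Real.cos α) ^ 2 +
    (lam⁻¹ * fwd w (cocycle lam φ) m (x - 2 * Real.pi * w * m) 0 1 * Real.sin α -
      lam⁻¹ * fwd w (cocycle lam φ) m (x - 2 * Real.pi * w * m) 1 1 * Real.cos α) ^ 2 := by
  rw [norm_op_unitVec, bwd, bwd_eq_inv, inv_of_det_eq_one (det_cocycle hl _),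
    inv_of_det_eq_one (det_fwd (fun x => det_cocycle hl x) _ _), growth, cocycle_eq, zero_add]
  generalize fwd w (cocycle lam φ) m (x - 2 * Real.pi * w * m) = B
  simp only [Matrix.mul_apply, Fin.sum_univ_two, Matrix.of_apply, Matrix.cons_val', Matrix.cons_val_zero,
    Matrix.cons_val_one, Matrix.cons_val_fin_one]
  have h := Real.sin_sq_add_cos_sq (φ (x - 2 * Real.pi * w * (m + 1)))
  generalize Real.sin (φ (x - 2 * Real.pi * w * (m + 1))) = S at *
  generalize Real.cos (φ (x - 2 * Real.pi * w * (m + 1))) = C at *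
  linear_combination ((lam * B 0 0 * Real.sin α - lam * B 1 0 * Real.cos α) ^ 2 +
    (lam⁻¹ * B 0 1 * Real.sin α - lam⁻¹ * B 1 1 * Real.cos α) ^ 2) * h

theorem contracted_fwd (hl : lam ≠ 0) (m : ℕ) (x : ℝ)
    (hp : 1 < (lam * growth w lam φ m (x + 2 * Real.pi * w)) ^ 2) :
    ∃ k : ℤ, contracted (fwd w (cocycle lam φ) (m + 1) x) =
      φ x + dirStart w lam φ m (x + 2 * Real.pi * w) + k * Real.pi := by
  have hd : (fwd w (cocycle lam φ) m (x + 2 * Real.pi * w)).det = 1 :=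
    det_fwd (fun x => det_cocycle hl x) _ _
  rw [Matrix.det_fin_two] at hd
  have hg : growth w lam φ m (x + 2 * Real.pi * w) ≠ 0 := by
    intro h; rw [h] at hp; norm_num at hp
  obtain ⟨k, hk⟩ := contracted_eq_skew (norm_fwd_succ (φ := φ) (w := w) (lam := lam) m x)
    (by unfold growth; field_simp; linarith) hp
  refine ⟨k, ?_⟩
  rw [hk, dirStart]
  have e1 : lam⁻¹ * fwd w (cocycle lam φ) m (x + 2 * Real.pi * w) 0 1 /
      (lam * growth w lam φ m (x + 2 * Real.pi * w)) =
      slopeStart w lam φ m (x + 2 * Real.pi * w) := by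
    rw [slopeStart]; unfold growth at *; field_simp
  have e2 : lam * fwd w (cocycle lam φ) m (x + 2 * Real.pi * w) 1 0 /
      (lam * growth w lam φ m (x + 2 * Real.pi * w)) =
      slopeEnd w lam φ m (x + 2 * Real.pi * w) := by
    rw [slopeEnd]; unfold growth at *; field_simp
  rw [e1, e2]

theorem contracted_bwd (hl : lam ≠ 0) (m : ℕ) (x : ℝ)
    (hp : 1 < (lam * growth w lam φ m (x - 2 * Real.pi * w * m)) ^ 2) :
    ∃ k : ℤ, contracted (bwd w (cocycle lam φ) (m + 1) x) =
      dirEnd w lam φ m (x - 2 * Real.pi * w * m) + k * Real.pi := by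
  have hd : (fwd w (cocycle lam φ) m (x - 2 * Real.pi * w * m)).det = 1 :=
    det_fwd (fun x => det_cocycle hl x) _ _
  rw [Matrix.det_fin_two] at hd
  have hg : growth w lam φ m (x - 2 * Real.pi * w * m) ≠ 0 := by
    intro h; rw [h] at hp; norm_num at hp
  obtain ⟨k, hk⟩ := contracted_eq_skew (norm_bwd_succ (φ := φ) (w := w) hl m x)
    (by unfold growth; field_simp; linarith) hp
  refine ⟨k, ?_⟩
  rw [hk, dirEnd, zero_add]
  have e1 : lam * fwd w (cocycle lam φ) m (x - 2 * Real.pi * w * m) 1 0 /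
      (lam * growth w lam φ m (x - 2 * Real.pi * w * m)) =
      slopeEnd w lam φ m (x - 2 * Real.pi * w * m) := by
    rw [slopeEnd]; unfold growth at *; field_simp
  have e2 : lam⁻¹ * fwd w (cocycle lam φ) m (x - 2 * Real.pi * w * m) 0 1 /
      (lam * growth w lam φ m (x - 2 * Real.pi * w * m)) =
      slopeStart w lam φ m (x - 2 * Real.pi * w * m) := by
    rw [slopeStart]; unfold growth at *; field_simp
  rw [e1, e2]

theorem one_lt_norm_of_sq {A : Mat} {θ : ℝ} (h : 1 < ‖op A (unitVec θ)‖ ^ 2) : 1 < ‖op A‖ := by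
  have h1 := (op A).le_opNorm (unitVec θ)
  rw [norm_unitVec, mul_one] at h1
  nlinarith [norm_nonneg (op A (unitVec θ))]

theorem isHyperbolic_fwd (hl : lam ≠ 0) (m : ℕ) (x : ℝ)
    (hp : 1 < (lam * growth w lam φ m (x + 2 * Real.pi * w)) ^ 2) :
    IsHyperbolic (fwd w (cocycle lam φ) (m + 1) x) := by
  refine ⟨det_fwd (fun x => det_cocycle hl x) _ _,
    one_lt_norm_of_sq (θ := φ x + Real.pi / 2) ?_⟩
  rw [norm_fwd_succ]
  simp only [Real.sin_pi_div_two, Real.cos_pi_div_two, mul_one, mul_zero, sub_zero]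
  nlinarith [sq_nonneg (lam * fwd w (cocycle lam φ) m (x + 2 * Real.pi * w) 1 0)]

theorem isHyperbolic_bwd (hl : lam ≠ 0) (m : ℕ) (x : ℝ)
    (hp : 1 < (lam * growth w lam φ m (x - 2 * Real.pi * w * m)) ^ 2) :
    IsHyperbolic (bwd w (cocycle lam φ) (m + 1) x) := by
  refine ⟨?_, one_lt_norm_of_sq (θ := 0 + Real.pi / 2) ?_⟩
  · rw [bwd_eq_inv, Matrix.det_nonsing_inv, det_fwd (fun x => det_cocycle hl x)]; simp
  · rw [norm_bwd_succ hl]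
    simp only [Real.sin_pi_div_two, Real.cos_pi_div_two, mul_one, mul_zero, sub_zero]
    nlinarith [sq_nonneg (lam⁻¹ * fwd w (cocycle lam φ) m (x - 2 * Real.pi * w * m) 0 1)]

/-- The offset between the angle function and the difference of the contracted directions of
the products over `m + 1` steps in the future and in the past; it does not depend on the value
of the angle function at `x`. -/
def offset (w lam : ℝ) (φ : ℝ → ℝ) (m : ℕ) (x : ℝ) : ℝ :=
  dirStart w lam φ m (x + 2 * Real.pi * w) - dirEnd w lam φ m (x - 2 * Real.pi * w * m)

end Products

/-! ### Distance to the critical points -/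

theorem mul_abs_of_pos {a b : ℝ} (h : 0 < a) : a * |b| = |a * b| := by
  rw [abs_mul, abs_of_pos h]

/-- Distance from `y` to the critical points `c₁ + ℤ π`. -/
def critDist (c₁ y : ℝ) : ℝ := |y - (c₁ + round ((y - c₁) / Real.pi) * Real.pi)|

section CritDist

variable {c₁ y s ρ : ℝ}

theorem critDist_le (k : ℤ) : critDist c₁ y ≤ |y - (c₁ + k * Real.pi)| := by
  have h := round_le ((y - c₁) / Real.pi) k
  have e : ∀ l : ℤ, |y - (c₁ + l * Real.pi)| = |(y - c₁) / Real.pi - l| * Real.pi := by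
    intro l
    rw [← abs_of_pos Real.pi_pos, ← abs_mul, abs_of_pos Real.pi_pos, sub_mul,
      div_mul_cancel₀ _ Real.pi_ne_zero]
    congr 1; ring
  rw [critDist, e, e]
  exact mul_le_mul_of_nonneg_right h Real.pi_pos.le

theorem critDist_le_iff : critDist c₁ y ≤ ρ ↔ y ∈ nearCrit c₁ ρ :=
  ⟨fun h => ⟨_, h⟩, fun ⟨k, hk⟩ => (critDist_le k).trans hk⟩

theorem critDist_nonneg : 0 ≤ critDist c₁ y := abs_nonneg _

theorem critDist_le_pi_div_two : critDist c₁ y ≤ Real.pi / 2 := by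
  have h := abs_sub_round ((y - c₁) / Real.pi)
  have e : critDist c₁ y = |(y - c₁) / Real.pi - round ((y - c₁) / Real.pi)| * Real.pi := by
    rw [critDist, ← abs_of_pos Real.pi_pos, ← abs_mul, abs_of_pos Real.pi_pos, sub_mul,
      div_mul_cancel₀ _ Real.pi_ne_zero]
    congr 1; ring
  rw [e]; nlinarith [Real.pi_pos]

theorem critDist_add_le : critDist c₁ (y + s) ≤ critDist c₁ y + |s| := by
  refine (critDist_le (round ((y - c₁) / Real.pi))).trans ?_
  rw [critDist, show y + s - (c₁ + (round ((y - c₁) / Real.pi) : ℝ) * Real.pi)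
    = y - (c₁ + (round ((y - c₁) / Real.pi) : ℝ) * Real.pi) + s by ring]
  exact abs_add_le _ _

theorem continuous_critDist : Continuous (critDist c₁) := by
  have : LipschitzWith 1 (critDist c₁) := LipschitzWith.of_dist_le_mul fun x z => by
    rw [NNReal.coe_one, one_mul, Real.dist_eq, Real.dist_eq, abs_sub_le_iff]
    constructor
    · have := critDist_add_le (c₁ := c₁) (y := z) (s := x - z)
      rw [add_sub_cancel] at this; linarith
    · have := critDist_add_le (c₁ := c₁) (y := x) (s := z - x)
      rw [add_sub_cancel, abs_sub_comm] at this; linarith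
  exact this.continuous

end CritDist

/-- Quantitative information on the orbits of the rotation of frequency `w`: visits close to the
critical points are separated in time, and they do happen. -/
structure Recurrent (w c₁ κ C₁ : ℝ) : Prop where
  pos : 0 < κ
  sep : ∀ (y : ℝ) (i : ℕ), 0 < i →
    4 * κ ≤ (critDist c₁ y + critDist c₁ (y + 2 * Real.pi * w * i)) * i
  hit : ∀ (y d : ℝ) (m : ℕ), (∀ i < m, d ≤ critDist c₁ (y + 2 * Real.pi * w * i)) → m * d ≤ C₁

/-- No point at distance at most `R` from the critical points returns to that distance before time
`r`, which has size `1 / R`, and at time `r` all these points are at distance at most `3 * R`. -/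
structure IsReturn (w c₁ κ C₁ R : ℝ) (r : ℕ) : Prop where
  pos : 0 < r
  lower : κ ≤ r * R
  upper : r * R ≤ C₁
  free_add : ∀ x, critDist c₁ x ≤ R → ∀ i : ℕ, 0 < i → i < r →
    R < critDist c₁ (x + 2 * Real.pi * w * i)
  free_sub : ∀ x, critDist c₁ x ≤ R → ∀ i : ℕ, 0 < i → i < r →
    R < critDist c₁ (x - 2 * Real.pi * w * i)
  near_add : ∀ x, critDist c₁ x ≤ R → critDist c₁ (x + 2 * Real.pi * w * r) ≤ 3 * R
  near_sub : ∀ x, critDist c₁ x ≤ R → critDist c₁ (x - 2 * Real.pi * w * r) ≤ 3 * R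

/-! ### Continued fractions -/

section Arithmetic

variable {w : ℝ}

theorem exists_int_contsAux (w : ℝ) (n : ℕ) :
    ∃ p q : ℤ, (GenContFract.of w).contsAux n = ⟨(p : ℝ), (q : ℝ)⟩ := by
  induction n using Nat.strong_induction_on with
  | _ n ih =>
    match n with
    | 0 => exact ⟨1, 0, by simp [GenContFract.contsAux]⟩
    | 1 => exact ⟨⌊w⌋, 1, by simp [GenContFract.contsAux, GenContFract.of_h_eq_floor]⟩
    | n + 2 =>
      obtain ⟨p, q, h1⟩ := ih n (by omega)
      obtain ⟨p', q', h2⟩ := ih (n + 1) (by omega)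
      cases hs : (GenContFract.of w).s.get? n with
      | none => exact ⟨p', q', by
          rw [GenContFract.contsAux_stable_step_of_terminated hs, h2]⟩
      | some gp =>
        obtain ⟨ha, z, hz⟩ := GenContFract.of_partNum_eq_one_and_exists_int_partDen_eq hs
        refine ⟨z * p' + p, z * q' + q, ?_⟩
        rw [GenContFract.contsAux_recurrence hs h1 h2, ha, hz]
        simp

theorem not_terminatedAt (hw : Irrational w) (n : ℕ) : ¬ (GenContFract.of w).TerminatedAt n := by
  intro h
  obtain ⟨r, hr⟩ := GenContFract.exists_rat_eq_of_terminates (v := w) ⟨n, h⟩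
  exact hw ⟨r, hr.symm⟩

theorem exists_int_conts (hw : Irrational w) (n : ℕ) : ∃ p p' Q Q' : ℤ,
    q w n = Q ∧ q w (n + 1) = Q' ∧ |w - p / Q| ≤ 1 / (q w n * q w (n + 1)) ∧
      (p * Q' - Q * p' = 1 ∨ p * Q' - Q * p' = -1) := by
  obtain ⟨p, Q, h⟩ := exists_int_contsAux w (n + 1)
  obtain ⟨p', Q', h'⟩ := exists_int_contsAux w (n + 2)
  have hn := not_terminatedAt hw n
  have hdet := SimpContFract.determinant (s := SimpContFract.of w) hn
  have happ := GenContFract.abs_sub_convs_le hn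
  have e1 : (GenContFract.of w).dens n = Q := by
    rw [GenContFract.den_eq_conts_b, GenContFract.nth_cont_eq_succ_nth_contAux, h]
  have e2 : (GenContFract.of w).dens (n + 1) = Q' := by
    rw [GenContFract.den_eq_conts_b, GenContFract.nth_cont_eq_succ_nth_contAux, h']
  have e3 : (GenContFract.of w).nums n = p := by
    rw [GenContFract.num_eq_conts_a, GenContFract.nth_cont_eq_succ_nth_contAux, h]
  have e4 : (GenContFract.of w).nums (n + 1) = p' := by
    rw [GenContFract.num_eq_conts_a, GenContFract.nth_cont_eq_succ_nth_contAux, h']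
  refine ⟨p, p', Q, Q', e1, e2, ?_, ?_⟩
  · rw [GenContFract.conv_eq_num_div_den, e3, e1] at happ
    rw [q, q, e1]; exact happ
  · change (GenContFract.of w).nums n * (GenContFract.of w).dens (n + 1) -
      (GenContFract.of w).dens n * (GenContFract.of w).nums (n + 1) = _ at hdet
    rw [e1, e2, e3, e4] at hdet
    rcases neg_one_pow_eq_or ℝ (n + 1) with h1 | h1
    · left; rw [h1] at hdet; exact_mod_cast hdet
    · right; rw [h1] at hdet; exact_mod_cast hdet

theorem one_le_q (hw : Irrational w) (n : ℕ) : 1 ≤ q w n := by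
  have h := GenContFract.succ_nth_fib_le_of_nth_den (v := w) (n := n) (Or.inr (not_terminatedAt hw _))
  refine le_trans ?_ h
  exact_mod_cast Nat.fib_pos.2 (Nat.succ_pos n)

theorem q_mono (w : ℝ) (n : ℕ) : q w n ≤ q w (n + 1) := GenContFract.of_den_mono

theorem q_add_one_le (hw : Irrational w) (n : ℕ) : q w (n + 1) + 1 ≤ q w (n + 2) := by
  obtain ⟨gp, hgp⟩ : ∃ gp, (GenContFract.of w).s.get? (n + 1) = some gp :=
    Option.ne_none_iff_exists'.1 (not_terminatedAt hw (n + 1))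
  have ha := (GenContFract.of_partNum_eq_one_and_exists_int_partDen_eq hgp).1
  have hb : 1 ≤ gp.b := GenContFract.of_one_le_get?_partDen (GenContFract.partDen_eq_s_b hgp)
  have h := GenContFract.dens_recurrence hgp rfl rfl
  rw [ha] at h
  have h1 := one_le_q hw n
  have h2 := one_le_q hw (n + 1)
  unfold q at *
  rw [h]
  nlinarith

theorem le_q (hw : Irrational w) (n : ℕ) : (n : ℝ) ≤ q w n := by
  induction n with
  | zero => simpa using (zero_le_one.trans (one_le_q hw 0))
  | succ n ih =>
    cases n with
    | zero => simpa using one_le_q hw 1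
    | succ n => have := q_add_one_le hw n; push_cast at *; linarith

/-- Numbers of bounded type are badly approximable. -/
theorem exists_badly_approximable (hw : IsBoundedType w) :
    ∃ c : ℝ, 0 < c ∧ ∀ (j : ℕ) (k : ℤ), 0 < j → c ≤ j * |w * j - k| := by
  obtain ⟨hirr, M, hM, hq⟩ := hw
  have hM1 : 1 ≤ M := by nlinarith [Real.sqrt_nonneg 5, Real.sq_sqrt (show (0:ℝ) ≤ 5 by norm_num)]
  refine ⟨1 / (4 * M), by positivity, fun j k hj => ?_⟩
  have hj1 : (1 : ℝ) ≤ j := by exact_mod_cast hj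
  -- the first convergent with denominator at least `2 j` separates `w j` from the integers
  have hex : ∃ n, 2 * (j : ℝ) ≤ q w n := ⟨2 * j, by have := le_q hirr (2 * j); push_cast at this; exact this⟩
  classical
  set n := Nat.find hex with hn
  have hn1 : 2 * (j : ℝ) ≤ q w n := Nat.find_spec hex
  have hn2 : q w n ≤ 2 * M * j := by
    rcases Nat.eq_zero_or_pos n with h0 | h0
    · rw [h0]
      have : q w 0 = 1 := by simp [q]
      rw [this]; nlinarith
    · obtain ⟨l, hl⟩ := Nat.exists_eq_succ_of_ne_zero h0.ne'
      have h1 : ¬ (2 * (j : ℝ) ≤ q w l) := Nat.find_min hex (by omega)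
      have h2 := hq l
      rw [hl]
      have : q w (l + 1) < M * q w l := h2
      push Not at h1
      nlinarith
  obtain ⟨p, p', Q, Q', e1, e2, happ, hdet⟩ := exists_int_conts hirr n
  have hQ1 := one_le_q hirr n
  have hQQ := q_mono w n
  have hQ0 : (0 : ℝ) < Q := by rw [← e1]; linarith
  -- otherwise `Q` divides `j`, as `p` and `Q` are coprime
  have hne : (j : ℤ) * p - k * Q ≠ 0 := by
    intro h0
    have hdvd : Q ∣ j := by
      rcases hdet with h | h
      · exact ⟨k * Q' - j * p', by linear_combination (-(j : ℤ)) * h + Q' * h0⟩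
      · exact ⟨-(k * Q' - j * p'), by linear_combination ((j : ℤ)) * h - Q' * h0⟩
    have := Int.le_of_dvd (by exact_mod_cast hj) hdvd
    have : (Q : ℝ) ≤ j := by exact_mod_cast this
    rw [← e1] at this; linarith
  have h1 : (1 : ℝ) ≤ |(j : ℝ) * p - k * Q| := by
    have := Int.one_le_abs hne
    exact_mod_cast this
  have h2 : |(j : ℝ) * p - k * Q| = (Q : ℝ) * |(j : ℝ) * (p / Q) - k| := by
    rw [mul_abs_of_pos hQ0]; congr 1; field_simp
  have h3 : |(j : ℝ) * (p / Q) - k| ≤ |w * j - k| + j * |w - p / Q| := by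
    rw [← Nat.abs_cast j, ← abs_mul, Nat.abs_cast]
    refine le_trans (le_of_eq ?_) (abs_sub (w * j - k) (j * (w - p / Q)))
    congr 1; ring
  have h4 : Q * (j * |w - p / Q|) ≤ 1 / 2 := by
    have : (j : ℝ) * |w - p / Q| ≤ j * (1 / (q w n * q w n)) := by
      gcongr
      refine happ.trans ?_
      gcongr
    calc (Q : ℝ) * (j * |w - p / Q|) ≤ Q * (j * (1 / (q w n * q w n))) := by gcongr
      _ = q w n * (j * (1 / (q w n * q w n))) := by rw [e1]
      _ = j / q w n := by field_simp
      _ ≤ 1 / 2 := by rw [div_le_div_iff₀ (by linarith) (by norm_num)]; linarith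
  rw [e1] at hn2
  have h5 : 1 / 2 ≤ Q * |w * j - k| := by nlinarith
  rw [div_le_iff₀ (by positivity)]
  nlinarith [abs_nonneg (w * j - k)]

/-- Bad approximability separates the visits close to the critical points; Dirichlet's approximation
of `2 w` by a fraction, whose denominator is then comparable to the bound imposed on it, produces
visits. -/
theorem exists_recurrent (hw : IsBoundedType w) (c₁ : ℝ) : ∃ κ C₁, Recurrent w c₁ κ C₁ := by
  obtain ⟨c, hc, hbad⟩ := exists_badly_approximable hw
  have hpi := Real.pi_pos
  refine ⟨Real.pi * c / 8, Real.pi * (1 + 1 / c), by positivity, fun y i hi => ?_, fun y d m h => ?_⟩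
  · set k := round ((y - c₁) / Real.pi) with hk
    set l := round ((y + 2 * Real.pi * w * i - c₁) / Real.pi) with hl
    have h1 : |2 * Real.pi * w * i - (l - k) * Real.pi|
        ≤ critDist c₁ y + critDist c₁ (y + 2 * Real.pi * w * i) := by
      rw [critDist, critDist, ← hk, ← hl, add_comm]
      refine le_trans (le_of_eq ?_) (abs_sub _ _)
      congr 1; ring
    have h2 := hbad (2 * i) (l - k) (by omega)
    have h3 : |2 * Real.pi * w * i - (l - k) * Real.pi| =
        Real.pi * |w * (2 * i : ℕ) - (l - k : ℤ)| := by
      rw [← abs_of_pos hpi, ← abs_mul, abs_of_pos hpi]; congr 1; push_cast; ring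
    rw [h3] at h1
    have hi' : (0 : ℝ) < i := by exact_mod_cast hi
    push_cast at h1 h2
    nlinarith [mul_le_mul_of_nonneg_right h1 hi'.le]
  · by_contra! hcon
    have hd : 0 < d := by
      by_contra! hd
      have : (m : ℝ) * d ≤ 0 := mul_nonpos_of_nonneg_of_nonpos (Nat.cast_nonneg m) hd
      have : 0 < Real.pi * (1 + 1 / c) := by positivity
      linarith
    set B := Real.pi * (1 + 1 / c) / d with hB
    have hm0 : 0 < m := by
      rcases Nat.eq_zero_or_pos m with h0 | h0
      · rw [h0, Nat.cast_zero, zero_mul] at hcon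
        have : 0 < Real.pi * (1 + 1 / c) := by positivity
        linarith
      · exact h0
    have hd2 : d ≤ Real.pi / 2 := by
      have := h 0 hm0
      exact this.trans critDist_le_pi_div_two
    have hB1 : 1 ≤ B := by
      rw [hB, le_div_iff₀ hd]
      have : 0 < Real.pi * (1 / c) := by positivity
      nlinarith
    set n := ⌊B⌋₊ with hn
    have hn1 : 0 < n := Nat.floor_pos.2 hB1
    have hnB : B < n + 1 := Nat.lt_floor_add_one B
    have hmB : B < m := by rw [hB, div_lt_iff₀ hd]; exact hcon
    have hnm : n < m := by
      have : (n : ℝ) < m := (Nat.floor_le (by linarith)).trans_lt hmB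
      exact_mod_cast this
    obtain ⟨r, hr1, hr2⟩ := Real.exists_rat_abs_sub_le_and_den_le (2 * w) hn1
    have hden : (0 : ℝ) < r.den := by exact_mod_cast r.den_pos
    have hrr : (r : ℝ) = r.num / r.den := by exact_mod_cast (Rat.num_div_den r).symm
    have hlow : c * (n + 1) ≤ 2 * r.den := by
      have h1 := hbad (2 * r.den) r.num (by have := r.den_pos; omega)
      have h2 : |w * (2 * r.den : ℕ) - r.num| ≤ 1 / (n + 1) := by
        have : |w * (2 * r.den : ℕ) - r.num| = r.den * |2 * w - r| := by
          rw [mul_abs_of_pos hden, hrr]; congr 1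
          push_cast; field_simp
        rw [this]
        calc _ ≤ (r.den : ℝ) * (1 / ((n + 1) * r.den)) := by gcongr
          _ = _ := by field_simp
      have h3 : c ≤ (2 * r.den : ℕ) * (1 / (n + 1)) := h1.trans (by gcongr)
      push_cast at h3
      rw [mul_one_div, le_div_iff₀ (by positivity)] at h3
      linarith
    -- the orbit of length `r.den` is close to the equidistributed points `j * r.num / r.den`
    set s := (y - c₁) / Real.pi with hs
    -- the `j` with `j * r.num = g` modulo `r.den` is sought, `- g / r.den` being nearest to `s`
    set g := round (-s * r.den) with hg
    have hg1 : |s + g / r.den| ≤ 1 / (2 * r.den) := by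
      have h1 := abs_sub_round (-s * r.den)
      have : |s + g / r.den| = |-s * r.den - g| / r.den := by
        rw [← abs_of_pos hden, ← abs_div, abs_of_pos hden, ← abs_neg]; congr 1; field_simp; ring
      rw [this, div_le_div_iff₀ hden (by positivity)]
      nlinarith
    have hcop : IsCoprime r.num (r.den : ℤ) := by
      rw [Int.isCoprime_iff_gcd_eq_one]; exact r.reduced
    obtain ⟨u, v, huv⟩ := hcop
    have hdz : (0 : ℤ) < r.den := by exact_mod_cast r.den_pos
    obtain ⟨j, hj⟩ := Int.eq_ofNat_of_zero_le (Int.emod_nonneg (g * u) hdz.ne')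
    have hjlt : j < r.den := by
      have := Int.emod_lt_of_pos (g * u) hdz
      rw [hj] at this; exact_mod_cast this
    have hjmod : (j : ℤ) = g * u - r.den * (g * u / r.den) := by
      rw [← hj, Int.emod_def]
    set l : ℤ := - g * v - (g * u / r.den) * r.num with hl
    have hjl : (j : ℤ) * r.num = g + r.den * l := by
      rw [hjmod, hl]; linear_combination g * huv
    have hjl' : (j : ℝ) * r.num = g + r.den * l := by exact_mod_cast hjl
    have hclose : |2 * w * j + s - l| ≤ (1 + 1 / c) / (n + 1) := by
      have e : 2 * w * j + s - l = j * (2 * w - r) + (s + g / r.den) := by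
        rw [hrr]
        have : (j : ℝ) * (r.num / r.den) = g / r.den + l := by
          rw [← mul_div_assoc, hjl']; field_simp
        linear_combination this
      rw [e]
      refine (abs_add_le _ _).trans ?_
      rw [abs_mul, Nat.abs_cast, add_div]
      have hjr : (j : ℝ) ≤ r.den := by exact_mod_cast hjlt.le
      refine add_le_add ?_ ?_
      · calc (j : ℝ) * |2 * w - r| ≤ r.den * (1 / ((n + 1) * r.den)) := by gcongr
          _ = _ := by field_simp
      · refine hg1.trans ?_
        rw [div_div, div_le_div_iff₀ (by positivity) (by positivity)]
        linarith
    have h5 := h j (by omega)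
    have h6 := critDist_le (c₁ := c₁) (y := y + 2 * Real.pi * w * j) l
    have h7 : |y + 2 * Real.pi * w * j - (c₁ + l * Real.pi)| = Real.pi * |2 * w * j + s - l| := by
      rw [← abs_of_pos hpi, ← abs_mul, abs_of_pos hpi, hs]; congr 1; field_simp; ring
    rw [h7] at h6
    have h8 : Real.pi * ((1 + 1 / c) / (n + 1)) < d := by
      rw [← mul_div_assoc, div_lt_iff₀ (by positivity)]
      rw [hB, div_lt_iff₀ hd] at hnB
      linarith
    have h9 := mul_le_mul_of_nonneg_left hclose hpi.le
    linarith

/-- The return times `r_n^±` have size `q_n ^ 2`, and they agree. -/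
theorem isReturn_rPlus {c₁ κ C₁ : ℝ} (hrec : Recurrent w c₁ κ C₁) (hw : Irrational w) (n : ℕ) :
    IsReturn w c₁ κ (C₁ + 1) (1 / q w n ^ 2) (rPlus w c₁ n) ∧ rMinus w c₁ n = rPlus w c₁ n := by
  have hq := one_le_q hw n
  set R := 1 / q w n ^ 2 with hR
  have hRpos : 0 < R := by positivity
  have hR1 : R ≤ 1 := by rw [hR, div_le_one (by positivity)]; nlinarith
  have hmem : ∀ x, x ∈ critInt w c₁ n 1 ↔ critDist c₁ x ≤ R := by
    intro x; rw [critInt, one_mul, ← critDist_le_iff]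
  have hsets : {j : ℕ | 0 < j ∧ ∃ x ∈ critInt w c₁ n 1, x - 2 * Real.pi * w * j ∈ critInt w c₁ n 1}
      = {j : ℕ | 0 < j ∧ ∃ x ∈ critInt w c₁ n 1, x + 2 * Real.pi * w * j ∈ critInt w c₁ n 1} := by
    ext j
    constructor
    · rintro ⟨hj, x, h1, h2⟩; exact ⟨hj, _, h2, by simpa using h1⟩
    · rintro ⟨hj, x, h1, h2⟩; exact ⟨hj, _, h2, by simpa using h1⟩
  refine ⟨?_, by rw [rMinus, rPlus, hsets]⟩
  set S := {j : ℕ | 0 < j ∧ ∃ x ∈ critInt w c₁ n 1, x + 2 * Real.pi * w * j ∈ critInt w c₁ n 1} with hS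
  have hC₁ : 0 ≤ C₁ := by simpa using hrec.hit 0 0 0 (by simp)
  obtain ⟨j, hjS, hjR⟩ : ∃ j ∈ S, (j : ℝ) * R ≤ C₁ + 1 := by
    set m := ⌊C₁ / R⌋₊ + 1 with hm
    have hm1 : C₁ < m * R := by
      have := Nat.lt_floor_add_one (C₁ / R)
      rw [div_lt_iff₀ hRpos] at this
      rw [hm]; push_cast; exact this
    have : ¬ ∀ i < m, R ≤ critDist c₁ (c₁ + 2 * Real.pi * w + 2 * Real.pi * w * i) := fun h =>
      absurd (hrec.hit _ _ _ h) (not_le.2 hm1)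
    push Not at this
    obtain ⟨i, hi, hlt⟩ := this
    refine ⟨i + 1, ⟨by omega, c₁, ?_, ?_⟩, ?_⟩
    · rw [hmem, critDist]; simpa using hRpos.le
    · rw [hmem]
      refine le_trans (le_of_eq ?_) hlt.le
      congr 1; push_cast; ring
    · have h1 : ((i + 1 : ℕ) : ℝ) ≤ C₁ / R + 1 := by
        have h2 : i + 1 ≤ ⌊C₁ / R⌋₊ + 1 := by omega
        have h3 : ((i + 1 : ℕ) : ℝ) ≤ ((⌊C₁ / R⌋₊ + 1 : ℕ) : ℝ) := by exact_mod_cast h2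
        have h4 := Nat.floor_le (div_nonneg hC₁ hRpos.le)
        push_cast at *; linarith
      calc ((i + 1 : ℕ) : ℝ) * R ≤ (C₁ / R + 1) * R := by gcongr
        _ = C₁ + R := by field_simp
        _ ≤ _ := by linarith
  have hrS : rPlus w c₁ n ∈ S := Nat.sInf_mem ⟨j, hjS⟩
  have hrj : rPlus w c₁ n ≤ j := Nat.sInf_le hjS
  set r := rPlus w c₁ n with hr
  have hnot : ∀ i, 0 < i → i < r → ∀ x, critDist c₁ x ≤ R →
      R < critDist c₁ (x + 2 * Real.pi * w * i) := by
    intro i h0 hi x hx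
    by_contra! hcon
    have : r ≤ i := Nat.sInf_le ⟨h0, x, (hmem _).2 hx, (hmem _).2 hcon⟩
    omega
  obtain ⟨hr0, x₀, hx₀, hx₁⟩ := hrS
  rw [hmem] at hx₀ hx₁
  obtain ⟨k₀, hk₀⟩ := critDist_le_iff.1 hx₀
  obtain ⟨k₁, hk₁⟩ := critDist_le_iff.1 hx₁
  refine ⟨hr0, ?_, ?_, fun x hx i h0 hi => hnot i h0 hi x hx, fun x hx i h0 hi => ?_,
    fun x hx => ?_, fun x hx => ?_⟩
  · have h1 := hrec.sep x₀ r hr0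
    have : (0 : ℝ) ≤ r := Nat.cast_nonneg r
    have h2 : (critDist c₁ x₀ + critDist c₁ (x₀ + 2 * Real.pi * w * r)) * r ≤ (R + R) * r := by
      gcongr
    linarith [hrec.pos]
  · have : (r : ℝ) ≤ j := by exact_mod_cast hrj
    calc (r : ℝ) * R ≤ j * R := by gcongr
      _ ≤ _ := hjR
  · by_contra! hcon
    have := hnot i h0 hi _ hcon
    rw [sub_add_cancel] at this
    linarith
  · obtain ⟨k, hk⟩ := critDist_le_iff.1 hx
    refine (critDist_le (k + k₁ - k₀)).trans ?_
    rw [abs_le] at *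
    push_cast
    constructor <;> nlinarith
  · obtain ⟨k, hk⟩ := critDist_le_iff.1 hx
    refine (critDist_le (k - k₁ + k₀)).trans ?_
    rw [abs_le] at *
    push_cast
    constructor <;> nlinarith

end Arithmetic

/-! ### Existence of cutoffs -/

/-- The average of `g` over the window of radius `h`. -/
def windowAvg (h : ℝ) (g : ℝ → ℝ) (x : ℝ) : ℝ := (2 * h)⁻¹ * ∫ t in (x - h)..(x + h), g t

section WindowAvg

variable {h : ℝ} {g : ℝ → ℝ}

theorem hasDerivAt_windowAvg (hg : Continuous g) (x : ℝ) :
    HasDerivAt (windowAvg h g) ((2 * h)⁻¹ * (g (x + h) - g (x - h))) x := by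
  have h1 : ∀ z, windowAvg h g z =
      (2 * h)⁻¹ * ((∫ t in (0 : ℝ)..(z + h), g t) - ∫ t in (0 : ℝ)..(z - h), g t) := by
    intro z
    rw [windowAvg, intervalIntegral.integral_interval_sub_left] <;>
      exact hg.intervalIntegrable _ _
  have h2 : ∀ z, HasDerivAt (fun s => ∫ t in (0 : ℝ)..s, g t) (g z) z := fun z =>
    intervalIntegral.integral_hasDerivAt_right (hg.intervalIntegrable _ _)
      (hg.stronglyMeasurableAtFilter _ _) hg.continuousAt
  have h3 := ((h2 (x + h)).comp_add_const x h).sub ((h2 (x - h)).comp_sub_const x h)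
  have h4 := h3.const_mul (2 * h)⁻¹
  exact h4.congr_of_eventuallyEq (Filter.Eventually.of_forall h1)

theorem deriv_windowAvg (hg : Continuous g) :
    deriv (windowAvg h g) = fun x => (2 * h)⁻¹ * (g (x + h) - g (x - h)) :=
  funext fun x => (hasDerivAt_windowAvg hg x).deriv

theorem contDiff_windowAvg (hg : ContDiff ℝ ∞ g) : ContDiff ℝ ∞ (windowAvg h g) := by
  rw [contDiff_infty_iff_deriv, deriv_windowAvg hg.continuous]
  refine ⟨fun x => (hasDerivAt_windowAvg hg.continuous x).differentiableAt, ?_⟩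
  exact contDiff_const.mul ((hg.comp (contDiff_id.add contDiff_const)).sub
    (hg.comp (contDiff_id.sub contDiff_const)))

theorem iteratedDeriv_windowAvg (hg : ContDiff ℝ ∞ g) (r : ℕ) (x : ℝ) :
    iteratedDeriv (r + 1) (windowAvg h g) x =
      (2 * h)⁻¹ * (iteratedDeriv r g (x + h) - iteratedDeriv r g (x - h)) := by
  rw [iteratedDeriv_succ', deriv_windowAvg hg.continuous, iteratedDeriv_const_mul_field]
  have h1 : ContDiff ℝ r fun x => g (x + h) :=
    (hg.of_le (by exact_mod_cast le_top)).comp (contDiff_id.add contDiff_const)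
  have h2 : ContDiff ℝ r fun x => g (x - h) :=
    (hg.of_le (by exact_mod_cast le_top)).comp (contDiff_id.sub contDiff_const)
  have : iteratedDeriv r (fun x => g (x + h) - g (x - h)) x = _ :=
    iteratedDeriv_sub h1.contDiffAt h2.contDiffAt
  rw [this, iteratedDeriv_comp_add_const, iteratedDeriv_comp_sub_const]

theorem windowAvg_mono (hh : 0 < h) {g' : ℝ → ℝ} (hg : Continuous g) (hg' : Continuous g')
    {x : ℝ} (hle : ∀ t ∈ Set.Icc (x - h) (x + h), g t ≤ g' t) :
    windowAvg h g x ≤ windowAvg h g' x := by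
  rw [windowAvg, windowAvg]
  gcongr
  exact intervalIntegral.integral_mono_on (by linarith) (hg.intervalIntegrable _ _)
    (hg'.intervalIntegrable _ _) hle

theorem windowAvg_const (hh : 0 < h) (c x : ℝ) : windowAvg h (fun _ => c) x = c := by
  rw [windowAvg, intervalIntegral.integral_const, smul_eq_mul]
  field_simp
  ring

theorem windowAvg_eq_of_eq (hh : 0 < h) (hg : Continuous g) {x c : ℝ}
    (heq : ∀ t ∈ Set.Icc (x - h) (x + h), g t = c) : windowAvg h g x = c :=
  le_antisymm
    ((windowAvg_mono hh hg continuous_const fun t ht => (heq t ht).le).trans_eq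
      (windowAvg_const hh c x))
    ((windowAvg_const hh c x).symm.trans_le
      (windowAvg_mono hh continuous_const hg fun t ht => (heq t ht).ge))

theorem windowAvg_periodic {p : ℝ} (hg : Function.Periodic g p) :
    Function.Periodic (windowAvg h g) p := by
  intro x
  rw [windowAvg, windowAvg]
  congr 1
  have := intervalIntegral.integral_comp_add_right (a := x - h) (b := x + h) g p
  rw [show x + p - h = x - h + p by ring, show x + p + h = x + h + p by ring, ← this]
  simp only [hg _]

end WindowAvg

/-- A smooth function that is `1` close to the critical points and `0` away from them. -/
theorem exists_plateau (c₁ : ℝ) {a b : ℝ} (ha : 0 ≤ a) (hab : a < b) (hb : b ≤ Real.pi / 2) :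
    ∃ g : ℝ → ℝ, ContDiff ℝ ∞ g ∧ Function.Periodic g (2 * Real.pi) ∧
      (∀ x, g x ∈ Set.Icc (0 : ℝ) 1) ∧ (∀ x, critDist c₁ x ≤ a → g x = 1) ∧
      ∀ x, b ≤ critDist c₁ x → g x = 0 := by
  have hcos : ∀ x, Real.cos (2 * (x - c₁)) = Real.cos (2 * critDist c₁ x) := by
    intro x
    set k := round ((x - c₁) / Real.pi) with hk
    have h1 : Real.cos (2 * critDist c₁ x) = Real.cos (2 * (x - (c₁ + k * Real.pi))) := by
      rw [critDist, ← Real.cos_abs (2 * (x - _)), abs_mul, abs_two]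
    rw [h1, show 2 * (x - (c₁ + k * Real.pi)) = 2 * (x - c₁) - k * (2 * Real.pi) by ring,
      Real.cos_sub_int_mul_two_pi]
  have hlt : Real.cos (2 * b) < Real.cos (2 * a) :=
    Real.strictAntiOn_cos ⟨by linarith, by linarith⟩ ⟨by linarith, by linarith⟩ (by linarith)
  refine ⟨fun x => Real.smoothTransition
    ((Real.cos (2 * (x - c₁)) - Real.cos (2 * b)) / (Real.cos (2 * a) - Real.cos (2 * b))),
    ?_, ?_, ?_, ?_, ?_⟩
  · refine Real.smoothTransition.contDiff.comp ?_
    refine ContDiff.div_const ?_ _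
    exact (Real.contDiff_cos.comp (contDiff_const.mul (contDiff_id.sub contDiff_const))).sub
      contDiff_const
  · intro x
    have : Real.cos (2 * (x + 2 * Real.pi - c₁)) = Real.cos (2 * (x - c₁)) := by
      rw [show 2 * (x + 2 * Real.pi - c₁) = 2 * (x - c₁) + (2 : ℕ) * (2 * Real.pi) by push_cast; ring,
        Real.cos_add_nat_mul_two_pi]
    simp only [this]
  · exact fun x => ⟨Real.smoothTransition.nonneg _, Real.smoothTransition.le_one _⟩
  · intro x hx
    refine Real.smoothTransition.one_of_one_le ?_
    rw [le_div_iff₀ (by linarith), one_mul, hcos]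
    have : Real.cos (2 * a) ≤ Real.cos (2 * critDist c₁ x) :=
      Real.strictAntiOn_cos.antitoneOn ⟨by linarith [critDist_nonneg (c₁ := c₁) (y := x)], by
        linarith⟩ ⟨by linarith, by linarith⟩ (by linarith)
    linarith
  · intro x hx
    refine Real.smoothTransition.zero_of_nonpos ?_
    refine div_nonpos_of_nonpos_of_nonneg ?_ (by linarith)
    rw [hcos]
    have : Real.cos (2 * critDist c₁ x) ≤ Real.cos (2 * b) :=
      Real.strictAntiOn_cos.antitoneOn ⟨by linarith, by linarith⟩ ⟨by linarith, by
        linarith [critDist_le_pi_div_two (c₁ := c₁) (y := x)]⟩ (by linarith)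
    linarith

/-- Averaging `k` times over windows of radius `h` controls `k` derivatives by powers of `1 / h`,
at the cost of enlarging the transition region by `k * h`. -/
theorem exists_plateau_deriv_le (c₁ : ℝ) {a b h : ℝ} (hh : 0 < h) (ha : 0 ≤ a) (hab : a < b)
    (hb : b ≤ Real.pi / 2) (k : ℕ) :
    ∃ g : ℝ → ℝ, ContDiff ℝ ∞ g ∧ Function.Periodic g (2 * Real.pi) ∧
      (∀ x, g x ∈ Set.Icc (0 : ℝ) 1) ∧ (∀ x, critDist c₁ x ≤ a - k * h → g x = 1) ∧
      (∀ x, b + k * h ≤ critDist c₁ x → g x = 0) ∧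
      ∀ r ≤ k, ∀ x, |iteratedDeriv r g x| ≤ (h⁻¹) ^ r := by
  induction k with
  | zero =>
    obtain ⟨g, h1, h2, h3, h4, h5⟩ := exists_plateau c₁ ha hab hb
    refine ⟨g, h1, h2, h3, by simpa using h4, by simpa using h5, fun r hr x => ?_⟩
    obtain rfl : r = 0 := by omega
    rw [iteratedDeriv_zero, pow_zero, abs_of_nonneg (h3 x).1]
    exact (h3 x).2
  | succ k ih =>
    obtain ⟨g, h1, h2, h3, h4, h5, h6⟩ := ih
    have hc := h1.continuous
    have hmem : ∀ x, windowAvg h g x ∈ Set.Icc (0 : ℝ) 1 := fun x =>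
      ⟨(windowAvg_const hh 0 x).symm.trans_le
          (windowAvg_mono hh continuous_const hc fun t _ => (h3 t).1),
        (windowAvg_mono hh hc continuous_const fun t _ => (h3 t).2).trans_eq
          (windowAvg_const hh 1 x)⟩
    have hnear : ∀ x t, t ∈ Set.Icc (x - h) (x + h) →
        critDist c₁ t ≤ critDist c₁ x + h ∧ critDist c₁ x - h ≤ critDist c₁ t := by
      intro x t ht
      have e1 := critDist_add_le (c₁ := c₁) (y := x) (s := t - x)
      have e2 := critDist_add_le (c₁ := c₁) (y := t) (s := x - t)
      rw [add_sub_cancel] at e1 e2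
      have e3 : |t - x| ≤ h := abs_le.2 ⟨by linarith [ht.1], by linarith [ht.2]⟩
      rw [abs_sub_comm] at e2
      constructor <;> linarith
    refine ⟨windowAvg h g, contDiff_windowAvg h1, windowAvg_periodic h2, hmem, ?_, ?_, ?_⟩
    · intro x hx
      refine windowAvg_eq_of_eq hh hc fun t ht => h4 t ?_
      push_cast at hx
      linarith [(hnear x t ht).1]
    · intro x hx
      refine windowAvg_eq_of_eq hh hc fun t ht => h5 t ?_
      push_cast at hx
      linarith [(hnear x t ht).2]
    · intro r hr x
      cases r with
      | zero =>
        rw [iteratedDeriv_zero, pow_zero, abs_of_nonneg (hmem x).1]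
        exact (hmem x).2
      | succ r =>
        rw [iteratedDeriv_windowAvg h1, abs_mul, abs_of_pos (by positivity : 0 < (2 * h)⁻¹)]
        have e1 := h6 r (by omega) (x + h)
        have e2 := h6 r (by omega) (x - h)
        calc (2 * h)⁻¹ * |iteratedDeriv r g (x + h) - iteratedDeriv r g (x - h)|
            ≤ (2 * h)⁻¹ * (h⁻¹ ^ r + h⁻¹ ^ r) := by
              gcongr
              exact (abs_sub _ _).trans (add_le_add e1 e2)
          _ = h⁻¹ ^ (r + 1) := by rw [pow_succ]; field_simp; ring

theorem mem_critInt_iff {w c₁ C x : ℝ} {n : ℕ} :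
    x ∈ critInt w c₁ n C ↔ critDist c₁ x ≤ 1 / (C * q w n ^ 2) := critDist_le_iff.symm

theorem exists_isCutoff {w : ℝ} (hw : Irrational w) (c₁ : ℝ) {N : ℕ} (hN : 100 ≤ N) :
    ∃ f, IsCutoff w c₁ N f := by
  have key : ∀ n ≥ N, ∃ g : ℝ → ℝ, ContDiff ℝ ∞ g ∧ Function.Periodic g (2 * Real.pi) ∧
      (∀ x, g x ∈ Set.Icc (0 : ℝ) 1) ∧ (∀ x ∈ critInt w c₁ n 10, g x = 1) ∧
      (∀ x ∉ critInt w c₁ n 1, g x = 0) ∧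
      ∀ r : ℕ, r ≤ ⌊q w n ^ (1 / 10 : ℝ)⌋₊ → ∀ x, |iteratedDeriv r g x| ≤ q w n ^ (3 * r) := by
    intro n hn
    have hq : 100 ≤ q w n := by
      have h1 : (100 : ℝ) ≤ n := by exact_mod_cast hN.trans hn
      exact h1.trans (le_q hw n)
    set Q := q w n with hQ
    set k := ⌊Q ^ (1 / 10 : ℝ)⌋₊ with hk
    have hk1 : 8 * ((k : ℝ) + 1) ≤ Q := by
      have h1 : (k : ℝ) ≤ Q ^ (1 / 10 : ℝ) := Nat.floor_le (by positivity)
      have h2 : Q ^ (1 / 10 : ℝ) ≤ Real.sqrt Q := by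
        rw [Real.sqrt_eq_rpow]
        exact Real.rpow_le_rpow_of_exponent_le (by linarith) (by norm_num)
      have h3 : (10 : ℝ) ≤ Real.sqrt Q := Real.le_sqrt_of_sq_le (by linarith)
      nlinarith [Real.sq_sqrt (show 0 ≤ Q by linarith)]
    have hR : 1 / Q ^ 2 ≤ 1 := by
      rw [div_le_one (by positivity)]; nlinarith
    have hRpos : 0 < 1 / Q ^ 2 := by positivity
    set R := 1 / Q ^ 2 with hRdef
    -- the `k` averages enlarge the transition region by at most `R / 8` on either side
    set h := R / (8 * (k + 1)) with hh
    have hh0 : 0 < h := by positivity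
    have hkh : k * h ≤ R / 8 := by
      rw [hh, mul_div_assoc', div_le_div_iff₀ (by positivity) (by norm_num)]
      nlinarith
    obtain ⟨g, h1, h2, h3, h4, h5, h6⟩ := exists_plateau_deriv_le c₁ hh0
      (show 0 ≤ R / 4 by positivity) (show R / 4 < R / 2 by linarith)
      (by linarith [Real.pi_gt_three]) k
    refine ⟨g, h1, h2, h3, fun x hx => h4 x ?_, fun x hx => h5 x ?_, fun r hr x => ?_⟩
    · rw [mem_critInt_iff, ← hQ] at hx
      have : 1 / (10 * Q ^ 2) = R / 10 := by rw [hRdef]; field_simp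
      rw [this] at hx; linarith
    · rw [mem_critInt_iff, one_mul] at hx
      push Not at hx
      linarith
    · refine (h6 r hr x).trans ?_
      rw [pow_mul]
      refine pow_le_pow_left₀ (by positivity) ?_ r
      have : h⁻¹ = 8 * (k + 1) * Q ^ 2 := by rw [hh, hRdef]; field_simp
      rw [this]
      nlinarith [sq_nonneg Q]
  choose! f hf using key
  exact ⟨f, fun n hn => (hf n hn).1, fun n hn => (hf n hn).2.1, fun n hn => (hf n hn).2.2.2.1,
    fun n hn x _ => (hf n hn).2.2.1 x, fun n hn => (hf n hn).2.2.2.2.1,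
    fun n hn => (hf n hn).2.2.2.2.2⟩

/-! ### Jets of slopes and of contracted directions -/

theorem contDiff_cocycle {φ : ℝ → ℝ} (lam : ℝ) (hφ : ContDiff ℝ ∞ φ) (i j : Fin 2) :
    ContDiff ℝ ∞ fun x => cocycle lam φ x i j := by
  simp only [cocycle_eq]
  have hs : ContDiff ℝ ∞ fun x => Real.sin (φ x) := hφ.sin
  have hc : ContDiff ℝ ∞ fun x => Real.cos (φ x) := hφ.cos
  fin_cases i <;> fin_cases j
  · exact contDiff_const.mul hs
  · exact (contDiff_const.mul hc).neg
  · exact contDiff_const.mul hc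
  · exact contDiff_const.mul hs

theorem contDiff_fwd {w lam : ℝ} {φ : ℝ → ℝ} (hφ : ContDiff ℝ ∞ φ) (m : ℕ) (i j : Fin 2) :
    ContDiff ℝ ∞ fun y => fwd w (cocycle lam φ) m y i j := by
  induction m generalizing i with
  | zero => simp only [fwd]; exact contDiff_const
  | succ m ih =>
    simp only [fwd, Matrix.mul_apply, Fin.sum_univ_two]
    exact (((contDiff_cocycle lam hφ i 0).comp (contDiff_id.add contDiff_const)).mul (ih 0)).add
      (((contDiff_cocycle lam hφ i 1).comp (contDiff_id.add contDiff_const)).mul (ih 1))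

theorem contDiff_growth {w lam : ℝ} {φ : ℝ → ℝ} (hφ : ContDiff ℝ ∞ φ) (m : ℕ) :
    ContDiff ℝ ∞ (growth w lam φ m) := contDiff_fwd hφ m 0 0

theorem contDiffAt_comp_add {f : ℝ → ℝ} {x s : ℝ} (h : ContDiffAt ℝ ∞ f (x + s)) :
    ContDiffAt ℝ ∞ (fun z => f (z + s)) x :=
  ContDiffAt.comp x h (contDiffAt_id.add contDiffAt_const)

/-- Smoothness at `x` together with a bound for the jet seminorm there. -/
structure JetLe (k : ℕ) (ρ x : ℝ) (f : ℝ → ℝ) (b : ℝ) : Prop where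
  smooth : ContDiffAt ℝ ∞ f x
  le : jetNorm k ρ x f ≤ b

namespace JetLe

variable {k : ℕ} {ρ x : ℝ} {f g : ℝ → ℝ} {b c : ℝ}

theorem mono (h : JetLe k ρ x f b) (hbc : b ≤ c) : JetLe k ρ x f c := ⟨h.smooth, h.le.trans hbc⟩

theorem nonneg (hρ : 0 ≤ ρ) (h : JetLe k ρ x f b) : 0 ≤ b := (jetNorm_nonneg hρ).trans h.le

theorem abs_le (hρ : 0 ≤ ρ) (h : JetLe k ρ x f b) : |f x| ≤ b := (abs_le_jetNorm hρ).trans h.le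

theorem add (hρ : 0 ≤ ρ) (hf : JetLe k ρ x f b) (hg : JetLe k ρ x g c) :
    JetLe k ρ x (fun z => f z + g z) (b + c) :=
  ⟨hf.smooth.add hg.smooth, (jetNorm_add_le hρ hf.smooth hg.smooth).trans (add_le_add hf.le hg.le)⟩

theorem sub (hρ : 0 ≤ ρ) (hf : JetLe k ρ x f b) (hg : JetLe k ρ x g c) :
    JetLe k ρ x (fun z => f z - g z) (b + c) :=
  ⟨hf.smooth.sub hg.smooth, (jetNorm_sub_le hρ hf.smooth hg.smooth).trans (add_le_add hf.le hg.le)⟩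

theorem neg (hf : JetLe k ρ x f b) : JetLe k ρ x (fun z => - f z) b :=
  ⟨hf.smooth.neg, jetNorm_neg.trans_le hf.le⟩

theorem mul (hρ : 0 ≤ ρ) (hf : JetLe k ρ x f b) (hg : JetLe k ρ x g c) :
    JetLe k ρ x (fun z => f z * g z) (b * c) :=
  ⟨hf.smooth.mul hg.smooth, (jetNorm_mul_le hρ hf.smooth hg.smooth).trans
    (mul_le_mul hf.le hg.le (jetNorm_nonneg hρ) (hf.nonneg hρ))⟩

theorem const (c : ℝ) : JetLe k ρ x (fun _ => c) |c| := ⟨contDiffAt_const, (jetNorm_const c).le⟩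

theorem const_mul (c : ℝ) (hf : JetLe k ρ x f b) : JetLe k ρ x (fun z => c * f z) (|c| * b) :=
  ⟨contDiffAt_const.mul hf.smooth, by
    rw [jetNorm_const_mul]; exact mul_le_mul_of_nonneg_left hf.le (abs_nonneg c)⟩

theorem congr (hf : JetLe k ρ x f b) (h : g =ᶠ[nhds x] f) : JetLe k ρ x g b :=
  ⟨hf.smooth.congr_of_eventuallyEq h, (jetNorm_congr h).trans_le hf.le⟩

theorem comp_add {s : ℝ} (hf : JetLe k ρ (x + s) f b) : JetLe k ρ x (fun z => f (z + s)) b :=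
  ⟨contDiffAt_comp_add hf.smooth, (jetNorm_comp_add s).trans_le hf.le⟩

/-- Inverse of a small perturbation of `1`. -/
theorem inv_one_add (hρ : 0 ≤ ρ) (hf : JetLe k ρ x f b) (hb : b ≤ 1 / 2) :
    1 + f x ≠ 0 ∧ JetLe k ρ x (fun z => (1 + f z)⁻¹) 2 := by
  have hs : ContDiffAt ℝ ∞ (fun z => 1 + f z) x := contDiffAt_const.add hf.smooth
  have ho : jetOsc k ρ x (fun z => 1 + f z) ≤ jetOsc k ρ x f := by
    refine (jetOsc_add_le hρ contDiffAt_const hf.smooth).trans ?_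
    rw [jetOsc_const, zero_add]
  have h1 := hf.le
  rw [jetNorm_eq] at h1
  have h2 : 1 - |f x| ≤ |1 + f x| := by
    have := abs_sub_abs_le_abs_sub 1 (-f x)
    rw [abs_one, abs_neg, sub_neg_eq_add] at this; exact this
  have h3 := jetOsc_nonneg (k := k) (x := x) (f := f) hρ
  have hne : 1 + f x ≠ 0 := by intro h0; rw [h0, abs_zero] at h2; linarith
  refine ⟨hne, hs.inv hne, (jetNorm_inv_le hρ hs (by linarith)).trans ?_⟩
  rw [inv_le_comm₀ (by linarith) (by norm_num)]
  linarith

theorem arctan (hρ : 0 ≤ ρ) (hf : JetLe k ρ x f b) (hb : b ≤ 1 / 2) :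
    JetLe k ρ x (fun z => Real.arctan (f z)) ((2 * k + 1) * b) :=
  ⟨Real.contDiff_arctan.contDiffAt.comp x hf.smooth,
    (jetNorm_arctan_le hρ hf.smooth (hf.le.trans hb)).trans
      (mul_le_mul_of_nonneg_left hf.le (by positivity))⟩

theorem arctan_sub (hρ : 0 ≤ ρ) {d : ℝ} (hf : JetLe k ρ x f (1 / 100)) (hg : JetLe k ρ x g (1 / 100))
    (hd : JetLe k ρ x (fun z => f z - g z) d) (hd4 : d ≤ 1 / 4) :
    JetLe k ρ x (fun z => Real.arctan (f z) - Real.arctan (g z)) ((2 * k + 1) * (2 * d)) := by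
  have h1 := (hf.mul hρ hg).inv_one_add hρ (by norm_num)
  have h2 := ((hd.mul hρ h1.2).mono (c := 2 * d) (by linarith)).arctan hρ (by linarith)
  refine h2.congr ?_
  have hlt : f x * g x > -1 := by
    have a1 := hf.abs_le hρ
    have a2 := hg.abs_le hρ
    have : |f x * g x| ≤ 1 / 100 * (1 / 100) := by
      rw [abs_mul]; exact mul_le_mul a1 a2 (abs_nonneg _) (by norm_num)
    linarith [neg_abs_le (f x * g x)]
  have hev : ∀ᶠ z in nhds x, f z * g z > -1 :=
    (hf.smooth.continuousAt.mul hg.smooth.continuousAt).eventually (lt_mem_nhds hlt)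
  filter_upwards [hev] with z hz
  rw [sub_eq_add_neg, ← Real.arctan_neg, Real.arctan_add (by linarith), div_eq_mul_inv]
  congr 2; ring

theorem skew (hρ : 0 ≤ ρ) {h : ℝ → ℝ} (hf : JetLe k ρ x f (1 / 100)) (hg : JetLe k ρ x g (1 / 100))
    (hh : JetLe k ρ x h b) (hb : b ≤ 1 / 100) :
    JetLe k ρ x (fun z => FlatCocycle.skew (f z) (g z) (h z)) ((2 * k + 1) * (2 * b)) := by
  have hb0 := hh.nonneg hρ
  have hff := hf.mul hρ hf
  have h1 := (const (k := k) (ρ := ρ) (x := x) 1).add hρ hff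
  have hy := (hg.mul hρ h1).add hρ (hf.mul hρ (hh.mono hb))
  have hD := (((hff.const_mul 2).add hρ (hff.mul hρ hff)).add hρ (hy.mul hρ hy)).sub hρ
    ((hh.mono hb).mul hρ (hh.mono hb))
  have hDi := (hD.inv_one_add hρ (by norm_num)).2
  have ha := (((hh.mul hρ hy).mul hρ hDi).const_mul 2).mono (c := 4 * b) (by
    norm_num; nlinarith)
  have := (ha.arctan hρ (by linarith)).const_mul (1 / 2)
  refine (this.mono (le_of_eq ?_)).congr (Filter.Eventually.of_forall fun z => ?_)
  · rw [abs_of_pos (by norm_num)]; ring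
  · simp only [FlatCocycle.skew]
    rw [div_eq_mul_inv, mul_comm, one_div]
    congr 2
    ring_nf

end JetLe

section Jets

variable {w lam K ρ : ℝ} {k : ℕ} {φ : ℝ → ℝ}

/-- Crude bound for the jets of the entries of a product. -/
theorem jetLe_fwd (hρ : 0 ≤ ρ) (hl : 1 ≤ lam) (hφ : ContDiff ℝ ∞ φ) (m : ℕ) (y : ℝ)
    (hj : ∀ i < m, jetNorm k ρ (y + 2 * Real.pi * w * i) (fun z => Real.sin (φ z)) ≤ 2 ∧
      jetNorm k ρ (y + 2 * Real.pi * w * i) (fun z => Real.cos (φ z)) ≤ 2) (a b : Fin 2) :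
    JetLe k ρ y (fun z => fwd w (cocycle lam φ) m z a b) ((4 * lam) ^ m) := by
  refine ⟨(contDiff_fwd hφ m a b).contDiffAt, ?_⟩
  induction m generalizing a with
  | zero =>
    simp only [fwd, jetNorm_const, pow_zero]
    rw [Matrix.one_apply]
    split_ifs <;> simp
  | succ m ih =>
    have ih' := ih fun i hi => hj i (by omega)
    obtain ⟨hs, hc⟩ := hj m (by omega)
    have hl0 : 0 < lam := by linarith
    have hli : lam⁻¹ ≤ lam := (inv_le_one_of_one_le₀ hl).trans hl
    have hS : JetLe k ρ (y + 2 * Real.pi * w * m) (fun z => Real.sin (φ z)) 2 :=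
      ⟨hφ.sin.contDiffAt, hs⟩
    have hC : JetLe k ρ (y + 2 * Real.pi * w * m) (fun z => Real.cos (φ z)) 2 :=
      ⟨hφ.cos.contDiffAt, hc⟩
    have hA : ∀ a b : Fin 2, JetLe k ρ (y + 2 * Real.pi * w * m)
        (fun z => cocycle lam φ z a b) (2 * lam) := by
      intro a b
      simp only [cocycle_eq]
      have e1 : |lam| * 2 ≤ 2 * lam := by rw [abs_of_pos hl0]; linarith
      have e2 : |lam⁻¹| * 2 ≤ 2 * lam := by rw [abs_of_pos (inv_pos.2 hl0)]; linarith
      fin_cases a <;> fin_cases b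
      · exact (hS.const_mul lam).mono e1
      · exact ((hC.const_mul lam).mono e1).neg
      · exact (hC.const_mul lam⁻¹).mono e2
      · exact (hS.const_mul lam⁻¹).mono e2
    have hB : ∀ a, JetLe k ρ y (fun z => fwd w (cocycle lam φ) m z a b) ((4 * lam) ^ m) :=
      fun a => ⟨(contDiff_fwd hφ m a b).contDiffAt, ih' a⟩
    have := ((hA a 0).comp_add.mul hρ (hB 0)).add hρ ((hA a 1).comp_add.mul hρ (hB 1))
    simp only [fwd, Matrix.mul_apply, Fin.sum_univ_two]
    refine this.le.trans (le_of_eq ?_)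
    rw [pow_succ]; ring

/-- Jet bounds for the product along the segment of length `m` that starts at `y`. -/
structure JetGood (w lam K : ℝ) (k : ℕ) (ρ : ℝ) (φ : ℝ → ℝ) (m : ℕ) (y : ℝ) : Prop where
  growth_ne : growth w lam φ m y ≠ 0
  inv_le : jetNorm k ρ y (fun z => (growth w lam φ m z)⁻¹) ≤ 2 * (Real.exp K / lam) ^ m
  end_le : jetNorm k ρ y (slopeEnd w lam φ m) ≤ 1 / 100
  start_le : jetNorm k ρ y (slopeStart w lam φ m) ≤ 1 / 100
  trig_le : ∀ i < m, jetNorm k ρ (y + 2 * Real.pi * w * i) (fun z => Real.sin (φ z)) ≤ 2 ∧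
      jetNorm k ρ (y + 2 * Real.pi * w * i) (fun z => Real.cos (φ z)) ≤ 2

theorem contDiffAt_slopeEnd (hφ : ContDiff ℝ ∞ φ) {m : ℕ} {y : ℝ} (h : growth w lam φ m y ≠ 0) :
    ContDiffAt ℝ ∞ (slopeEnd w lam φ m) y :=
  (contDiff_fwd hφ m 1 0).contDiffAt.div (contDiff_fwd hφ m 0 0).contDiffAt h

theorem contDiffAt_slopeStart (hφ : ContDiff ℝ ∞ φ) {m : ℕ} {y : ℝ}
    (h : growth w lam φ m y ≠ 0) : ContDiffAt ℝ ∞ (slopeStart w lam φ m) y :=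
  contDiffAt_const.mul ((contDiff_fwd hφ m 0 1).contDiffAt.div (contDiff_fwd hφ m 0 0).contDiffAt h)

namespace JetGood

variable {m n : ℕ} {y : ℝ}

theorem jetLe_inv (hφ : ContDiff ℝ ∞ φ) (h : JetGood w lam K k ρ φ m y) :
    JetLe k ρ y (fun z => (growth w lam φ m z)⁻¹) (2 * (Real.exp K / lam) ^ m) :=
  ⟨(contDiff_growth hφ m).contDiffAt.inv h.growth_ne, h.inv_le⟩

theorem jetLe_end (hφ : ContDiff ℝ ∞ φ) (h : JetGood w lam K k ρ φ m y) :
    JetLe k ρ y (slopeEnd w lam φ m) (1 / 100) := ⟨contDiffAt_slopeEnd hφ h.growth_ne, h.end_le⟩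

theorem jetLe_start (hφ : ContDiff ℝ ∞ φ) (h : JetGood w lam K k ρ φ m y) :
    JetLe k ρ y (slopeStart w lam φ m) (1 / 100) :=
  ⟨contDiffAt_slopeStart hφ h.growth_ne, h.start_le⟩

theorem eventually_ne (hφ : ContDiff ℝ ∞ φ) (h : JetGood w lam K k ρ φ m y) :
    ∀ᶠ z in nhds y, growth w lam φ m z ≠ 0 :=
  (contDiff_growth hφ m).continuous.continuousAt.eventually_ne h.growth_ne

theorem start_add_sub (hρ : 0 ≤ ρ) (hl : 1 ≤ lam) (hφ : ContDiff ℝ ∞ φ)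
    (h : JetGood w lam K k ρ φ m y) (h' : JetGood w lam K k ρ φ (m + n) y) :
    JetLe k ρ y (fun z => slopeStart w lam φ (m + n) z - slopeStart w lam φ m z)
      (4 * ((4 * lam) ^ n * (Real.exp K / lam) ^ m * (Real.exp K / lam) ^ (m + n))) := by
  have hl0 : 0 < lam := by linarith
  have hN : JetLe k ρ (y + 2 * Real.pi * w * m)
      (fun z => fwd w (cocycle lam φ) n z 0 1) ((4 * lam) ^ n) := by
    refine jetLe_fwd hρ hl hφ n _ (fun i hi => ?_) 0 1
    have := h'.trig_le (m + i) (by omega)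
    rw [show y + 2 * Real.pi * w * m + 2 * Real.pi * w * i = y + 2 * Real.pi * w * (m + i : ℕ) by
      push_cast; ring]
    exact this
  have h1 := (hN.comp_add.mul hρ ((h.jetLe_inv hφ).mul hρ (h'.jetLe_inv hφ))).const_mul (lam⁻¹ ^ 2)
  have hle : lam⁻¹ ^ 2 ≤ 1 := pow_le_one₀ (by positivity) (inv_le_one_of_one_le₀ hl)
  refine (h1.mono ?_).congr ?_
  · rw [abs_of_pos (by positivity)]
    refine (mul_le_of_le_one_left (by positivity) hle).trans (le_of_eq ?_)
    ring
  · filter_upwards [h.eventually_ne hφ, h'.eventually_ne hφ] with z hz hz'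
    exact slopeStart_add hl0.ne' hz hz'

theorem end_add_sub (hρ : 0 ≤ ρ) (hl : 1 ≤ lam) (hφ : ContDiff ℝ ∞ φ)
    (h : JetGood w lam K k ρ φ n (y + 2 * Real.pi * w * m))
    (h' : JetGood w lam K k ρ φ (m + n) y) :
    JetLe k ρ y (fun z => slopeEnd w lam φ (m + n) z - slopeEnd w lam φ n (z + 2 * Real.pi * w * m))
      (4 * ((4 * lam) ^ m * (Real.exp K / lam) ^ n * (Real.exp K / lam) ^ (n + m))) := by
  have hl0 : 0 < lam := by linarith
  have hN : JetLe k ρ y (fun z => fwd w (cocycle lam φ) m z 1 0) ((4 * lam) ^ m) :=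
    jetLe_fwd hρ hl hφ m _ (fun i hi => h'.trig_le i (by omega)) 1 0
  have h1 := hN.mul hρ ((h.jetLe_inv hφ).comp_add.mul hρ (h'.jetLe_inv hφ))
  refine (h1.mono (le_of_eq (by rw [add_comm n m]; ring))).congr ?_
  have hc : ContinuousAt (fun z : ℝ => z + 2 * Real.pi * w * m) y := by fun_prop
  filter_upwards [hc.eventually (h.eventually_ne hφ), h'.eventually_ne hφ] with z hz hz'
  exact slopeEnd_add hl0.ne' hz hz'

end JetGood

/-- Conditions under which lengths of size `X` make the growth win over all losses. -/
structure Dominates (lam K κ₂ C : ℝ) : Prop where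
  one_le : 1 ≤ lam
  K_nonneg : 0 ≤ K
  κ_pos : 0 < κ₂
  le : 2 * C * (K + Real.log 4) ≤ κ₂ * Real.log lam
  eight_le : 8 ≤ κ₂ * Real.log lam

/-- The rate of the bounds `exp (- rate * X)` on scale `X`. -/
def rate (κ₂ lam : ℝ) : ℝ := κ₂ * Real.log lam

theorem Dominates.prod_le {κ₂ C X : ℝ} (hd : Dominates lam K κ₂ C) (hX : 0 ≤ X) {m n : ℕ}
    (hm : κ₂ * X ≤ m) (hn : ((m + n : ℕ) : ℝ) ≤ C * X) :
    (4 * lam) ^ n * (Real.exp K / lam) ^ m * (Real.exp K / lam) ^ (m + n)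
      ≤ Real.exp (-(rate κ₂ lam * X)) := by
  have hl0 : 0 < lam := by linarith [hd.one_le]
  have hlog : 0 ≤ Real.log lam := Real.log_nonneg hd.one_le
  have h4 : 0 ≤ Real.log 4 := Real.log_nonneg (by norm_num)
  have e1 : (4 * lam) ^ n = Real.exp (n * (Real.log 4 + Real.log lam)) := by
    rw [← Real.log_mul (by norm_num) hl0.ne', Real.exp_nat_mul, Real.exp_log (by positivity)]
  have e2 : ∀ l : ℕ, (Real.exp K / lam) ^ l = Real.exp (l * (K - Real.log lam)) := by
    intro l
    rw [Real.exp_nat_mul, Real.exp_sub, Real.exp_log hl0]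
  rw [e1, e2, e2, ← Real.exp_add, ← Real.exp_add, Real.exp_le_exp, rate]
  push_cast at hn ⊢
  have hK := hd.K_nonneg
  have h1 : (n : ℝ) * Real.log 4 + (2 * m + n) * K ≤ 2 * (m + n) * (K + Real.log 4) := by
    nlinarith [Nat.cast_nonneg (α := ℝ) m, Nat.cast_nonneg (α := ℝ) n,
      mul_nonneg (Nat.cast_nonneg (α := ℝ) m) h4, mul_nonneg (Nat.cast_nonneg (α := ℝ) n) h4,
      mul_nonneg (Nat.cast_nonneg (α := ℝ) n) hK]
  have h2 : 2 * ((m : ℝ) + n) * (K + Real.log 4) ≤ 2 * (C * X) * (K + Real.log 4) := by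
    have : 0 ≤ K + Real.log 4 := by linarith
    nlinarith
  have h3 : 2 * (C * X) * (K + Real.log 4) ≤ κ₂ * Real.log lam * X := by
    have := mul_le_mul_of_nonneg_right hd.le hX
    linarith
  have h4' : κ₂ * X * Real.log lam ≤ m * Real.log lam := mul_le_mul_of_nonneg_right hm hlog
  nlinarith

theorem Dominates.exp_le {κ₂ C X : ℝ} (hd : Dominates lam K κ₂ C) (hX : 1 ≤ X) :
    Real.exp (-(rate κ₂ lam * X)) ≤ 1 / 800 := by
  have h1 : 8 ≤ rate κ₂ lam * X := by have := hd.eight_le; rw [rate]; nlinarith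
  have h2 : Real.exp (-(rate κ₂ lam * X)) ≤ Real.exp (-8) := Real.exp_le_exp.2 (by linarith)
  refine h2.trans ?_
  rw [Real.exp_neg, inv_le_comm₀ (Real.exp_pos _) (by norm_num)]
  have h3 : (2.7 : ℝ) ^ 8 ≤ Real.exp 1 ^ 8 :=
    pow_le_pow_left₀ (by norm_num) (by linarith [Real.exp_one_gt_d9]) 8
  rw [← Real.exp_nat_mul] at h3
  norm_num at h3 ⊢
  linarith

namespace JetGood

variable {m m' : ℕ} {x y X κ₂ C : ℝ}

theorem start_sub (hρ : 0 ≤ ρ) (hd : Dominates lam K κ₂ C) (hX : 0 ≤ X) (hφ : ContDiff ℝ ∞ φ)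
    (h : JetGood w lam K k ρ φ m y) (h' : JetGood w lam K k ρ φ m' y)
    (hm : κ₂ * X ≤ m) (hm' : κ₂ * X ≤ m') (hC : m ≤ C * X) (hC' : m' ≤ C * X) :
    JetLe k ρ y (fun z => slopeStart w lam φ m z - slopeStart w lam φ m' z)
      (4 * Real.exp (-(rate κ₂ lam * X))) := by
  rcases le_total m m' with hle | hle
  · obtain ⟨n, rfl⟩ := Nat.exists_eq_add_of_le hle
    have := ((h.start_add_sub hρ hd.one_le hφ h').mono
      (mul_le_mul_of_nonneg_left (hd.prod_le hX hm hC') (by norm_num))).neg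
    simpa only [neg_sub] using this
  · obtain ⟨n, rfl⟩ := Nat.exists_eq_add_of_le hle
    exact (h'.start_add_sub hρ hd.one_le hφ h).mono
      (mul_le_mul_of_nonneg_left (hd.prod_le hX hm' hC) (by norm_num))

theorem end_sub_aux (hρ : 0 ≤ ρ) (hd : Dominates lam K κ₂ C) (hX : 0 ≤ X) (hφ : ContDiff ℝ ∞ φ)
    {n : ℕ} (h : JetGood w lam K k ρ φ n (x - 2 * Real.pi * w * n))
    (h' : JetGood w lam K k ρ φ (m + n) (x - 2 * Real.pi * w * (m + n : ℕ)))
    (hm : κ₂ * X ≤ n) (hC' : (m + n : ℕ) ≤ C * X) :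
    JetLe k ρ x (fun z => slopeEnd w lam φ (m + n) (z - 2 * Real.pi * w * (m + n : ℕ)) -
        slopeEnd w lam φ n (z - 2 * Real.pi * w * n))
      (4 * Real.exp (-(rate κ₂ lam * X))) := by
  have e : ∀ z : ℝ, z - 2 * Real.pi * w * (m + n : ℕ) + 2 * Real.pi * w * m =
      z - 2 * Real.pi * w * n := fun z => by push_cast; ring
  rw [← e x] at h
  have h1 := (h.end_add_sub hρ hd.one_le hφ h').mono
      (mul_le_mul_of_nonneg_left (hd.prod_le hX hm (by rwa [add_comm])) (by norm_num))
  rw [sub_eq_add_neg] at h1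
  have h2 := h1.comp_add
  simpa only [← sub_eq_add_neg, e] using h2

theorem end_sub (hρ : 0 ≤ ρ) (hd : Dominates lam K κ₂ C) (hX : 0 ≤ X) (hφ : ContDiff ℝ ∞ φ)
    (h : JetGood w lam K k ρ φ m (x - 2 * Real.pi * w * m))
    (h' : JetGood w lam K k ρ φ m' (x - 2 * Real.pi * w * m'))
    (hm : κ₂ * X ≤ m) (hm' : κ₂ * X ≤ m') (hC : m ≤ C * X) (hC' : m' ≤ C * X) :
    JetLe k ρ x (fun z => slopeEnd w lam φ m (z - 2 * Real.pi * w * m) -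
        slopeEnd w lam φ m' (z - 2 * Real.pi * w * m'))
      (4 * Real.exp (-(rate κ₂ lam * X))) := by
  rcases le_total m m' with hle | hle
  · obtain ⟨n, rfl⟩ := Nat.exists_eq_add_of_le' hle
    have := (h.end_sub_aux hρ hd hX hφ h' hm hC').neg
    simpa only [neg_sub] using this
  · obtain ⟨n, rfl⟩ := Nat.exists_eq_add_of_le' hle
    exact h'.end_sub_aux hρ hd hX hφ h hm' hC

theorem jetLe_sq_inv (hρ : 0 ≤ ρ) (hd : Dominates lam K κ₂ C) (hX : 0 ≤ X) (hφ : ContDiff ℝ ∞ φ)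
    (h : JetGood w lam K k ρ φ m y) (hm : κ₂ * X ≤ m) (hC : m ≤ C * X) :
    JetLe k ρ y (fun z => ((lam * growth w lam φ m z) ^ 2)⁻¹)
      (4 * Real.exp (-(rate κ₂ lam * X))) := by
  have hl0 : 0 < lam := by linarith [hd.one_le]
  have hle : lam⁻¹ ^ 2 ≤ 1 := pow_le_one₀ (by positivity) (inv_le_one_of_one_le₀ hd.one_le)
  have h1 := ((h.jetLe_inv hφ).mul hρ (h.jetLe_inv hφ)).const_mul (lam⁻¹ ^ 2)
  refine (h1.mono ?_).congr (Filter.Eventually.of_forall fun z => ?_)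
  · rw [abs_of_pos (by positivity)]
    refine (mul_le_of_le_one_left (by positivity) hle).trans ?_
    have := hd.prod_le (n := 0) hX hm (by simpa using hC)
    rw [pow_zero, one_mul, add_zero] at this
    linarith
  · simp only [mul_pow, mul_inv, inv_pow]; ring

theorem jetLe_skew (hρ : 0 ≤ ρ) (hd : Dominates lam K κ₂ C) (hX : 1 ≤ X) (hφ : ContDiff ℝ ∞ φ)
    (h : JetGood w lam K k ρ φ m y) (hm : κ₂ * X ≤ m) (hC : m ≤ C * X) :
    JetLe k ρ y (fun z => skew (slopeStart w lam φ m z) (slopeEnd w lam φ m z)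
      (((lam * growth w lam φ m z) ^ 2)⁻¹)) ((2 * k + 1) * (8 * Real.exp (-(rate κ₂ lam * X)))) ∧
    JetLe k ρ y (fun z => skew (slopeEnd w lam φ m z) (slopeStart w lam φ m z)
      (((lam * growth w lam φ m z) ^ 2)⁻¹)) ((2 * k + 1) * (8 * Real.exp (-(rate κ₂ lam * X)))) := by
  have h1 := h.jetLe_sq_inv hρ hd (by linarith) hφ hm hC
  have h2 := hd.exp_le hX
  constructor
  · exact ((h.jetLe_start hφ).skew hρ (h.jetLe_end hφ) h1 (by linarith)).mono (le_of_eq (by ring))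
  · exact ((h.jetLe_end hφ).skew hρ (h.jetLe_start hφ) h1 (by linarith)).mono (le_of_eq (by ring))

theorem dirStart_sub (hρ : 0 ≤ ρ) (hd : Dominates lam K κ₂ C) (hX : 1 ≤ X) (hφ : ContDiff ℝ ∞ φ)
    (h : JetGood w lam K k ρ φ m y) (h' : JetGood w lam K k ρ φ m' y)
    (hm : κ₂ * X ≤ m) (hm' : κ₂ * X ≤ m') (hC : m ≤ C * X) (hC' : m' ≤ C * X) :
    JetLe k ρ y (fun z => dirStart w lam φ m z - dirStart w lam φ m' z)
      ((2 * k + 1) * (24 * Real.exp (-(rate κ₂ lam * X)))) := by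
  have h2 := hd.exp_le hX
  have h1 := (h.jetLe_start hφ).arctan_sub hρ (h'.jetLe_start hφ)
    (h.start_sub hρ hd (by linarith) hφ h' hm hm' hC hC') (by linarith)
  have h3 := (h.jetLe_skew hρ hd hX hφ hm hC).1.sub hρ (h'.jetLe_skew hρ hd hX hφ hm' hC').1
  refine ((h1.add hρ h3).mono (le_of_eq (by ring))).congr (Filter.Eventually.of_forall fun z => ?_)
  simp only [dirStart]; ring

theorem dirEnd_sub (hρ : 0 ≤ ρ) (hd : Dominates lam K κ₂ C) (hX : 1 ≤ X) (hφ : ContDiff ℝ ∞ φ)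
    (h : JetGood w lam K k ρ φ m (x - 2 * Real.pi * w * m))
    (h' : JetGood w lam K k ρ φ m' (x - 2 * Real.pi * w * m'))
    (hm : κ₂ * X ≤ m) (hm' : κ₂ * X ≤ m') (hC : m ≤ C * X) (hC' : m' ≤ C * X) :
    JetLe k ρ x (fun z => dirEnd w lam φ m (z - 2 * Real.pi * w * m) -
      dirEnd w lam φ m' (z - 2 * Real.pi * w * m'))
      ((2 * k + 1) * (24 * Real.exp (-(rate κ₂ lam * X)))) := by
  have h2 := hd.exp_le hX
  have a1 := h.jetLe_end hφ
  have a2 := h'.jetLe_end hφ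
  have a3 := (h.jetLe_skew hρ hd hX hφ hm hC).2
  have a4 := (h'.jetLe_skew hρ hd hX hφ hm' hC').2
  rw [sub_eq_add_neg] at a1 a2 a3 a4
  have b1 := a1.comp_add.arctan_sub hρ a2.comp_add
    (by simpa only [← sub_eq_add_neg] using
      h.end_sub hρ hd (by linarith) hφ h' hm hm' hC hC') (by linarith)
  have b2 := a3.comp_add.sub hρ a4.comp_add
  refine ((b1.add hρ b2).mono (le_of_eq (by ring))).congr (Filter.Eventually.of_forall fun z => ?_)
  simp only [dirEnd, ← sub_eq_add_neg]; ring

/-- The offsets computed from two futures and two pasts of comparable lengths almost agree. -/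
theorem offset_sub (hρ : 0 ≤ ρ) (hd : Dominates lam K κ₂ C) (hX : 1 ≤ X) (hφ : ContDiff ℝ ∞ φ)
    (hs : JetGood w lam K k ρ φ m (x + 2 * Real.pi * w))
    (hs' : JetGood w lam K k ρ φ m' (x + 2 * Real.pi * w))
    (h : JetGood w lam K k ρ φ m (x - 2 * Real.pi * w * m))
    (h' : JetGood w lam K k ρ φ m' (x - 2 * Real.pi * w * m'))
    (hm : κ₂ * X ≤ m) (hm' : κ₂ * X ≤ m') (hC : m ≤ C * X) (hC' : m' ≤ C * X) :
    JetLe k ρ x (fun z => offset w lam φ m z - offset w lam φ m' z)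
      ((2 * k + 1) * (48 * Real.exp (-(rate κ₂ lam * X)))) := by
  have h1 := (hs.dirStart_sub hρ hd hX hφ hs' hm hm' hC hC').comp_add
  have h2 := h.dirEnd_sub hρ hd hX hφ h' hm hm' hC hC'
  refine ((h1.sub hρ h2).mono (le_of_eq (by ring))).congr (Filter.Eventually.of_forall fun z => ?_)
  simp only [offset]; ring

theorem contDiffAt_offset (hd : Dominates lam K κ₂ C) (hX : 1 ≤ X) (hφ : ContDiff ℝ ∞ φ)
    (hρ : 0 ≤ ρ) (hs : JetGood w lam K k ρ φ m (x + 2 * Real.pi * w))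
    (h : JetGood w lam K k ρ φ m (x - 2 * Real.pi * w * m))
    (hm : κ₂ * X ≤ m) (hC : m ≤ C * X) :
    ContDiffAt ℝ ∞ (offset w lam φ m) x := by
  have a1 : ContDiffAt ℝ ∞ (dirStart w lam φ m) (x + 2 * Real.pi * w) :=
    (Real.contDiff_arctan.contDiffAt.comp _ (hs.jetLe_start hφ).smooth).add
      (hs.jetLe_skew hρ hd hX hφ hm hC).1.smooth
  have a2 : ContDiffAt ℝ ∞ (dirEnd w lam φ m) (x - 2 * Real.pi * w * m) :=
    (Real.contDiff_arctan.contDiffAt.comp _ (h.jetLe_end hφ).smooth).add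
      (h.jetLe_skew hρ hd hX hφ hm hC).2.smooth
  rw [sub_eq_add_neg] at a2
  have := (contDiffAt_comp_add a1).sub (contDiffAt_comp_add a2)
  simp only [← sub_eq_add_neg] at this
  exact this

end JetGood

end Jets

/-! ### Clean orbit segments -/

/-- An orbit segment is clean if its points close to the critical points are far from its ends,
in proportion to the inverse of the distance. -/
def IsClean (w c₁ κ : ℝ) (m : ℕ) (y : ℝ) : Prop :=
  ∀ i < m, κ ≤ critDist c₁ (y + 2 * Real.pi * w * i) * (i + 1) ∧
    κ ≤ critDist c₁ (y + 2 * Real.pi * w * i) * (m - i)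

/-- All points of the segment are at distance larger than `R` from the critical points. -/
def IsFree (w c₁ R : ℝ) (m : ℕ) (y : ℝ) : Prop :=
  ∀ i < m, R < critDist c₁ (y + 2 * Real.pi * w * i)

section Clean

variable {w c₁ κ C₁ R : ℝ} {m : ℕ} {y : ℝ}

theorem shift_shift (w y : ℝ) (i l : ℕ) :
    y + 2 * Real.pi * w * i + 2 * Real.pi * w * l = y + 2 * Real.pi * w * (i + l : ℕ) := by
  push_cast; ring

theorem IsFree.left {i n : ℕ} (h : IsFree w c₁ R (i + 1 + n) y) : IsFree w c₁ R i y :=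
  fun l hl => h l (by omega)

theorem IsFree.right {i n : ℕ} (h : IsFree w c₁ R (i + 1 + n) y) :
    IsFree w c₁ R n (y + 2 * Real.pi * w * (i + 1 : ℕ)) := fun l hl => by
  rw [shift_shift]; exact h _ (by omega)

/-- Splitting a clean segment at its point closest to the critical points. -/
theorem IsClean.split (hrec : Recurrent w c₁ κ C₁) (hm : 0 < m) (h : IsClean w c₁ κ m y) :
    ∃ i n : ℕ, m = i + 1 + n ∧ IsClean w c₁ κ i y ∧
      IsClean w c₁ κ n (y + 2 * Real.pi * w * (i + 1 : ℕ)) ∧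
      κ ≤ critDist c₁ (y + 2 * Real.pi * w * i) * (i + 1) ∧
      κ ≤ critDist c₁ (y + 2 * Real.pi * w * i) * (n + 1) ∧
      critDist c₁ (y + 2 * Real.pi * w * i) * (i + 1) ≤ C₁ + 2 ∧
      critDist c₁ (y + 2 * Real.pi * w * i) * (n + 1) ≤ C₁ + 2 := by
  obtain ⟨i, hi, hmin⟩ := Finset.exists_min_image (Finset.range m)
    (fun i => critDist c₁ (y + 2 * Real.pi * w * i)) ⟨0, by simpa using hm⟩
  rw [Finset.mem_range] at hi
  simp only [Finset.mem_range] at hmin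
  obtain ⟨n, rfl⟩ : ∃ n, m = i + 1 + n := ⟨m - (i + 1), by omega⟩
  have h2 := Real.pi_lt_four
  have hd2 := critDist_le_pi_div_two (c₁ := c₁) (y := y + 2 * Real.pi * w * i)
  have hκ := hrec.pos
  have h0 := h i hi
  refine ⟨i, n, rfl, fun l hl => ⟨(h l (by omega)).1, ?_⟩, fun l hl => ?_, h0.1, ?_, ?_, ?_⟩
  · have h1 := hrec.sep (y + 2 * Real.pi * w * l) (i - l) (by omega)
    rw [shift_shift, show l + (i - l) = i by omega, Nat.cast_sub hl.le] at h1
    have h3 := hmin l (by omega)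
    have h4 : (0 : ℝ) ≤ i - l := by
      have : (l : ℝ) ≤ i := by exact_mod_cast hl.le
      linarith
    nlinarith
  · have h1 := hrec.sep (y + 2 * Real.pi * w * i) (l + 1) (by omega)
    have h5 := (h (i + 1 + l) (by omega)).2
    have h3 := hmin (i + 1 + l) (by omega)
    rw [shift_shift, show i + (l + 1) = i + 1 + l by omega] at h1
    rw [shift_shift]
    push_cast at *
    constructor
    · have : (0 : ℝ) ≤ l + 1 := by positivity
      nlinarith
    · calc _ ≤ _ := h5
        _ = _ := by ring
  · have := h0.2
    push_cast at this
    calc _ ≤ _ := this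
      _ = _ := by ring
  · have := hrec.hit y _ i fun l hl => hmin l (by omega)
    nlinarith
  · have := hrec.hit (y + 2 * Real.pi * w * (i + 1 : ℕ)) _ n fun l hl => by
      rw [shift_shift]; exact hmin _ (by omega)
    nlinarith

variable {r : ℕ} {x : ℝ}

theorem IsReturn.free_future (h : IsReturn w c₁ κ C₁ R r) (hx : critDist c₁ x ≤ R) :
    IsFree w c₁ R (r - 1) (x + 2 * Real.pi * w) := fun i hi => by
  have := h.free_add x hx (i + 1) (by omega) (by omega)
  rw [show x + 2 * Real.pi * w + 2 * Real.pi * w * i = x + 2 * Real.pi * w * (i + 1 : ℕ) by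
    push_cast; ring]
  exact this

theorem past_shift (w x : ℝ) {m i : ℕ} (hi : i ≤ m) :
    x - 2 * Real.pi * w * m + 2 * Real.pi * w * i = x - 2 * Real.pi * w * (m - i : ℕ) := by
  rw [Nat.cast_sub hi]; ring

theorem IsReturn.free_past (h : IsReturn w c₁ κ C₁ R r) (hx : critDist c₁ x ≤ R) :
    IsFree w c₁ R (r - 1) (x - 2 * Real.pi * w * (r - 1 : ℕ)) := fun i hi => by
  rw [past_shift w x hi.le]
  exact h.free_sub x hx _ (by omega) (by omega)

theorem IsReturn.clean_future (hrec : Recurrent w c₁ κ C₁) {C : ℝ} (h : IsReturn w c₁ κ C R r)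
    (hx : critDist c₁ x ≤ R) : IsClean w c₁ κ (r - 1) (x + 2 * Real.pi * w) := by
  intro i hi
  have hfree := h.free_add x hx (i + 1) (by omega) (by omega)
  have h1 := hrec.sep x (i + 1) (by omega)
  have h2 := hrec.sep (x + 2 * Real.pi * w * (i + 1 : ℕ)) (r - (i + 1)) (by omega)
  rw [shift_shift, show i + 1 + (r - (i + 1)) = r by omega] at h2
  have h3 := h.near_add x hx
  rw [show x + 2 * Real.pi * w + 2 * Real.pi * w * i = x + 2 * Real.pi * w * (i + 1 : ℕ) by
    push_cast; ring]
  rw [Nat.cast_sub (by omega : i + 1 ≤ r)] at h2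
  rw [Nat.cast_sub (by omega : 1 ≤ r)]
  have hκ := hrec.pos
  have hir : ((i + 1 : ℕ) : ℝ) ≤ r := by exact_mod_cast (by omega : i + 1 ≤ r)
  push_cast at *
  constructor
  · have : (0 : ℝ) ≤ i + 1 := by positivity
    nlinarith
  · have : (0 : ℝ) ≤ r - (i + 1) := by linarith
    nlinarith

theorem IsReturn.clean_past (hrec : Recurrent w c₁ κ C₁) {C : ℝ} (h : IsReturn w c₁ κ C R r)
    (hx : critDist c₁ x ≤ R) :
    IsClean w c₁ κ (r - 1) (x - 2 * Real.pi * w * (r - 1 : ℕ)) := by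
  intro i hi
  rw [past_shift w x hi.le]
  set l := r - 1 - i with hl
  have hfree := h.free_sub x hx l (by omega) (by omega)
  have h1 := hrec.sep (x - 2 * Real.pi * w * l) l (by omega)
  rw [sub_add_cancel] at h1
  have h2 := hrec.sep (x - 2 * Real.pi * w * r) (i + 1) (by omega)
  rw [past_shift w x (by omega), show r - (i + 1) = l by omega] at h2
  have h3 := h.near_sub x hx
  have e : ((r - 1 : ℕ) : ℝ) - i = l := by
    rw [hl, Nat.cast_sub (by omega : i ≤ r - 1)]
  rw [e]
  have hκ := hrec.pos
  push_cast at h2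
  constructor
  · have : (0 : ℝ) ≤ i + 1 := by positivity
    nlinarith
  · have : (0 : ℝ) ≤ (l : ℝ) := by positivity
    nlinarith

end Clean

/-! ### Growth along clean segments -/

/-- Exponential growth along the segment of length `m` that starts at `y`, with small slopes at
both ends.  The square root in the exponent absorbs the losses where segments are joined. -/
structure IsGood (w lam K B : ℝ) (φ : ℝ → ℝ) (m : ℕ) (y : ℝ) : Prop where
  growth_le : lam ^ m * Real.exp (-(K * (m + 1)) + K * Real.sqrt (m + 1)) ≤ |growth w lam φ m y|
  end_le : |slopeEnd w lam φ m y| ≤ lam⁻¹ ^ 2 * B * (1 - (1 / 2) ^ m)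
  start_le : |slopeStart w lam φ m y| ≤ lam⁻¹ ^ 2 * B * (1 - (1 / 2) ^ m)

/-- Numerical conditions for the growth estimates: `c₂` measures the transversality at the joints,
`K` the loss per step and `B` the slopes. -/
structure Constants (κ c₂ K B lam : ℝ) : Prop where
  κ_pos : 0 < κ
  c₂_pos : 0 < c₂
  c₂_le : c₂ ≤ 1
  K_ge : 2 * (1 / Real.sqrt κ - Real.log c₂) ≤ K
  B_ge : 4 / c₂ * Real.exp (1 / Real.sqrt κ) ≤ B
  one_le : 1 ≤ lam
  lam_ge : 2 * Real.exp (1 / Real.sqrt κ) ≤ (lam * Real.exp (-K)) ^ 2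
  slope_small : lam⁻¹ ^ 2 * B ≤ 1 / 200

theorem sqrt_add_le {u v : ℝ} (hu : 0 ≤ u) (huv : u ≤ v) :
    Real.sqrt (u + v) ≤ Real.sqrt v + Real.sqrt u / 2 := by
  have h1 := Real.sq_sqrt hu
  have h2 := Real.sq_sqrt (hu.trans huv)
  have h3 := Real.sqrt_le_sqrt huv
  have h4 := Real.sqrt_nonneg u
  rw [Real.sqrt_le_left (by positivity)]
  nlinarith

theorem half_sqrt_le {u v t : ℝ} (hu : t ≤ u) (hv : t ≤ v) (ht : 0 ≤ t) :
    Real.sqrt t / 2 ≤ Real.sqrt u + Real.sqrt v - Real.sqrt (u + v) := by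
  rcases le_total u v with h | h
  · have := sqrt_add_le (ht.trans hu) h
    have := Real.sqrt_le_sqrt hu
    linarith
  · have := sqrt_add_le (ht.trans hv) h
    rw [add_comm] at this
    have := Real.sqrt_le_sqrt hv
    linarith

theorem one_div_sqrt_le {κ d u : ℝ} (hκ : 0 < κ) (hu : 0 ≤ u) (h : κ ≤ d * u) :
    1 / Real.sqrt d ≤ 1 / Real.sqrt κ * Real.sqrt u := by
  have hd : 0 < d := by
    by_contra! hd
    nlinarith
  have h1 := Real.sqrt_le_sqrt h
  rw [Real.sqrt_mul hd.le] at h1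
  have h2 := Real.sqrt_pos.2 hd
  have h3 := Real.sqrt_pos.2 hκ
  rw [one_div_mul_eq_div, div_le_div_iff₀ h2 h3]
  linarith

section Good

variable {w lam K B κ c₂ : ℝ} {φ : ℝ → ℝ} {m : ℕ} {y : ℝ}

theorem Constants.K_nonneg (hc : Constants κ c₂ K B lam) : 0 ≤ K := by
  have h1 : 0 ≤ 1 / Real.sqrt κ := by positivity
  have h2 := Real.log_nonpos hc.c₂_pos.le hc.c₂_le
  linarith [hc.K_ge]

theorem Constants.B_nonneg (hc : Constants κ c₂ K B lam) : 0 ≤ B :=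
  le_trans (by have := hc.c₂_pos; positivity) hc.B_ge

namespace IsGood

theorem congr {ψ : ℝ → ℝ} (h : IsGood w lam K B φ m y)
    (he : ∀ i < m, φ (y + 2 * Real.pi * w * i) = ψ (y + 2 * Real.pi * w * i)) :
    IsGood w lam K B ψ m y := by
  have e : fwd w (cocycle lam φ) m y = fwd w (cocycle lam ψ) m y :=
    fwd_congr fun i hi => by simp only [cocycle, he i hi]
  obtain ⟨h1, h2, h3⟩ := h
  unfold growth at h1
  unfold slopeEnd at h2
  unfold slopeStart at h3
  rw [e] at h1 h2 h3
  exact ⟨h1, h2, h3⟩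

theorem pow_le (hc : Constants κ c₂ K B lam) (h : IsGood w lam K B φ m y) :
    (lam * Real.exp (-K)) ^ m ≤ |growth w lam φ m y| := by
  refine le_trans ?_ h.growth_le
  rw [mul_pow, ← Real.exp_nat_mul]
  have hl := hc.one_le
  gcongr
  have h1 : 1 ≤ Real.sqrt ((m : ℝ) + 1) := Real.one_le_sqrt.2 (by
    linarith [Nat.cast_nonneg (α := ℝ) m])
  nlinarith [hc.K_nonneg]

theorem ne_zero (hc : Constants κ c₂ K B lam) (h : IsGood w lam K B φ m y) :
    growth w lam φ m y ≠ 0 := by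
  have := h.pow_le hc
  have hl := hc.one_le
  intro h0
  rw [h0, abs_zero] at this
  exact absurd this (not_le.2 (by positivity))

theorem end_le' (hc : Constants κ c₂ K B lam) (h : IsGood w lam K B φ m y) :
    |slopeEnd w lam φ m y| ≤ lam⁻¹ ^ 2 * B := by
  refine h.end_le.trans (mul_le_of_le_one_right ?_ ?_)
  · have := hc.B_nonneg; positivity
  · have : (0 : ℝ) ≤ (1 / 2) ^ m := by positivity
    linarith

theorem start_le' (hc : Constants κ c₂ K B lam) (h : IsGood w lam K B φ m y) :
    |slopeStart w lam φ m y| ≤ lam⁻¹ ^ 2 * B := by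
  refine h.start_le.trans (mul_le_of_le_one_right ?_ ?_)
  · have := hc.B_nonneg; positivity
  · have : (0 : ℝ) ≤ (1 / 2) ^ m := by positivity
    linarith

theorem inv_le (hc : Constants κ c₂ K B lam) (h : IsGood w lam K B φ m y) :
    |(growth w lam φ m y)⁻¹| ≤ (Real.exp K / lam) ^ m := by
  have hl : 0 < lam := by linarith [hc.one_le]
  have h1 := h.pow_le hc
  rw [abs_inv, show Real.exp K / lam = (lam * Real.exp (-K))⁻¹ by
    rw [Real.exp_neg]; field_simp, inv_pow]
  exact inv_anti₀ (by positivity) h1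

theorem zero : IsGood w lam K B φ 0 y where
  growth_le := by rw [growth_zero]; simp
  end_le := by rw [slopeEnd_zero]; simp
  start_le := by rw [slopeStart_zero]; simp

theorem jetGood_zero (hc : Constants κ c₂ K B lam) (h : IsGood w lam K B φ m y) :
    JetGood w lam K 0 0 φ m y where
  growth_ne := h.ne_zero hc
  inv_le := by
    rw [jetNorm_zero_order]
    have hl := hc.one_le
    have : 0 ≤ (Real.exp K / lam) ^ m := by positivity
    linarith [h.inv_le hc]
  end_le := by
    rw [jetNorm_zero_order]; linarith [h.end_le' hc, hc.slope_small]
  start_le := by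
    rw [jetNorm_zero_order]; linarith [h.start_le' hc, hc.slope_small]
  trig_le := fun i _ => by
    rw [jetNorm_zero_order, jetNorm_zero_order]
    constructor
    · linarith [Real.abs_sin_le_one (φ (y + 2 * Real.pi * w * i))]
    · linarith [Real.abs_cos_le_one (φ (y + 2 * Real.pi * w * i))]

end IsGood

theorem abs_cos_add_le {θ t : ℝ} (ht : |t| ≤ 1) : |Real.cos θ + t * Real.sin θ| ≤ 2 := by
  have h1 := Real.abs_cos_le_one θ
  have h2 := Real.abs_sin_le_one θ
  calc |Real.cos θ + t * Real.sin θ| ≤ |Real.cos θ| + |t| * |Real.sin θ| := by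
        rw [← abs_mul]; exact abs_add_le _ _
    _ ≤ 1 + 1 * 1 := by gcongr
    _ = 2 := by norm_num

theorem abs_neg_cos_add_le {θ t : ℝ} (ht : |t| ≤ 1) : |-Real.cos θ + t * Real.sin θ| ≤ 2 := by
  have h1 := Real.abs_cos_le_one θ
  have h2 := Real.abs_sin_le_one θ
  calc |-Real.cos θ + t * Real.sin θ| ≤ |-Real.cos θ| + |t| * |Real.sin θ| := by
        rw [← abs_mul]; exact abs_add_le _ _
    _ ≤ 1 + 1 * 1 := by rw [abs_neg]; gcongr
    _ = 2 := by norm_num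

/-- The correction of a slope caused by a joint at depth `n` from the end decays in `n`. -/
theorem Constants.joint_le (hc : Constants κ c₂ K B lam) {n : ℕ} {d P G : ℝ}
    (hP : (lam * Real.exp (-K)) ^ n ≤ |P|) (hd : κ ≤ d * (n + 1))
    (hG : c₂ * Real.exp (-(1 / Real.sqrt d)) ≤ |G|) :
    |P⁻¹ * P⁻¹ * G⁻¹| ≤ B / 4 * (1 / 2) ^ n := by
  have hl : 0 < lam := by linarith [hc.one_le]
  have hc₂ := hc.c₂_pos
  set s := 1 / Real.sqrt κ with hs
  have hs0 : 0 ≤ s := by positivity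
  have h1 : 1 / Real.sqrt d ≤ s * (n + 1) := by
    refine (one_div_sqrt_le hc.κ_pos (by positivity) hd).trans ?_
    gcongr
    rw [Real.sqrt_le_left (by positivity)]
    nlinarith [Nat.cast_nonneg (α := ℝ) n]
  have h2 : c₂ * Real.exp (-(s * (n + 1))) ≤ |G| := by
    refine le_trans ?_ hG
    gcongr
  have h3 : |P⁻¹| ≤ ((lam * Real.exp (-K)) ^ n)⁻¹ := by
    rw [abs_inv]; exact inv_anti₀ (by positivity) hP
  have h4 : |G⁻¹| ≤ (c₂ * Real.exp (-(s * (n + 1))))⁻¹ := by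
    rw [abs_inv]; exact inv_anti₀ (by positivity) h2
  rw [abs_mul, abs_mul]
  calc |P⁻¹| * |P⁻¹| * |G⁻¹| ≤ ((lam * Real.exp (-K)) ^ n)⁻¹ * ((lam * Real.exp (-K)) ^ n)⁻¹ *
        (c₂ * Real.exp (-(s * (n + 1))))⁻¹ := by gcongr
    _ = (Real.exp s / (lam * Real.exp (-K)) ^ 2) ^ n * (Real.exp s / c₂) := by
        rw [show Real.exp (-(s * ((n : ℝ) + 1))) = (Real.exp s ^ n * Real.exp s)⁻¹ by
          rw [← Real.exp_nat_mul, ← Real.exp_add, ← Real.exp_neg]; congr 1; ring, div_pow]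
        field_simp
        rw [← mul_pow, ← pow_mul, ← pow_mul, mul_comm 2 n]
    _ ≤ (1 / 2) ^ n * (B / 4) := by
        have h5 : Real.exp s / (lam * Real.exp (-K)) ^ 2 ≤ 1 / 2 := by
          rw [div_le_div_iff₀ (by positivity) (by norm_num)]
          linarith [hc.lam_ge]
        have h6 : Real.exp s / c₂ ≤ B / 4 := by
          have := hc.B_ge
          rw [div_mul_eq_mul_div, ← hs, mul_div_assoc] at this
          linarith
        gcongr
    _ = _ := by ring

/-- Two good segments that are joined transversally make a good segment. The loss at the joint is
absorbed by the term `K * √(m + 1)` in the growth: the sum of the square roots for the two parts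
exceeds that for the whole by half the root of the shorter part (`half_sqrt_le`). -/
theorem isGood_join (hc : Constants κ c₂ K B lam) {i n : ℕ} {d : ℝ}
    (hi : IsGood w lam K B φ i y)
    (hn : IsGood w lam K B φ n (y + 2 * Real.pi * w * (i + 1 : ℕ)))
    (hdi : κ ≤ d * (i + 1)) (hdn : κ ≤ d * (n + 1))
    (hG : c₂ * Real.exp (-(1 / Real.sqrt d)) ≤
      |transv (φ (y + 2 * Real.pi * w * i)) (slopeEnd w lam φ i y)
        (slopeStart w lam φ n (y + 2 * Real.pi * w * (i + 1 : ℕ)))|) :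
    IsGood w lam K B φ (i + 1 + n) y := by
  have hl : 0 < lam := by linarith [hc.one_le]
  have hc₂ := hc.c₂_pos
  have hK := hc.K_nonneg
  have hB := hc.B_nonneg
  have hi0 := hi.ne_zero hc
  have hn0 := hn.ne_zero hc
  have hsplit := growth_split hi0 hl.ne' hn0
  have ht := hi.end_le' hc
  have hu := hn.start_le' hc
  have hB1 := hc.slope_small
  have hlB : 0 ≤ lam⁻¹ ^ 2 * B := by positivity
  set G := transv (φ (y + 2 * Real.pi * w * i)) (slopeEnd w lam φ i y)
        (slopeStart w lam φ n (y + 2 * Real.pi * w * (i + 1 : ℕ))) with hGdef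
  have hG0 : G ≠ 0 := by
    intro h0; rw [h0, abs_zero] at hG
    exact absurd hG (not_le.2 (by positivity))
  have hg0 : growth w lam φ (i + 1 + n) y ≠ 0 := by
    rw [hsplit]; exact mul_ne_zero (mul_ne_zero (mul_ne_zero hl.ne' hn0) hi0) hG0
  refine ⟨?_, ?_, ?_⟩
  · have hgi := hi.growth_le
    have hgn := hn.growth_le
    rw [hsplit, abs_mul, abs_mul, abs_mul, abs_of_pos hl]
    have hlog : c₂ * Real.exp (-(1 / Real.sqrt d)) = Real.exp (Real.log c₂ - 1 / Real.sqrt d) := by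
      rw [Real.exp_sub, Real.exp_log hc₂, Real.exp_neg]; rfl
    rw [hlog] at hG
    calc _ ≤ lam * (lam ^ n * Real.exp (-(K * (n + 1)) + K * Real.sqrt (n + 1))) *
          (lam ^ i * Real.exp (-(K * (i + 1)) + K * Real.sqrt (i + 1))) *
          Real.exp (Real.log c₂ - 1 / Real.sqrt d) := by
          have e : ∀ a b c : ℝ, lam * (lam ^ n * Real.exp a) * (lam ^ i * Real.exp b) * Real.exp c
              = lam ^ (i + 1 + n) * Real.exp (a + b + c) := by
            intro a b c
            rw [Real.exp_add, Real.exp_add, pow_add, pow_add]; ring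
          rw [e]
          refine mul_le_mul_of_nonneg_left (Real.exp_le_exp.2 ?_) (by positivity)
          set t : ℝ := min ((i : ℝ) + 1) (n + 1) with ht
          have ht1 : 1 ≤ t := le_min (by linarith [Nat.cast_nonneg (α := ℝ) i])
            (by linarith [Nat.cast_nonneg (α := ℝ) n])
          have hdt : κ ≤ d * t := by
            rcases min_choice ((i : ℝ) + 1) (n + 1) with h | h
            · rw [ht, h]; exact hdi
            · rw [ht, h]; exact hdn
          have h1 := one_div_sqrt_le hc.κ_pos (by linarith) hdt
          have h2 := half_sqrt_le (min_le_left ((i : ℝ) + 1) (n + 1)) (min_le_right _ _)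
            (by rw [← ht]; linarith)
          rw [← ht] at h2
          have h3 : 1 ≤ Real.sqrt t := Real.one_le_sqrt.2 ht1
          have h4 := Real.log_nonpos hc₂.le hc.c₂_le
          have h5 := hc.K_ge
          have e2 : ((i + 1 + n : ℕ) : ℝ) + 1 = (i + 1) + (n + 1) := by push_cast; ring
          rw [e2]
          nlinarith [mul_le_mul_of_nonneg_left h2 hK,
            mul_le_mul_of_nonneg_right h5 (Real.sqrt_nonneg t)]
      _ ≤ _ := by gcongr
  · rw [slopeEnd_split hl.ne' hi0 hn0 hg0]
    have h1 := hc.joint_le (hn.pow_le hc) hdn hG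
    have h2 : |Real.cos (φ (y + 2 * Real.pi * w * i)) + slopeEnd w lam φ i y *
            Real.sin (φ (y + 2 * Real.pi * w * i))| ≤ 2 := abs_cos_add_le (by linarith)
    refine (abs_add_le _ _).trans ?_
    rw [abs_mul, abs_mul, abs_of_pos (by positivity : 0 < lam⁻¹ ^ 2)]
    calc _ ≤ lam⁻¹ ^ 2 * B * (1 - (1 / 2) ^ n) + lam⁻¹ ^ 2 * (2 * (B / 4 * (1 / 2) ^ n)) := by
          gcongr
          exact hn.end_le
      _ = lam⁻¹ ^ 2 * B * (1 - (1 / 2) ^ (n + 1)) := by rw [pow_succ]; ring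
      _ ≤ _ := by
          gcongr lam⁻¹ ^ 2 * B * (1 - ?_)
          exact pow_le_pow_of_le_one (by norm_num) (by norm_num) (by omega)
  · rw [slopeStart_split hl.ne' hi0 hn0 hg0]
    have h1 := hc.joint_le (hi.pow_le hc) hdi hG
    have h2 : |-Real.cos (φ (y + 2 * Real.pi * w * i)) +
          slopeStart w lam φ n (y + 2 * Real.pi * w * (i + 1 : ℕ)) *
            Real.sin (φ (y + 2 * Real.pi * w * i))| ≤ 2 := abs_neg_cos_add_le (by linarith)
    refine (abs_add_le _ _).trans ?_
    rw [abs_mul, abs_mul, abs_of_pos (by positivity : 0 < lam⁻¹ ^ 2)]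
    calc _ ≤ lam⁻¹ ^ 2 * B * (1 - (1 / 2) ^ i) + lam⁻¹ ^ 2 * (2 * (B / 4 * (1 / 2) ^ i)) := by
          gcongr
          exact hi.start_le
      _ = lam⁻¹ ^ 2 * B * (1 - (1 / 2) ^ (i + 1)) := by rw [pow_succ]; ring
      _ ≤ _ := by
          gcongr lam⁻¹ ^ 2 * B * (1 - ?_)
          exact pow_le_pow_of_le_one (by norm_num) (by norm_num) (by omega)

/-- At points farther than `R` from the critical points, good pasts and futures of length
comparable to the inverse distance are joined transversally. -/
def Transversal (w c₁ κ C lam K B c₂ R : ℝ) (φ : ℝ → ℝ) : Prop :=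
  ∀ (z : ℝ) (i n : ℕ), R < critDist c₁ z →
    IsGood w lam K B φ i (z - 2 * Real.pi * w * i) →
    IsGood w lam K B φ n (z + 2 * Real.pi * w) →
    κ ≤ critDist c₁ z * (i + 1) → κ ≤ critDist c₁ z * (n + 1) →
    critDist c₁ z * (i + 1) ≤ C → critDist c₁ z * (n + 1) ≤ C →
    c₂ * Real.exp (-(1 / Real.sqrt (critDist c₁ z))) ≤
      |transv (φ z) (slopeEnd w lam φ i (z - 2 * Real.pi * w * i))
        (slopeStart w lam φ n (z + 2 * Real.pi * w))|

theorem Transversal.at_split {c₁ C R : ℝ} (ht : Transversal w c₁ κ C lam K B c₂ R φ) {i n : ℕ}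
    (hR : R < critDist c₁ (y + 2 * Real.pi * w * i))
    (hi : IsGood w lam K B φ i y)
    (hn : IsGood w lam K B φ n (y + 2 * Real.pi * w * (i + 1 : ℕ)))
    (h1 : κ ≤ critDist c₁ (y + 2 * Real.pi * w * i) * (i + 1))
    (h2 : κ ≤ critDist c₁ (y + 2 * Real.pi * w * i) * (n + 1))
    (h3 : critDist c₁ (y + 2 * Real.pi * w * i) * (i + 1) ≤ C)
    (h4 : critDist c₁ (y + 2 * Real.pi * w * i) * (n + 1) ≤ C) :
    c₂ * Real.exp (-(1 / Real.sqrt (critDist c₁ (y + 2 * Real.pi * w * i)))) ≤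
      |transv (φ (y + 2 * Real.pi * w * i)) (slopeEnd w lam φ i y)
        (slopeStart w lam φ n (y + 2 * Real.pi * w * (i + 1 : ℕ)))| := by
  have e : y + 2 * Real.pi * w * (i + 1 : ℕ) = y + 2 * Real.pi * w * i + 2 * Real.pi * w := by
    push_cast; ring
  have := ht (y + 2 * Real.pi * w * i) i n hR
  rw [add_sub_cancel_right, ← e] at this
  exact this hi hn h1 h2 h3 h4

/-- Transversality propagates growth to all clean segments, by splitting them at their point
closest to the critical points. -/
theorem isGood_of_transversal {c₁ C₁ R : ℝ} (hc : Constants κ c₂ K B lam)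
    (hrec : Recurrent w c₁ κ C₁) (ht : Transversal w c₁ κ (C₁ + 2) lam K B c₂ R φ) :
    ∀ (m : ℕ) (y : ℝ), IsClean w c₁ κ m y → IsFree w c₁ R m y → IsGood w lam K B φ m y := by
  intro m
  induction m using Nat.strong_induction_on with
  | _ m ih =>
    intro y hcl hfr
    rcases Nat.eq_zero_or_pos m with rfl | hm
    · exact IsGood.zero
    · obtain ⟨i, n, rfl, hci, hcn, h1, h2, h3, h4⟩ := hcl.split hrec hm
      have gi := ih i (by omega) y hci hfr.left
      have gn := ih n (by omega) _ hcn hfr.right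
      exact isGood_join hc gi gn h1 h2
        (ht.at_split (hfr i (by omega)) gi gn h1 h2 h3 h4)

end Good

/-! ### The inductive scheme in terms of smooth offsets -/

/-- Radii `R j` of the shrinking neighbourhoods of the critical points, with return times `r j`. -/
structure Ladder (w c₁ κ C M₂ : ℝ) (R : ℕ → ℝ) (r : ℕ → ℕ) : Prop where
  κ_pos : 0 < κ
  pos : ∀ j, 0 < R j
  anti : ∀ j, R (j + 1) ≤ R j
  comp : ∀ j, R j ≤ M₂ * R (j + 1)
  succ_le : ∀ j : ℕ, (j : ℝ) + 1 ≤ 1 / R j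
  large : 2 * M₂ / κ ≤ 1 / R 0
  ret : ∀ j, IsReturn w c₁ κ C (R j) (r j)

namespace Ladder

variable {w c₁ κ C M₂ : ℝ} {R : ℕ → ℝ} {r : ℕ → ℕ}

theorem antitone (h : Ladder w c₁ κ C M₂ R r) : Antitone R := antitone_nat_of_succ_le h.anti

theorem one_le_M₂ (h : Ladder w c₁ κ C M₂ R r) : 1 ≤ M₂ := by
  have h1 := (h.anti 0).trans (h.comp 0)
  have := h.pos 1
  by_contra! hM
  nlinarith

theorem one_le (h : Ladder w c₁ κ C M₂ R r) (j : ℕ) : 1 ≤ 1 / R j :=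
  le_trans (by linarith [Nat.cast_nonneg (α := ℝ) j]) (h.succ_le j)

theorem one_div_mono (h : Ladder w c₁ κ C M₂ R r) {i j : ℕ} (hij : i ≤ j) : 1 / R i ≤ 1 / R j :=
  one_div_le_one_div_of_le (h.pos j) (h.antitone hij)

theorem two_le (h : Ladder w c₁ κ C M₂ R r) (j : ℕ) : 2 ≤ κ * (1 / R j) := by
  have h1 := h.large.trans (h.one_div_mono (Nat.zero_le j))
  rw [div_le_iff₀ h.κ_pos] at h1
  linarith [h.one_le_M₂]

theorem le_of_le {n : ℕ} {d X : ℝ} (h : Ladder w c₁ κ C M₂ R r) (hd : κ ≤ d * (n + 1))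
    (hdX : d * X = 1) (hX : 1 / R 0 ≤ X) : κ / (2 * M₂) * X ≤ n := by
  have hM := h.one_le_M₂
  have hX0 : 0 < X := lt_of_lt_of_le (by linarith [h.one_le 0]) hX
  have hκ := h.κ_pos
  have h1 : κ * X ≤ n + 1 := by
    calc κ * X ≤ d * (n + 1) * X := by gcongr
      _ = n + 1 := by rw [mul_right_comm, hdX, one_mul]
  have h2 : 2 ≤ κ * X := (h.two_le 0).trans (by gcongr)
  have h3 : κ / (2 * M₂) * X ≤ κ / 2 * X := by gcongr; linarith
  linarith

theorem le_len (h : Ladder w c₁ κ C M₂ R r) {j : ℕ} {X : ℝ} (hX : X ≤ M₂ * (1 / R j)) :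
    κ / (2 * M₂) * X ≤ (r j - 1 : ℕ) := by
  have hM := h.one_le_M₂
  have hκ := h.κ_pos
  have hr := (h.ret j).lower
  have hR := h.pos j
  rw [Nat.cast_sub (h.ret j).pos, Nat.cast_one]
  have h1 : κ * (1 / R j) ≤ r j := by
    rw [mul_one_div, div_le_iff₀ hR]; exact hr
  have h2 := h.two_le j
  have h3 : κ / (2 * M₂) * X ≤ κ / (2 * M₂) * (M₂ * (1 / R j)) := by gcongr
  have h4 : κ / (2 * M₂) * (M₂ * (1 / R j)) = κ * (1 / R j) / 2 := by field_simp
  linarith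

theorem C_nonneg (h : Ladder w c₁ κ C M₂ R r) : 0 ≤ C :=
  h.κ_pos.le.trans ((h.ret 0).lower.trans (h.ret 0).upper)

theorem len_le (h : Ladder w c₁ κ C M₂ R r) {j : ℕ} {X : ℝ} (hX : 1 / R j ≤ X) :
    ((r j - 1 : ℕ) : ℝ) ≤ C * X := by
  have hr := (h.ret j).upper
  have h1 : (r j : ℝ) ≤ C * (1 / R j) := by
    rw [mul_one_div, le_div_iff₀ (h.pos j)]; exact hr
  rw [Nat.cast_sub (h.ret j).pos, Nat.cast_one]
  have := mul_le_mul_of_nonneg_left hX h.C_nonneg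
  linarith

end Ladder

/-- The corrections of the inductive construction, before multiplication with the cutoffs. -/
def corr (w lam : ℝ) (r : ℕ → ℕ) (ψ : ℝ → ℝ) : ℕ → ℝ → ℝ
  | 0, x => -offset w lam ψ (r 0 - 1) x
  | j + 1, x => offset w lam ψ (r j - 1) x - offset w lam ψ (r (j + 1) - 1) x

/-- The angle functions of the inductive construction, starting from `φ`. -/
def psi (w lam : ℝ) (r : ℕ → ℕ) (F : ℕ → ℝ → ℝ) (φ : ℝ → ℝ) : ℕ → ℝ → ℝ
  | 0 => φ
  | j + 1 => fun x => psi w lam r F φ j x + corr w lam r (psi w lam r F φ j) j x * F j x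

theorem offset_congr {w lam x : ℝ} {φ ψ : ℝ → ℝ} {m : ℕ}
    (h₁ : ∀ i < m, φ (x + 2 * Real.pi * w + 2 * Real.pi * w * i) =
      ψ (x + 2 * Real.pi * w + 2 * Real.pi * w * i))
    (h₂ : ∀ i < m, φ (x - 2 * Real.pi * w * m + 2 * Real.pi * w * i) =
      ψ (x - 2 * Real.pi * w * m + 2 * Real.pi * w * i)) :
    offset w lam φ m x = offset w lam ψ m x := by
  have e : ∀ y : ℝ, (∀ i < m, φ (y + 2 * Real.pi * w * i) = ψ (y + 2 * Real.pi * w * i)) →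
      fwd w (cocycle lam φ) m y = fwd w (cocycle lam ψ) m y := fun y h =>
    fwd_congr fun i hi => by simp only [cocycle, h i hi]
  simp only [offset, dirStart, dirEnd, slopeStart, slopeEnd, growth, e _ h₁, e _ h₂]

/-- Everything the convergence of the inductive construction rests on: the arithmetic of the
rotation, a lower bound for the starting angle function, the cutoffs, and `lam` being large. -/
structure Scheme (w c₁ κ C₁ M₂ lam K B c₀ : ℝ) (R : ℕ → ℝ) (r : ℕ → ℕ) (F : ℕ → ℝ → ℝ)
    (φ : ℝ → ℝ) : Prop where
  recurrent : Recurrent w c₁ κ C₁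
  ladder : Ladder w c₁ κ (C₁ + 2) M₂ R r
  const : Constants κ (c₀ / 4) K B lam
  dom : Dominates lam K (κ / (2 * M₂)) (C₁ + 2)
  smooth : ContDiff ℝ ∞ φ
  lower : ∀ z, 0 < critDist c₁ z →
    c₀ * Real.exp (-(1 / Real.sqrt (critDist c₁ z))) ≤ |Real.sin (φ z)|
  F_smooth : ∀ j, ContDiff ℝ ∞ (F j)
  F_one : ∀ j z, critDist c₁ z ≤ R j / 10 → F j z = 1
  F_zero : ∀ j z, R j < critDist c₁ z → F j z = 0
  F_mem : ∀ j z, F j z ∈ Set.Icc (0 : ℝ) 1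
  twenty_le : 20 ≤ rate (κ / (2 * M₂)) lam
  rate_large : 160 * Real.exp (1 - rate (κ / (2 * M₂)) lam / 20) ≤ c₀
  base : 3 * (lam⁻¹ ^ 2 * B) ≤ c₀ / 2 * Real.exp (-(1 / Real.sqrt (R 0)))
  first : 2 * (lam⁻¹ ^ 2 * B) + 16 * Real.exp (-rate (κ / (2 * M₂)) lam) ≤
    c₀ / 8 * Real.exp (-Real.sqrt (10 * (1 / R 0)))

section Induction

variable {w c₁ κ C₁ M₂ lam K B c₀ : ℝ} {R : ℕ → ℝ} {r : ℕ → ℕ} {F : ℕ → ℝ → ℝ} {φ : ℝ → ℝ}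

/-- All clean segments that stay away from the critical points have good jets. -/
def AllJetGood (w c₁ κ lam K R : ℝ) (k : ℕ) (ρ : ℝ) (ψ : ℝ → ℝ) : Prop :=
  ∀ m y, IsClean w c₁ κ m y → IsFree w c₁ R m y → JetGood w lam K k ρ ψ m y

theorem IsFree.mono {R R' : ℝ} {m : ℕ} {y : ℝ} (h : IsFree w c₁ R m y) (hR : R' ≤ R) :
    IsFree w c₁ R' m y := fun i hi => hR.trans_lt (h i hi)

/-- The angle at which a past and a future of lengths of size `X` meet is the offset of any
reference segments of such lengths, up to an exponentially small error. -/
theorem JetGood.abs_angle_sub_offset_le {w lam K κ₂ C X z : ℝ} {φ : ℝ → ℝ} {i m n : ℕ}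
    (hd : Dominates lam K κ₂ C) (hX : 1 ≤ X) (hφ : ContDiff ℝ ∞ φ)
    (gi : JetGood w lam K 0 0 φ i (z - 2 * Real.pi * w * i))
    (gn : JetGood w lam K 0 0 φ n (z + 2 * Real.pi * w))
    (gp : JetGood w lam K 0 0 φ m (z - 2 * Real.pi * w * m))
    (gf : JetGood w lam K 0 0 φ m (z + 2 * Real.pi * w))
    (li : κ₂ * X ≤ i) (ln : κ₂ * X ≤ n) (lm : κ₂ * X ≤ m)
    (ui : i ≤ C * X) (un : n ≤ C * X) (um : m ≤ C * X) :
    |Real.arctan (slopeStart w lam φ n (z + 2 * Real.pi * w)) -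
      Real.arctan (slopeEnd w lam φ i (z - 2 * Real.pi * w * i)) - offset w lam φ m z| ≤
      32 * Real.exp (-(rate κ₂ lam * X)) := by
  have hE := hd.exp_le hX
  have s1 := (gf.jetLe_skew le_rfl hd hX hφ lm um).1.abs_le le_rfl
  have s2 := (gp.jetLe_skew le_rfl hd hX hφ lm um).2.abs_le le_rfl
  have e1 := ((gn.jetLe_start hφ).arctan_sub le_rfl (gf.jetLe_start hφ)
    (gn.start_sub le_rfl hd (by linarith) hφ gf ln lm un um) (by linarith)).abs_le le_rfl
  have a1 := gi.jetLe_end hφ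
  have a2 := gp.jetLe_end hφ
  rw [sub_eq_add_neg] at a1 a2
  have e2 := (a1.comp_add.arctan_sub le_rfl a2.comp_add
    (by simpa only [← sub_eq_add_neg] using
      gi.end_sub le_rfl hd (by linarith) hφ gp li lm ui um) (by linarith)).abs_le le_rfl
  simp only [← sub_eq_add_neg] at e2
  simp only [CharP.cast_eq_zero, mul_zero, zero_add, one_mul] at e1 e2 s1 s2
  simp only [offset, dirStart, dirEnd]
  generalize Real.arctan (slopeStart w lam φ n (z + 2 * Real.pi * w)) = b1 at *
  generalize Real.arctan (slopeEnd w lam φ i (z - 2 * Real.pi * w * i)) = b2 at *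
  generalize Real.arctan (slopeStart w lam φ m (z + 2 * Real.pi * w)) = b3 at *
  generalize Real.arctan (slopeEnd w lam φ m (z - 2 * Real.pi * w * m)) = b4 at *
  generalize skew _ _ _ = b5 at *
  generalize skew _ _ _ = b6 at *
  rw [abs_le] at e1 e2 s1 s2 ⊢
  constructor <;> linarith [e1.1, e1.2, e2.1, e2.2, s1.1, s1.2, s2.1, s2.2]

namespace AllJetGood

variable {k : ℕ} {ρ R' : ℝ} {ψ : ℝ → ℝ} {j : ℕ} {x : ℝ}

theorem future (h : AllJetGood w c₁ κ lam K R' k ρ ψ) (hrec : Recurrent w c₁ κ C₁)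
    (hL : Ladder w c₁ κ (C₁ + 2) M₂ R r) (hj : R' ≤ R j) (hx : critDist c₁ x ≤ R j) :
    JetGood w lam K k ρ ψ (r j - 1) (x + 2 * Real.pi * w) :=
  h _ _ ((hL.ret j).clean_future hrec hx) (((hL.ret j).free_future hx).mono hj)

theorem past (h : AllJetGood w c₁ κ lam K R' k ρ ψ) (hrec : Recurrent w c₁ κ C₁)
    (hL : Ladder w c₁ κ (C₁ + 2) M₂ R r) (hj : R' ≤ R j) (hx : critDist c₁ x ≤ R j) :
    JetGood w lam K k ρ ψ (r j - 1) (x - 2 * Real.pi * w * (r j - 1 : ℕ)) :=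
  h _ _ ((hL.ret j).clean_past hrec hx) (((hL.ret j).free_past hx).mono hj)

theorem jetLe_corr (h : AllJetGood w c₁ κ lam K (R (j + 1)) k ρ ψ) (hρ : 0 ≤ ρ)
    (hrec : Recurrent w c₁ κ C₁) (hL : Ladder w c₁ κ (C₁ + 2) M₂ R r)
    (hd : Dominates lam K (κ / (2 * M₂)) (C₁ + 2)) (hψ : ContDiff ℝ ∞ ψ)
    (hx : critDist c₁ x ≤ R (j + 1)) :
    JetLe k ρ x (corr w lam r ψ (j + 1))
      ((2 * k + 1) * (48 * Real.exp (-(rate (κ / (2 * M₂)) lam * (1 / R (j + 1)))))) := by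
  have hx' := hx.trans (hL.anti j)
  have hM := hL.one_le_M₂
  have h1 := hL.one_le (j + 1)
  have h2 : 1 / R (j + 1) ≤ M₂ * (1 / R j) := by
    rw [mul_one_div, div_le_div_iff₀ (hL.pos _) (hL.pos _), one_mul]; exact hL.comp j
  exact JetGood.offset_sub hρ hd h1 hψ (h.future hrec hL (hL.anti j) hx')
    (h.future hrec hL le_rfl hx) (h.past hrec hL (hL.anti j) hx') (h.past hrec hL le_rfl hx)
    (hL.le_len h2) (hL.le_len (by nlinarith)) (hL.len_le (hL.one_div_mono (Nat.le_succ j)))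
    (hL.len_le le_rfl)

theorem contDiffAt_offset (h : AllJetGood w c₁ κ lam K R' 0 0 ψ)
    (hrec : Recurrent w c₁ κ C₁) (hL : Ladder w c₁ κ (C₁ + 2) M₂ R r)
    (hd : Dominates lam K (κ / (2 * M₂)) (C₁ + 2)) (hψ : ContDiff ℝ ∞ ψ)
    (hj : R' ≤ R j) (hx : critDist c₁ x ≤ R j) :
    ContDiffAt ℝ ∞ (offset w lam ψ (r j - 1)) x := by
  have hM := hL.one_le_M₂
  have h1 := hL.one_le j
  exact JetGood.contDiffAt_offset hd h1 hψ le_rfl (h.future hrec hL hj hx)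
    (h.past hrec hL hj hx) (hL.le_len (by nlinarith)) (hL.len_le le_rfl)

theorem contDiffAt_corr (h : AllJetGood w c₁ κ lam K (R j) 0 0 ψ)
    (hrec : Recurrent w c₁ κ C₁) (hL : Ladder w c₁ κ (C₁ + 2) M₂ R r)
    (hd : Dominates lam K (κ / (2 * M₂)) (C₁ + 2)) (hψ : ContDiff ℝ ∞ ψ)
    (hx : critDist c₁ x ≤ R j) : ContDiffAt ℝ ∞ (corr w lam r ψ j) x := by
  cases j with
  | zero => exact (h.contDiffAt_offset hrec hL hd hψ le_rfl hx).neg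
  | succ j =>
    exact (h.contDiffAt_offset hrec hL hd hψ (hL.anti j) (hx.trans (hL.anti j))).sub
      (h.contDiffAt_offset hrec hL hd hψ le_rfl hx)

end AllJetGood

namespace Scheme

theorem psi_succ_of_far (hS : Scheme w c₁ κ C₁ M₂ lam K B c₀ R r F φ) {j : ℕ} {z : ℝ}
    (hz : R j < critDist c₁ z) : psi w lam r F φ (j + 1) z = psi w lam r F φ j z := by
  simp only [psi, hS.F_zero j z hz, mul_zero, add_zero]

theorem psi_eq_of_far (hS : Scheme w c₁ κ C₁ M₂ lam K B c₀ R r F φ) {j l : ℕ} {z : ℝ}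
    (hjl : j ≤ l) (hz : R j < critDist c₁ z) :
    psi w lam r F φ l z = psi w lam r F φ j z := by
  induction l, hjl using Nat.le_induction with
  | base => rfl
  | succ l hl ih => rw [hS.psi_succ_of_far ((hS.ladder.antitone hl).trans_lt hz), ih]

/-- The hypothesis carried along the induction: the `j`-th angle function is smooth, and good
pasts and futures are joined transversally at points farther than `R j` from the critical points. -/
def Trans (w c₁ κ C₁ lam K B c₀ : ℝ) (R : ℕ → ℝ) (r : ℕ → ℕ) (F : ℕ → ℝ → ℝ) (φ : ℝ → ℝ)
    (j : ℕ) : Prop :=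
  ContDiff ℝ ∞ (psi w lam r F φ j) ∧
    Transversal w c₁ κ (C₁ + 2) lam K B (c₀ / 4) (R j) (psi w lam r F φ j)

theorem isGood (hS : Scheme w c₁ κ C₁ M₂ lam K B c₀ R r F φ) {j : ℕ}
    (hT : Trans w c₁ κ C₁ lam K B c₀ R r F φ j) {m : ℕ} {y : ℝ} (hc : IsClean w c₁ κ m y)
    (hf : IsFree w c₁ (R j) m y) : IsGood w lam K B (psi w lam r F φ j) m y :=
  isGood_of_transversal hS.const hS.recurrent hT.2 m y hc hf

theorem allJetGood_zero (hS : Scheme w c₁ κ C₁ M₂ lam K B c₀ R r F φ) {j : ℕ}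
    (hT : Trans w c₁ κ C₁ lam K B c₀ R r F φ j) :
    AllJetGood w c₁ κ lam K (R j) 0 0 (psi w lam r F φ j) :=
  fun _ _ hc hf => (hS.isGood hT hc hf).jetGood_zero hS.const

theorem offset_psi_eq (hS : Scheme w c₁ κ C₁ M₂ lam K B c₀ R r F φ) {j l : ℕ} (hjl : j ≤ l)
    {x : ℝ} (hx : critDist c₁ x ≤ R j) :
    offset w lam (psi w lam r F φ l) (r j - 1) x =
      offset w lam (psi w lam r F φ j) (r j - 1) x :=
  offset_congr (fun i hi => hS.psi_eq_of_far hjl ((hS.ladder.ret j).free_future hx i hi))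
    (fun i hi => hS.psi_eq_of_far hjl ((hS.ladder.ret j).free_past hx i hi))

/-- On the `k`-th neighbourhood the corrections add up to the offset of level `k`. -/
theorem sum_corr (hS : Scheme w c₁ κ C₁ M₂ lam K B c₀ R r F φ) {k : ℕ} {x : ℝ}
    (hx : critDist c₁ x ≤ R k) :
    ∑ l ∈ Finset.range (k + 1), corr w lam r (psi w lam r F φ l) l x =
      -offset w lam (psi w lam r F φ k) (r k - 1) x := by
  induction k with
  | zero => simp [corr]
  | succ k ih =>
    have hx' := hx.trans (hS.ladder.anti k)
    rw [Finset.sum_range_succ, ih hx', corr, hS.offset_psi_eq (Nat.le_succ k) hx']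
    ring

theorem psi_eq_sum (j : ℕ) (x : ℝ) : psi w lam r F φ j x =
    φ x + ∑ l ∈ Finset.range j, corr w lam r (psi w lam r F φ l) l x * F l x := by
  induction j with
  | zero => simp [psi]
  | succ j ih => rw [Finset.sum_range_succ, ← add_assoc, ← ih, psi]

theorem psi_add_offset (hS : Scheme w c₁ κ C₁ M₂ lam K B c₀ R r F φ) {k : ℕ} {x : ℝ}
    (hx : critDist c₁ x ≤ R k) :
    psi w lam r F φ (k + 1) x + offset w lam (psi w lam r F φ k) (r k - 1) x =
      φ x - ∑ l ∈ Finset.range (k + 1),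
        corr w lam r (psi w lam r F φ l) l x * (1 - F l x) := by
  have h1 := hS.sum_corr hx
  simp only [mul_sub, mul_one, Finset.sum_sub_distrib]
  rw [psi_eq_sum, h1]
  ring

theorem abs_corr_zero_le (hS : Scheme w c₁ κ C₁ M₂ lam K B c₀ R r F φ)
    (hT : Trans w c₁ κ C₁ lam K B c₀ R r F φ 0) {x : ℝ} (hx : critDist c₁ x ≤ R 0) :
    |corr w lam r (psi w lam r F φ 0) 0 x| ≤
      2 * (lam⁻¹ ^ 2 * B) + 16 * Real.exp (-rate (κ / (2 * M₂)) lam) := by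
  have hL := hS.ladder
  have h1 := hL.one_le 0
  have hM := hL.one_le_M₂
  have hJ := hS.allJetGood_zero hT
  have g1 := (hS.isGood hT ((hL.ret 0).clean_future hS.recurrent hx)
    ((hL.ret 0).free_future hx)).start_le' hS.const
  have g2 := (hS.isGood hT ((hL.ret 0).clean_past hS.recurrent hx)
    ((hL.ret 0).free_past hx)).end_le' hS.const
  have s1 := ((hJ.future hS.recurrent hL le_rfl hx).jetLe_skew le_rfl hS.dom h1 hT.1
    (hL.le_len (by nlinarith)) (hL.len_le le_rfl)).1.abs_le le_rfl
  have s2 := ((hJ.past hS.recurrent hL le_rfl hx).jetLe_skew le_rfl hS.dom h1 hT.1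
    (hL.le_len (by nlinarith)) (hL.len_le le_rfl)).2.abs_le le_rfl
  have h20 := hS.twenty_le
  have h3 : Real.exp (-(rate (κ / (2 * M₂)) lam * (1 / R 0))) ≤
      Real.exp (-rate (κ / (2 * M₂)) lam) := Real.exp_le_exp.2 (by nlinarith)
  have a1 := (abs_arctan_le _).trans g1
  have a2 := (abs_arctan_le _).trans g2
  rw [abs_le] at a1 a2 s1 s2 ⊢
  simp only [corr, offset, dirStart, dirEnd]
  simp only [CharP.cast_eq_zero, mul_zero, zero_add, one_mul] at s1 s2
  constructor <;> linarith [a1.1, a1.2, a2.1, a2.2, s1.1, s1.2, s2.1, s2.2]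

theorem abs_corr_succ_le (hS : Scheme w c₁ κ C₁ M₂ lam K B c₀ R r F φ) {j : ℕ}
    (hT : Trans w c₁ κ C₁ lam K B c₀ R r F φ (j + 1)) {x : ℝ} (hx : critDist c₁ x ≤ R (j + 1)) :
    |corr w lam r (psi w lam r F φ (j + 1)) (j + 1) x| ≤
      48 * Real.exp (-(rate (κ / (2 * M₂)) lam * (1 / R (j + 1)))) := by
  have := ((hS.allJetGood_zero hT).jetLe_corr le_rfl hS.recurrent hS.ladder hS.dom hT.1 hx).abs_le
    le_rfl
  simpa using this

theorem contDiff_psi_succ (hS : Scheme w c₁ κ C₁ M₂ lam K B c₀ R r F φ) {j : ℕ}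
    (hT : Trans w c₁ κ C₁ lam K B c₀ R r F φ j) : ContDiff ℝ ∞ (psi w lam r F φ (j + 1)) := by
  refine contDiff_iff_contDiffAt.2 fun x => ?_
  rcases le_or_gt (critDist c₁ x) (R j) with hx | hx
  · exact hT.1.contDiffAt.add (((hS.allJetGood_zero hT).contDiffAt_corr hS.recurrent hS.ladder
      hS.dom hT.1 hx).mul (hS.F_smooth j).contDiffAt)
  · refine hT.1.contDiffAt.congr_of_eventuallyEq ?_
    filter_upwards [continuous_critDist.continuousAt.eventually (lt_mem_nhds hx)] with z hz
    exact hS.psi_succ_of_far hz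

theorem isGood_succ (hS : Scheme w c₁ κ C₁ M₂ lam K B c₀ R r F φ) {l k : ℕ} (hkl : k ≤ l)
    (hT : Trans w c₁ κ C₁ lam K B c₀ R r F φ l) {m : ℕ} {y : ℝ} (hc : IsClean w c₁ κ m y)
    (hf : IsFree w c₁ (R k) m y) : IsGood w lam K B (psi w lam r F φ (l + 1)) m y := by
  have hf' := hf.mono (hS.ladder.antitone hkl)
  exact (hS.isGood hT hc hf').congr fun i hi => (hS.psi_succ_of_far (hf' i hi)).symm

/-- A correction at a scale well below the distance `1 / X` does not act; the others decay. -/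
theorem abs_corr_mul_le (hS : Scheme w c₁ κ C₁ M₂ lam K B c₀ R r F φ) {j : ℕ}
    (hT : Trans w c₁ κ C₁ lam K B c₀ R r F φ (j + 1)) {z : ℝ} (hz : 0 < critDist c₁ z)
    (hx : critDist c₁ z ≤ R (j + 1)) :
    |corr w lam r (psi w lam r F φ (j + 1)) (j + 1) z * (1 - F (j + 1) z)| ≤
      48 * Real.exp (-(rate (κ / (2 * M₂)) lam / 20 * (1 / critDist c₁ z))) *
        (1 / 2) ^ (j + 1) := by
  rcases le_or_gt (critDist c₁ z) (R (j + 1) / 10) with h | h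
  · rw [hS.F_one _ z h, sub_self, mul_zero, abs_zero]; positivity
  · have h1 := hS.abs_corr_succ_le hT hx
    have h20 := hS.twenty_le
    have hR := hS.ladder.pos (j + 1)
    have h2 := hS.ladder.succ_le (j + 1)
    have hF := hS.F_mem (j + 1) z
    have h3 : 1 / critDist c₁ z ≤ 10 * (1 / R (j + 1)) := by
      rw [mul_one_div, div_le_div_iff₀ hz hR]; linarith
    have h4 : Real.exp (-((j + 1 : ℕ) : ℝ)) ≤ (1 / 2) ^ (j + 1) := by
      rw [← mul_neg_one, Real.exp_nat_mul]
      gcongr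
      rw [Real.exp_neg, one_div]
      exact inv_anti₀ (by norm_num) (by linarith [Real.add_one_le_exp 1])
    rw [abs_mul]
    calc _ ≤ 48 * Real.exp (-(rate (κ / (2 * M₂)) lam * (1 / R (j + 1)))) * 1 := by
          gcongr
          rw [abs_le]; constructor <;> linarith [hF.1, hF.2]
      _ ≤ 48 * (Real.exp (-(rate (κ / (2 * M₂)) lam / 20 * (1 / critDist c₁ z))) *
            Real.exp (-((j + 1 : ℕ) : ℝ))) := by
          rw [mul_one, ← Real.exp_add]
          gcongr
          nlinarith
      _ ≤ _ := by rw [mul_assoc]; gcongr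

theorem sum_corr_mul_le (hS : Scheme w c₁ κ C₁ M₂ lam K B c₀ R r F φ) {k : ℕ}
    (hT : ∀ i ≤ k, Trans w c₁ κ C₁ lam K B c₀ R r F φ i) {z : ℝ} (hz : 0 < critDist c₁ z)
    (hx : critDist c₁ z ≤ R k) :
    |∑ l ∈ Finset.range (k + 1), corr w lam r (psi w lam r F φ l) l z * (1 - F l z)| ≤
      c₀ / 8 * Real.exp (-Real.sqrt (1 / critDist c₁ z)) +
      48 * Real.exp (-(rate (κ / (2 * M₂)) lam / 20 * (1 / critDist c₁ z))) := by
  have hc₀ : 0 < c₀ := by linarith [hS.const.c₂_pos]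
  have hx0 := hx.trans (hS.ladder.antitone (Nat.zero_le k))
  have h0 : |corr w lam r (psi w lam r F φ 0) 0 z * (1 - F 0 z)| ≤
      c₀ / 8 * Real.exp (-Real.sqrt (1 / critDist c₁ z)) := by
    rcases le_or_gt (critDist c₁ z) (R 0 / 10) with h | h
    · rw [hS.F_one _ z h, sub_self, mul_zero, abs_zero]; positivity
    · have hF := hS.F_mem 0 z
      have h3 : 1 / critDist c₁ z ≤ 10 * (1 / R 0) := by
        rw [mul_one_div, div_le_div_iff₀ hz (hS.ladder.pos 0)]; linarith
      rw [abs_mul]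
      calc _ ≤ (c₀ / 8 * Real.exp (-Real.sqrt (10 * (1 / R 0)))) * 1 := by
            refine mul_le_mul ((hS.abs_corr_zero_le (hT 0 (Nat.zero_le k)) hx0).trans hS.first) ?_
              (abs_nonneg _) (by positivity)
            · rw [abs_le]; constructor <;> linarith [hF.1, hF.2]
        _ ≤ _ := by rw [mul_one]; gcongr
  have h1 : ∀ j ∈ Finset.range k,
      |corr w lam r (psi w lam r F φ (j + 1)) (j + 1) z * (1 - F (j + 1) z)| ≤
      48 * Real.exp (-(rate (κ / (2 * M₂)) lam / 20 * (1 / critDist c₁ z))) *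
        (1 / 2) ^ (j + 1) := fun j hj => by
    have hj' : j + 1 ≤ k := by simpa using hj
    exact hS.abs_corr_mul_le (hT _ hj') hz (hx.trans (hS.ladder.antitone hj'))
  have h2 : ∑ j ∈ Finset.range k, (1 / 2 : ℝ) ^ (j + 1) ≤ 1 := by
    have : ∀ k : ℕ, ∑ j ∈ Finset.range k, (1 / 2 : ℝ) ^ (j + 1) = 1 - (1 / 2) ^ k := by
      intro k
      induction k with
      | zero => simp
      | succ k ih => rw [Finset.sum_range_succ, ih, pow_succ]; ring
    rw [this]
    have : (0 : ℝ) ≤ (1 / 2) ^ k := by positivity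
    linarith
  rw [Finset.sum_range_succ']
  refine (abs_add_le _ _).trans ?_
  rw [add_comm]
  refine add_le_add h0 ((Finset.abs_sum_le_sum_abs _ _).trans ((Finset.sum_le_sum h1).trans ?_))
  rw [← Finset.mul_sum]
  exact mul_le_of_le_one_right (by positivity) h2

theorem abs_sin_le_add (a b : ℝ) : |Real.sin a| ≤ |Real.sin b| + |a - b| := by
  have h1 := Real.abs_sin_sub_sin_le a b
  have h2 := abs_sub_abs_le_abs_sub (Real.sin a) (Real.sin b)
  linarith

theorem abs_sin_le_transv (θ t u : ℝ) :
    |Real.sin (θ + Real.arctan u - Real.arctan t)| ≤ |transv θ t u| := by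
  rw [transv_eq, abs_mul]
  have h1 : 1 ≤ Real.sqrt (1 + t ^ 2) := Real.one_le_sqrt.2 (by nlinarith)
  have h2 : 1 ≤ Real.sqrt (1 + u ^ 2) := Real.one_le_sqrt.2 (by nlinarith)
  refine le_mul_of_one_le_right (abs_nonneg _) ?_
  rw [abs_of_nonneg (by positivity)]
  nlinarith

theorem transv_of_far (hS : Scheme w c₁ κ C₁ M₂ lam K B c₀ R r F φ) {z t u : ℝ}
    (hz : R 0 < critDist c₁ z) (ht : |t| ≤ lam⁻¹ ^ 2 * B) (hu : |u| ≤ lam⁻¹ ^ 2 * B) :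
    c₀ / 4 * Real.exp (-(1 / Real.sqrt (critDist c₁ z))) ≤ |transv (φ z) t u| := by
  have hR := hS.ladder.pos 0
  have hc₀ : 0 < c₀ := by linarith [hS.const.c₂_pos]
  have hB := hS.const.slope_small
  have h1 := hS.lower z (hR.trans hz)
  have h2 : Real.exp (-(1 / Real.sqrt (R 0))) ≤ Real.exp (-(1 / Real.sqrt (critDist c₁ z))) := by
    gcongr
  have h3 := hS.base
  have h4 : |transv (φ z) t u - Real.sin (φ z)| ≤ 3 * (lam⁻¹ ^ 2 * B) := by
    have e : transv (φ z) t u - Real.sin (φ z) =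
      -(t * Real.cos (φ z)) + u * (Real.cos (φ z) + t * Real.sin (φ z)) := by
      rw [transv]; ring
    rw [e]
    refine (abs_add_le _ _).trans ?_
    rw [abs_neg, abs_mul, abs_mul]
    have a1 := abs_cos_add_le (θ := φ z) (t := t) (by linarith)
    have a2 := Real.abs_cos_le_one (φ z)
    calc _ ≤ lam⁻¹ ^ 2 * B * 1 + lam⁻¹ ^ 2 * B * 2 := by gcongr <;> exact (abs_nonneg _).trans ht
      _ = _ := by ring
  have h5 := abs_sub_abs_le_abs_sub (Real.sin (φ z)) (transv (φ z) t u)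
  rw [abs_sub_comm] at h5
  have h6 := mul_le_mul_of_nonneg_left h2 hc₀.le
  have h7 := mul_pos hc₀ (Real.exp_pos (-(1 / Real.sqrt (critDist c₁ z))))
  linarith

theorem exists_scale {R : ℕ → ℝ} {d : ℝ} (h0 : d ≤ R 0) (l : ℕ) (hl : R (l + 1) < d) :
    ∃ k ≤ l, R (k + 1) < d ∧ d ≤ R k := by
  induction l with
  | zero => exact ⟨0, le_rfl, hl, h0⟩
  | succ l ih =>
    rcases le_or_gt d (R (l + 1)) with h | h
    · exact ⟨l + 1, le_rfl, hl, h⟩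
    · obtain ⟨k, hk, h1⟩ := ih h
      exact ⟨k, hk.trans (Nat.le_succ l), h1⟩

theorem sin_lower_bound {X θ c b₁ b₂ b₃ b₄ b₅ f : ℝ} (hX : 1 ≤ X) (hθ : 20 ≤ θ)
    (hc : 160 * Real.exp (1 - θ / 20) ≤ c)
    (hlow : c * Real.exp (-Real.sqrt X) ≤ |Real.sin f|) (hsum : b₅ + b₃ = f - b₄)
    (h₄ : |b₄| ≤ c / 8 * Real.exp (-Real.sqrt X) + 48 * Real.exp (-(θ / 20 * X)))
    (h₃ : |b₁ - b₂ - b₃| ≤ 32 * Real.exp (-(θ * X))) :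
    c / 4 * Real.exp (-Real.sqrt X) ≤ |Real.sin (b₅ + b₁ - b₂)| := by
  have hsin := abs_sin_le_add f (b₅ + b₁ - b₂)
  have hdist : |f - (b₅ + b₁ - b₂)| ≤ c / 8 * Real.exp (-Real.sqrt X) +
      48 * Real.exp (-(θ / 20 * X)) + 32 * Real.exp (-(θ * X)) := by
    rw [abs_le] at h₃ h₄ ⊢
    constructor <;> linarith [h₃.1, h₃.2, h₄.1, h₄.2]
  have hsX : Real.sqrt X ≤ X := by
    rw [Real.sqrt_le_left (by linarith)]; nlinarith
  have b1 : Real.exp (-(θ * X)) ≤ Real.exp (-(θ / 20 * X)) := Real.exp_le_exp.2 (by nlinarith)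
  have b2 : Real.exp (-(θ / 20 * X)) ≤ Real.exp (-Real.sqrt X) * Real.exp (1 - θ / 20) := by
    rw [← Real.exp_add]
    exact Real.exp_le_exp.2 (by nlinarith)
  have b3 := mul_le_mul_of_nonneg_left hc (Real.exp_pos (-Real.sqrt X)).le
  have hc0 : 0 < c := lt_of_lt_of_le (by positivity) hc
  nlinarith [mul_pos hc0 (Real.exp_pos (-Real.sqrt X))]

/-- Near a critical point the transversality is read off from a reference orbit segment, whose
contracted directions meet at the angle that the corrections have restored. -/
theorem transv_of_near (hS : Scheme w c₁ κ C₁ M₂ lam K B c₀ R r F φ) {k l : ℕ} (hkl : k ≤ l)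
    (hT : ∀ i ≤ l, Trans w c₁ κ C₁ lam K B c₀ R r F φ i) {z : ℝ} {i n : ℕ}
    (hz : R (k + 1) < critDist c₁ z) (hz' : critDist c₁ z ≤ R k)
    (hi : IsGood w lam K B (psi w lam r F φ (l + 1)) i (z - 2 * Real.pi * w * i))
    (hn : IsGood w lam K B (psi w lam r F φ (l + 1)) n (z + 2 * Real.pi * w))
    (h1 : κ ≤ critDist c₁ z * (i + 1)) (h2 : κ ≤ critDist c₁ z * (n + 1))
    (h3 : critDist c₁ z * (i + 1) ≤ C₁ + 2) (h4 : critDist c₁ z * (n + 1) ≤ C₁ + 2) :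
    c₀ / 4 * Real.exp (-(1 / Real.sqrt (critDist c₁ z))) ≤
      |transv (psi w lam r F φ (l + 1) z)
        (slopeEnd w lam (psi w lam r F φ (l + 1)) i (z - 2 * Real.pi * w * i))
        (slopeStart w lam (psi w lam r F φ (l + 1)) n (z + 2 * Real.pi * w))| := by
  have hL := hS.ladder
  have hd0 : 0 < critDist c₁ z := (hL.pos _).trans hz
  have hc₀ := hS.const.c₂_pos
  have hψ := hS.contDiff_psi_succ (hT l le_rfl)
  have hpsi : psi w lam r F φ (l + 1) z = psi w lam r F φ (k + 1) z :=
    hS.psi_eq_of_far (by omega) hz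
  have hoff : offset w lam (psi w lam r F φ (l + 1)) (r k - 1) z =
      offset w lam (psi w lam r F φ k) (r k - 1) z := hS.offset_psi_eq (by omega) hz'
  have hsum := hS.psi_add_offset hz'
  have hsle := hS.sum_corr_mul_le (fun i hi => hT i (hi.trans hkl)) hd0 hz'
  have gf := (hS.isGood_succ hkl (hT l le_rfl) ((hL.ret k).clean_future hS.recurrent hz')
    ((hL.ret k).free_future hz')).jetGood_zero hS.const
  have gp := (hS.isGood_succ hkl (hT l le_rfl) ((hL.ret k).clean_past hS.recurrent hz')
    ((hL.ret k).free_past hz')).jetGood_zero hS.const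
  have gi := hi.jetGood_zero hS.const
  have gn := hn.jetGood_zero hS.const
  set X := 1 / critDist c₁ z with hX
  have hXk : 1 / R k ≤ X := one_div_le_one_div_of_le hd0 hz'
  have hX0 : 1 / R 0 ≤ X := (hL.one_div_mono (Nat.zero_le k)).trans hXk
  have hX1 : 1 ≤ X := (hL.one_le k).trans hXk
  have hXM : X ≤ M₂ * (1 / R k) := by
    rw [hX, mul_one_div, div_le_div_iff₀ hd0 (hL.pos k), one_mul]
    have := hL.comp k
    nlinarith [hL.one_le_M₂]
  have hdX : critDist c₁ z * X = 1 := by rw [hX]; field_simp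
  have up : ∀ a : ℕ, critDist c₁ z * (a + 1) ≤ C₁ + 2 → (a : ℝ) ≤ (C₁ + 2) * X := by
    intro a ha
    rw [hX, mul_one_div, le_div_iff₀ hd0]
    nlinarith
  have li := hL.le_of_le h1 hdX hX0
  have ln := hL.le_of_le h2 hdX hX0
  have lk := hL.le_len hXM
  have uk := hL.len_le hXk
  have hang := JetGood.abs_angle_sub_offset_le hS.dom hX1 hψ (hi.jetGood_zero hS.const)
    (hn.jetGood_zero hS.const) gp gf li ln lk (up i h3) (up n h4) uk
  refine le_trans ?_ (abs_sin_le_transv _ _ _)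
  have hlow := hS.lower z hd0
  have hsq : Real.sqrt X = 1 / Real.sqrt (critDist c₁ z) := by
    rw [hX, Real.sqrt_div zero_le_one, Real.sqrt_one]
  rw [← hoff, ← hpsi] at hsum
  rw [← hsq] at hlow ⊢
  have h20 := hS.twenty_le
  have hlarge := hS.rate_large
  clear_value X
  generalize Real.arctan (slopeStart w lam _ n (z + 2 * Real.pi * w)) = b1 at *
  generalize Real.arctan (slopeEnd w lam _ i (z - 2 * Real.pi * w * i)) = b2 at *
  generalize offset w lam (psi w lam r F φ (l + 1)) (r k - 1) z = b3 at *
  generalize (∑ l ∈ Finset.range (k + 1), corr w lam r (psi w lam r F φ l) l z * (1 - F l z)) = b4 at *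
  generalize psi w lam r F φ (l + 1) z = b5 at *
  generalize rate (κ / (2 * M₂)) lam = θ at *
  exact sin_lower_bound hX1 h20 hlarge hlow hsum hsle hang

/-- The transversality survives all steps: near the critical points a point at a distance between
`R (k + 1)` and `R k` is compared with the reference segments of level `k`, on which the later steps
leave the angle function unchanged. -/
theorem trans (hS : Scheme w c₁ κ C₁ M₂ lam K B c₀ R r F φ) (j : ℕ) :
    Trans w c₁ κ C₁ lam K B c₀ R r F φ j := by
  induction j using Nat.strong_induction_on with
  | _ j ih =>
    match j with
    | 0 =>
      refine ⟨hS.smooth, fun z i n hz hi hn _ _ _ _ => ?_⟩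
      exact hS.transv_of_far hz (hi.end_le' hS.const) (hn.start_le' hS.const)
    | l + 1 =>
      refine ⟨hS.contDiff_psi_succ (ih l (Nat.lt_succ_self l)),
        fun z i n hz hi hn h1 h2 h3 h4 => ?_⟩
      rcases le_or_gt (critDist c₁ z) (R 0) with h0 | h0
      · obtain ⟨k, hk, hk1, hk2⟩ := exists_scale h0 l hz
        exact hS.transv_of_near hk (fun i hi => ih i (Nat.lt_succ_of_le hi)) hk1 hk2 hi hn
          h1 h2 h3 h4
      · rw [hS.psi_eq_of_far (Nat.zero_le _) h0]
        exact hS.transv_of_far h0 (hi.end_le' hS.const) (hn.start_le' hS.const)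

end Scheme

end Induction

/-! ### Jets along clean segments -/

/-- The relative loss, per unit of oscillation of the angle function, of the jets of the growth
along clean segments of length `m`. -/
def jetLoss (κ c₂ m : ℝ) : ℝ := 24 / c₂ * m * Real.exp (1 / Real.sqrt κ * Real.sqrt m)

/-- Numerical conditions for the jets of the slopes; they do not involve the order of the jets. -/
structure JetConstants (κ c₂ K lam : ℝ) : Prop where
  base : 524 * Real.exp (1 / Real.sqrt κ) ^ 2 ≤ c₂ ^ 2 * lam ^ 2
  ratio : 4 * Real.exp (1 / Real.sqrt κ) ^ 2 ≤ (lam * Real.exp (-K)) ^ 2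

section JetClean

variable {w c₁ κ C₁ lam K B c₂ R ρ η : ℝ} {k : ℕ} {ψ : ℝ → ℝ}

theorem jetLoss_nonneg (hc : 0 < c₂) {m : ℝ} (hm : 0 ≤ m) : 0 ≤ jetLoss κ c₂ m := by
  unfold jetLoss; positivity

theorem jetLoss_mono (hc : 0 < c₂) {m m' : ℝ} (hm : 0 ≤ m) (h : m ≤ m') :
    jetLoss κ c₂ m ≤ jetLoss κ c₂ m' := by
  have : 0 ≤ m' := hm.trans h
  unfold jetLoss; gcongr

theorem jetLoss_join (hc : 0 < c₂) {i n : ℕ} {γ : ℝ}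
    (hγ : γ ≤ c₂⁻¹ * Real.exp (1 / Real.sqrt κ * Real.sqrt (i + 1 + n : ℕ))) :
    jetLoss κ c₂ i + jetLoss κ c₂ n + 16 * γ ≤ jetLoss κ c₂ (i + 1 + n : ℕ) := by
  unfold jetLoss
  set E := Real.exp (1 / Real.sqrt κ * Real.sqrt (i + 1 + n : ℕ)) with hE
  have h1 : Real.exp (1 / Real.sqrt κ * Real.sqrt i) ≤ E := by
    rw [hE]; gcongr; omega
  have h2 : Real.exp (1 / Real.sqrt κ * Real.sqrt n) ≤ E := by
    rw [hE]; gcongr; omega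
  have hE0 : 0 < E := Real.exp_pos _
  calc _ ≤ 24 / c₂ * i * E + 24 / c₂ * n * E + 16 * (c₂⁻¹ * E) := by gcongr
    _ ≤ 24 / c₂ * i * E + 24 / c₂ * n * E + 24 * (c₂⁻¹ * E) := by gcongr; norm_num
    _ = _ := by push_cast; ring

theorem Constants.jet_joint_le (hc : Constants κ c₂ K B lam) (hj : JetConstants κ c₂ K lam)
    {n : ℕ} {d P G : ℝ} (hP : (lam * Real.exp (-K)) ^ n ≤ |P|) (hd : κ ≤ d * (n + 1))
    (hG : c₂ * Real.exp (-(1 / Real.sqrt d)) ≤ |G|) :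
    lam⁻¹ ^ 2 * |P⁻¹ * P⁻¹ * G⁻¹| *
      (6 + 8 * jetLoss κ c₂ n + 64 * (c₂⁻¹ * Real.exp (1 / Real.sqrt d))) ≤ (1 / 2) ^ (n + 1) := by
  have hl : 0 < lam := by linarith [hc.one_le]
  have hc₂ := hc.c₂_pos
  set s := 1 / Real.sqrt κ with hs
  have hs0 : 0 ≤ s := by positivity
  set E := Real.exp s with hE
  have hE1 : 1 ≤ E := Real.one_le_exp hs0
  have h1 : 1 / Real.sqrt d ≤ s * (n + 1) := by
    refine (one_div_sqrt_le hc.κ_pos (by positivity) hd).trans ?_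
    gcongr
    rw [Real.sqrt_le_left (by positivity)]
    nlinarith [Nat.cast_nonneg (α := ℝ) n]
  have hEn : Real.exp (s * (n + 1)) = E ^ (n + 1) := by
    rw [hE, ← Real.exp_nat_mul]; push_cast; ring_nf
  set U := c₂⁻¹ * E ^ (n + 1) with hU
  have hU1 : 1 ≤ U := by
    have h3 : 1 ≤ c₂⁻¹ := (one_le_inv₀ hc₂).2 hc.c₂_le
    have h4 : 1 ≤ E ^ (n + 1) := one_le_pow₀ hE1
    nlinarith
  have hΓ : c₂⁻¹ * Real.exp (1 / Real.sqrt d) ≤ U := by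
    rw [hU, ← hEn]; gcongr
  have h3 : |P⁻¹| ≤ ((lam * Real.exp (-K)) ^ n)⁻¹ := by
    rw [abs_inv]; exact inv_anti₀ (by positivity) hP
  have h4 : |G⁻¹| ≤ U := by
    rw [abs_inv]
    refine (inv_anti₀ (by positivity) hG).trans ?_
    rw [mul_inv, Real.exp_neg, inv_inv]; exact hΓ
  have h5 : jetLoss κ c₂ n ≤ 24 * n * U := by
    have : Real.exp (s * Real.sqrt n) ≤ E ^ (n + 1) := by
      rw [← hEn]
      gcongr
      rw [Real.sqrt_le_left (by positivity)]
      nlinarith [Nat.cast_nonneg (α := ℝ) n]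
    calc jetLoss κ c₂ n = 24 * n * (c₂⁻¹ * Real.exp (s * Real.sqrt n)) := by
          rw [jetLoss, ← hs]; ring
      _ ≤ _ := by rw [hU]; gcongr
  have h6 : ((n : ℝ) + 1) ≤ 2 ^ n := by exact_mod_cast Nat.lt_two_pow_self
  have h7 : 6 + 8 * jetLoss κ c₂ n + 64 * (c₂⁻¹ * Real.exp (1 / Real.sqrt d)) ≤ 262 * 2 ^ n * U := by
    have : (n + 1) * U ≤ 2 ^ n * U := by gcongr
    nlinarith [mul_nonneg (Nat.cast_nonneg (α := ℝ) n) (by linarith : (0 : ℝ) ≤ U)]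
  have h7' : 0 ≤ 6 + 8 * jetLoss κ c₂ n + 64 * (c₂⁻¹ * Real.exp (1 / Real.sqrt d)) := by
    have := jetLoss_nonneg (κ := κ) hc₂ (Nat.cast_nonneg (α := ℝ) n)
    positivity
  rw [abs_mul, abs_mul]
  have hb : 262 * lam⁻¹ ^ 2 * c₂⁻¹ ^ 2 * E ^ 2 ≤ 1 / 2 := by
    have := hj.base
    rw [← hs, ← hE] at this
    rw [show 262 * lam⁻¹ ^ 2 * c₂⁻¹ ^ 2 * E ^ 2 = 262 * E ^ 2 / (c₂ ^ 2 * lam ^ 2) by field_simp,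
      div_le_div_iff₀ (by positivity) (by norm_num)]
    linarith
  have hr : 2 * E ^ 2 / (lam * Real.exp (-K)) ^ 2 ≤ 1 / 2 := by
    have := hj.ratio
    rw [← hs, ← hE] at this
    rw [div_le_div_iff₀ (by positivity) (by norm_num)]
    linarith
  calc _ ≤ lam⁻¹ ^ 2 * (((lam * Real.exp (-K)) ^ n)⁻¹ * ((lam * Real.exp (-K)) ^ n)⁻¹ * U) *
        (262 * 2 ^ n * U) := by gcongr
    _ = (262 * lam⁻¹ ^ 2 * c₂⁻¹ ^ 2 * E ^ 2) * (2 * E ^ 2 / (lam * Real.exp (-K)) ^ 2) ^ n := by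
        rw [hU, div_pow, mul_pow, ← pow_mul (lam * Real.exp (-K)), mul_comm 2 n, pow_mul]
        field_simp
        ring
    _ ≤ 1 / 2 * (1 / 2) ^ n := by gcongr
    _ = _ := by rw [pow_succ]; ring

/-- Jets of the factors that appear where two segments are joined. -/
theorem jet_joint {x : ℝ} {t u S C : ℝ → ℝ} (hρ : 0 ≤ ρ) (hη : 0 ≤ η) (hη' : η ≤ 1 / 200)
    (ht : ContDiffAt ℝ ∞ t x) (hu : ContDiffAt ℝ ∞ u x) (hS : ContDiffAt ℝ ∞ S x)
    (hC : ContDiffAt ℝ ∞ C x) (ht1 : |t x| ≤ 1 / 200) (hu1 : |u x| ≤ 1 / 200)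
    (hS1 : |S x| ≤ 1) (hC1 : |C x| ≤ 1) (ot : jetOsc k ρ x t ≤ η) (ou : jetOsc k ρ x u ≤ η)
    (oS : jetOsc k ρ x S ≤ η) (oC : jetOsc k ρ x C ≤ η) :
    jetOsc k ρ x (fun z => C z + t z * S z) ≤ 3 * η ∧
    jetOsc k ρ x (fun z => -C z + u z * S z) ≤ 3 * η ∧
    jetOsc k ρ x (fun z => S z - t z * C z + u z * (C z + t z * S z)) ≤ 8 * η := by
  have prod : ∀ {f g : ℝ → ℝ} {a : ℝ}, ContDiffAt ℝ ∞ f x → ContDiffAt ℝ ∞ g x →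
      |f x| ≤ 1 / 200 → |g x| ≤ 1 + 1 / 200 → jetOsc k ρ x f ≤ η → jetOsc k ρ x g ≤ a * η → 0 ≤ a →
      a ≤ 3 → jetOsc k ρ x (fun z => f z * g z) ≤ 3 / 2 * η := by
    intro f g a hf hg hf1 hg1 of og ha ha3
    refine (jetOsc_mul_le hρ hf hg).trans ?_
    have n1 : jetNorm k ρ x g ≤ 1 + 4 / 200 := by rw [jetNorm_eq]; nlinarith
    have o0 := jetOsc_nonneg (k := k) (x := x) (f := g) hρ
    calc _ ≤ η * (1 + 4 / 200) + 1 / 200 * (a * η) := by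
          gcongr
          exact jetNorm_nonneg hρ
      _ ≤ _ := by nlinarith
  have h1 := prod (a := 1) ht hS ht1 (by linarith) ot (by linarith) (by norm_num) (by norm_num)
  have h2 := prod (a := 1) hu hS hu1 (by linarith) ou (by linarith) (by norm_num) (by norm_num)
  have h3 := prod (a := 1) ht hC ht1 (by linarith) ot (by linarith) (by norm_num) (by norm_num)
  have d1 : jetOsc k ρ x (fun z => C z + t z * S z) ≤ 3 * η :=
    (jetOsc_add_le hρ hC (ht.mul hS)).trans (by linarith)
  have a1 : |C x + t x * S x| ≤ 1 + 1 / 200 := by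
    refine (abs_add_le _ _).trans ?_
    rw [abs_mul]
    have := mul_le_mul ht1 hS1 (abs_nonneg _) (by norm_num)
    linarith
  have h4 := prod (a := 3) hu (hC.add (ht.mul hS)) hu1 a1 ou d1 (by norm_num) le_rfl
  refine ⟨d1, (jetOsc_add_le hρ hC.neg (hu.mul hS)).trans ?_, ?_⟩
  · rw [jetOsc_neg]; linarith
  · refine (jetOsc_add_le hρ (hS.sub (ht.mul hC)) (hu.mul (hC.add (ht.mul hS)))).trans ?_
    have := jetOsc_sub_le (k := k) hρ hS (ht.mul hC)
    linarith

/-- The jet seminorm of `f` exceeds the value of `f` at most by the factor `exp b`. -/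
def RelLe (k : ℕ) (ρ x : ℝ) (f : ℝ → ℝ) (b : ℝ) : Prop :=
  ContDiffAt ℝ ∞ f x ∧ jetNorm k ρ x f ≤ |f x| * Real.exp b

namespace RelLe

variable {x b b' : ℝ} {f g : ℝ → ℝ}

theorem mul (hρ : 0 ≤ ρ) (hf : RelLe k ρ x f b) (hg : RelLe k ρ x g b') :
    RelLe k ρ x (fun z => f z * g z) (b + b') :=
  ⟨hf.1.mul hg.1, (jetNorm_mul_le hρ hf.1 hg.1).trans (by
    calc _ ≤ (|f x| * Real.exp b) * (|g x| * Real.exp b') :=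
          mul_le_mul hf.2 hg.2 (jetNorm_nonneg hρ) (by positivity)
      _ = _ := by rw [abs_mul, Real.exp_add]; ring)⟩

theorem const (c : ℝ) : RelLe k ρ x (fun _ => c) 0 :=
  ⟨contDiffAt_const, by rw [jetNorm_const, Real.exp_zero, mul_one]⟩

theorem mono (hf : RelLe k ρ x f b) (h : b ≤ b') : RelLe k ρ x f b' :=
  ⟨hf.1, hf.2.trans (by gcongr)⟩

theorem congr (hf : RelLe k ρ x f b) (h : g =ᶠ[nhds x] f) : RelLe k ρ x g b :=
  ⟨hf.1.congr_of_eventuallyEq h, by rw [jetNorm_congr h, h.eq_of_nhds]; exact hf.2⟩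

theorem comp_add {s : ℝ} (hf : RelLe k ρ (x + s) f b) : RelLe k ρ x (fun z => f (z + s)) b :=
  ⟨contDiffAt_comp_add hf.1, by rw [jetNorm_comp_add]; exact hf.2⟩

theorem inv {γ : ℝ} (hρ : 0 ≤ ρ) (hf : ContDiffAt ℝ ∞ f x) (ho : jetOsc k ρ x f ≤ 8 * η)
    (h0 : f x ≠ 0) (hγ : |(f x)⁻¹| ≤ γ) (hηγ : 16 * (η * γ) ≤ 1) :
    RelLe k ρ x (fun z => (f z)⁻¹) (η * (16 * γ)) := by
  have ha : 0 < |f x| := abs_pos.2 h0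
  have hη : 0 ≤ η := by linarith [(jetOsc_nonneg (k := k) (x := x) (f := f) hρ).trans ho]
  have h1 : 1 ≤ γ * |f x| := by
    rw [abs_inv, inv_le_iff_one_le_mul₀ ha] at hγ
    linarith
  have h2 : 8 * η ≤ 8 * (η * γ) * |f x| := by nlinarith
  refine ⟨hf.inv h0, (jetNorm_inv_le hρ hf (by nlinarith)).trans ?_⟩
  rw [abs_inv, inv_le_comm₀ (by nlinarith) (by positivity), mul_inv, inv_inv, ← Real.exp_neg]
  have h3 : Real.exp (-(η * (16 * γ))) ≤ 1 - 8 * (η * γ) := by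
    have hv : 0 ≤ η * γ := mul_nonneg hη ((abs_nonneg _).trans hγ)
    set v := 8 * (η * γ) with hv'
    rw [show η * (16 * γ) = 2 * v by rw [hv']; ring, Real.exp_neg,
      inv_le_comm₀ (Real.exp_pos _) (by linarith)]
    have := Real.add_one_le_exp (2 * v)
    refine le_trans ?_ this
    rw [inv_le_iff_one_le_mul₀ (by linarith)]
    nlinarith
  nlinarith

theorem osc_mul_le {γ h c : ℝ} (hρ : 0 ≤ ρ) (hη : 0 ≤ η) (hg : RelLe k ρ x g (η * c))
    (hc : c = 2 * h + 16 * γ) (hc0 : 0 ≤ c) (hc1 : η * c ≤ 1 / 2)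
    (hf : ContDiffAt ℝ ∞ f x) (of : jetOsc k ρ x f ≤ 3 * η) (hf2 : |f x| ≤ 2) :
    jetOsc k ρ x (fun z => f z * g z) ≤ η * (|g x| * (6 + 8 * h + 64 * γ)) := by
  have hx : 0 ≤ η * c := mul_nonneg hη hc0
  have hexp : Real.exp (η * c) ≤ 1 + 2 * (η * c) := by
    have := Real.exp_bound_div_one_sub_of_interval hx (by linarith)
    refine this.trans ?_
    rw [div_le_iff₀ (by linarith)]
    nlinarith
  have hn := hg.2
  have ho : jetOsc k ρ x g ≤ |g x| * (2 * (η * c)) := by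
    have h1 := hn
    rw [jetNorm_eq] at h1
    nlinarith [abs_nonneg (g x)]
  have hn2 : jetNorm k ρ x g ≤ |g x| * 2 := hn.trans (by gcongr; linarith)
  have o0 := jetOsc_nonneg (k := k) (x := x) (f := g) hρ
  calc _ ≤ _ := jetOsc_mul_le hρ hf hg.1
    _ ≤ 3 * η * (|g x| * 2) + 2 * (|g x| * (2 * (η * c))) := by
        gcongr
        exact jetNorm_nonneg hρ
    _ = _ := by rw [hc]; ring

end RelLe

/-- Relative jet bounds along the segment of length `m` that starts at `y`. -/
structure RelJet (w κ c₂ lam η : ℝ) (k : ℕ) (ρ : ℝ) (ψ : ℝ → ℝ) (m : ℕ) (y : ℝ) : Prop where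
  inv_le : RelLe k ρ y (fun z => (growth w lam ψ m z)⁻¹) (η * jetLoss κ c₂ m)
  end_le : jetOsc k ρ y (slopeEnd w lam ψ m) ≤ η * (1 - (1 / 2) ^ m)
  start_le : jetOsc k ρ y (slopeStart w lam ψ m) ≤ η * (1 - (1 / 2) ^ m)

theorem RelJet.zero (y : ℝ) : RelJet w κ c₂ lam η k ρ ψ 0 y where
  inv_le := by
    simp only [growth_zero, inv_one]
    simpa [jetLoss] using RelLe.const 1
  end_le := by
    rw [show slopeEnd w lam ψ 0 = fun _ => 0 from funext fun z => slopeEnd_zero, jetOsc_const]; simp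
  start_le := by
    rw [show slopeStart w lam ψ 0 = fun _ => 0 from funext fun z => slopeStart_zero, jetOsc_const]
    simp

theorem join_sum_le {η a b v l h : ℝ} {n : ℕ} (hη : 0 ≤ η) (hl : 0 ≤ l)
    (ha : a ≤ η * (1 - (1 / 2) ^ n)) (hb : b ≤ η * (v * h))
    (hv : l * v * h ≤ (1 / 2) ^ (n + 1)) : a + l * b ≤ η * (1 - (1 / 2) ^ (n + 1)) := by
  have h1 := mul_le_mul_of_nonneg_left hb hl
  have h2 := mul_le_mul_of_nonneg_left hv hη
  rw [pow_succ] at *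
  nlinarith

theorem relJet_join (hρ : 0 ≤ ρ) (hη : 0 ≤ η) (hη' : η ≤ 1 / 200) (hc : Constants κ c₂ K B lam)
    (hj : JetConstants κ c₂ K lam) (hψ : ContDiff ℝ ∞ ψ)
    (hs : ∀ x, jetOsc k ρ x (fun z => Real.sin (ψ z)) ≤ η)
    (hcos : ∀ x, jetOsc k ρ x (fun z => Real.cos (ψ z)) ≤ η) {i n : ℕ} {d y : ℝ}
    (gi : IsGood w lam K B ψ i y)
    (gn : IsGood w lam K B ψ n (y + 2 * Real.pi * w * (i + 1 : ℕ)))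
    (ji : RelJet w κ c₂ lam η k ρ ψ i y)
    (jn : RelJet w κ c₂ lam η k ρ ψ n (y + 2 * Real.pi * w * (i + 1 : ℕ)))
    (hdi : κ ≤ d * (i + 1)) (hdn : κ ≤ d * (n + 1))
    (hG : c₂ * Real.exp (-(1 / Real.sqrt d)) ≤
      |transv (ψ (y + 2 * Real.pi * w * i)) (slopeEnd w lam ψ i y)
        (slopeStart w lam ψ n (y + 2 * Real.pi * w * (i + 1 : ℕ)))|)
    (hm : η * jetLoss κ c₂ (i + 1 + n : ℕ) ≤ 1 / 8) :
    RelJet w κ c₂ lam η k ρ ψ (i + 1 + n) y := by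
  have hl : 0 < lam := by linarith [hc.one_le]
  have hc₂ := hc.c₂_pos
  have hi0 := gi.ne_zero hc
  have hn0 := gn.ne_zero hc
  have hg0 := (isGood_join hc gi gn hdi hdn hG).ne_zero hc
  have hB1 := hc.slope_small
  have ht1 := (gi.end_le' hc).trans hB1
  have hu1 := (gn.start_le' hc).trans hB1
  have half : ∀ m : ℕ, η * (1 - (1 / 2) ^ m) ≤ η := fun m => by
    have : (0 : ℝ) ≤ (1 / 2) ^ m := by positivity
    nlinarith
  -- the factors at the joint, as functions of the starting point
  set t := slopeEnd w lam ψ i with ht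
  set u := fun z => slopeStart w lam ψ n (z + 2 * Real.pi * w * (i + 1 : ℕ)) with hu
  set S := fun z => Real.sin (ψ (z + 2 * Real.pi * w * i)) with hS
  set C := fun z => Real.cos (ψ (z + 2 * Real.pi * w * i)) with hC
  set G := fun z => S z - t z * C z + u z * (C z + t z * S z) with hGdef
  have hψi : ContDiff ℝ ∞ fun z => ψ (z + 2 * Real.pi * w * i) :=
    hψ.comp (contDiff_id.add contDiff_const)
  have dt : ContDiffAt ℝ ∞ t y := contDiffAt_slopeEnd hψ hi0
  have du : ContDiffAt ℝ ∞ u y := contDiffAt_comp_add (contDiffAt_slopeStart hψ hn0)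
  have dS : ContDiffAt ℝ ∞ S y := hψi.sin.contDiffAt
  have dC : ContDiffAt ℝ ∞ C y := hψi.cos.contDiffAt
  have ot : jetOsc k ρ y t ≤ η := ji.end_le.trans (half i)
  have ou : jetOsc k ρ y u ≤ η := by
    rw [hu, jetOsc_comp_add (f := slopeStart w lam ψ n)]; exact jn.start_le.trans (half n)
  have oS : jetOsc k ρ y S ≤ η := by
    rw [hS, jetOsc_comp_add (f := fun z => Real.sin (ψ z))]; exact hs _
  have oC : jetOsc k ρ y C ≤ η := by
    rw [hC, jetOsc_comp_add (f := fun z => Real.cos (ψ z))]; exact hcos _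
  obtain ⟨o1, o2, o3⟩ := jet_joint hρ hη hη' dt du dS dC ht1 hu1 (Real.abs_sin_le_one _)
    (Real.abs_cos_le_one _) ot ou oS oC
  have dG : ContDiffAt ℝ ∞ G y := (dS.sub (dt.mul dC)).add (du.mul (dC.add (dt.mul dS)))
  have hGy : c₂ * Real.exp (-(1 / Real.sqrt d)) ≤ |G y| := hG
  set γ := c₂⁻¹ * Real.exp (1 / Real.sqrt d) with hγ
  have hγ0 : 0 ≤ γ := by positivity
  have hG0 : G y ≠ 0 := by
    intro h0; rw [h0, abs_zero] at hGy
    exact absurd hGy (not_le.2 (by positivity))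
  have hγG : |(G y)⁻¹| ≤ γ := by
    rw [abs_inv, hγ]
    refine (inv_anti₀ (by positivity) hGy).trans (le_of_eq ?_)
    rw [mul_inv, Real.exp_neg, inv_inv]
  have hγm : γ ≤ c₂⁻¹ * Real.exp (1 / Real.sqrt κ * Real.sqrt (i + 1 + n : ℕ)) := by
    have h1 := one_div_sqrt_le hc.κ_pos (by positivity) hdi
    rw [hγ]
    gcongr
    refine h1.trans ?_
    gcongr
    push_cast; linarith [Nat.cast_nonneg (α := ℝ) n]
  have hjoin := jetLoss_join (κ := κ) hc₂ hγm
  have hLi := jetLoss_nonneg (κ := κ) hc₂ (Nat.cast_nonneg (α := ℝ) i)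
  have hLn := jetLoss_nonneg (κ := κ) hc₂ (Nat.cast_nonneg (α := ℝ) n)
  have hηm := (mul_le_mul_of_nonneg_left hjoin hη).trans hm
  have p1 := mul_nonneg hη hLi
  have p2 := mul_nonneg hη hLn
  have p3 := mul_nonneg hη hγ0
  have rG := RelLe.inv hρ dG o3 hG0 hγG (by linarith)
  have ri := ji.inv_le
  have rn := jn.inv_le.comp_add
  -- the splitting formulas hold in a neighbourhood
  have ei : ∀ᶠ z in nhds y, growth w lam ψ i z ≠ 0 :=
    (contDiff_growth hψ i).continuous.continuousAt.eventually_ne hi0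
  have en : ∀ᶠ z in nhds y, growth w lam ψ n (z + 2 * Real.pi * w * (i + 1 : ℕ)) ≠ 0 := by
    have : Continuous fun z => growth w lam ψ n (z + 2 * Real.pi * w * (i + 1 : ℕ)) :=
      (contDiff_growth hψ n).continuous.comp (by fun_prop)
    exact this.continuousAt.eventually_ne hn0
  have eg : ∀ᶠ z in nhds y, growth w lam ψ (i + 1 + n) z ≠ 0 :=
    (contDiff_growth hψ _).continuous.continuousAt.eventually_ne hg0
  have dsn : ContDiffAt ℝ ∞ (fun z => slopeEnd w lam ψ n (z + 2 * Real.pi * w * (i + 1 : ℕ))) y :=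
    contDiffAt_comp_add (contDiffAt_slopeEnd hψ hn0)
  have dsi : ContDiffAt ℝ ∞ (slopeStart w lam ψ i) y := contDiffAt_slopeStart hψ hi0
  refine ⟨?_, ?_, ?_⟩
  · have r := (((RelLe.const (k := k) (ρ := ρ) (x := y) lam⁻¹).mul hρ rn).mul hρ ri).mul hρ rG
    refine (r.mono ?_).congr ?_
    · have := mul_le_mul_of_nonneg_left hjoin hη
      linarith
    · filter_upwards [ei, en] with z hz hz'
      rw [growth_split hz hl.ne' hz']
      simp only [hGdef, ht, hu, hS, hC, transv, mul_inv]
  · have hV := ((rn.mul hρ rn).mul hρ rG).mono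
      (b' := η * (2 * jetLoss κ c₂ n + 16 * γ)) (le_of_eq (by ring))
    have hV' := hV.osc_mul_le (f := fun z => C z + t z * S z) hρ hη rfl (by positivity)
      (by linarith) (dC.add (dt.mul dS)) o1 (abs_cos_add_le (by linarith))
    have hjj := hc.jet_joint_le hj (gn.pow_le hc) hdn hGy
    have hsum := jetOsc_add_le (k := k) hρ dsn
      (contDiffAt_const (c := lam⁻¹ ^ 2) |>.mul ((dC.add (dt.mul dS)).mul hV.1))
    rw [jetOsc_const_mul, abs_of_pos (by positivity : 0 < lam⁻¹ ^ 2),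
      jetOsc_comp_add (f := slopeEnd w lam ψ n)] at hsum
    have he : slopeEnd w lam ψ (i + 1 + n) =ᶠ[nhds y] fun z =>
        slopeEnd w lam ψ n (z + 2 * Real.pi * w * (i + 1 : ℕ)) + lam⁻¹ ^ 2 *
          ((C z + t z * S z) * ((growth w lam ψ n (z + 2 * Real.pi * w * (i + 1 : ℕ)))⁻¹ *
            (growth w lam ψ n (z + 2 * Real.pi * w * (i + 1 : ℕ)))⁻¹ * (G z)⁻¹)) := by
      filter_upwards [ei, en, eg] with z hz hz' hz''
      exact slopeEnd_split hl.ne' hz hz' hz''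
    rw [jetOsc_congr he]
    refine hsum.trans ((join_sum_le hη (by positivity) jn.end_le hV' hjj).trans ?_)
    gcongr η * (1 - ?_)
    exact pow_le_pow_of_le_one (by norm_num) (by norm_num) (by omega)
  · have hV := ((ri.mul hρ ri).mul hρ rG).mono
      (b' := η * (2 * jetLoss κ c₂ i + 16 * γ)) (le_of_eq (by ring))
    have hV' := hV.osc_mul_le (f := fun z => -C z + u z * S z) hρ hη rfl (by positivity)
      (by linarith) (dC.neg.add (du.mul dS)) o2 (abs_neg_cos_add_le (by linarith))
    have hjj := hc.jet_joint_le hj (gi.pow_le hc) hdi hGy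
    have hsum := jetOsc_add_le (k := k) hρ dsi
      (contDiffAt_const (c := lam⁻¹ ^ 2) |>.mul ((dC.neg.add (du.mul dS)).mul hV.1))
    rw [jetOsc_const_mul, abs_of_pos (by positivity : 0 < lam⁻¹ ^ 2)] at hsum
    have he : slopeStart w lam ψ (i + 1 + n) =ᶠ[nhds y] fun z =>
        slopeStart w lam ψ i z + lam⁻¹ ^ 2 *
          ((-C z + u z * S z) * ((growth w lam ψ i z)⁻¹ * (growth w lam ψ i z)⁻¹ * (G z)⁻¹)) := by
      filter_upwards [ei, en, eg] with z hz hz' hz''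
      exact slopeStart_split hl.ne' hz hz' hz''
    rw [jetOsc_congr he]
    refine hsum.trans ((join_sum_le hη (by positivity) ji.start_le hV' hjj).trans ?_)
    gcongr η * (1 - ?_)
    exact pow_le_pow_of_le_one (by norm_num) (by norm_num) (by omega)

theorem relJet_of_transversal (hρ : 0 ≤ ρ) (hη : 0 ≤ η) (hη' : η ≤ 1 / 200)
    (hc : Constants κ c₂ K B lam) (hj : JetConstants κ c₂ K lam) (hrec : Recurrent w c₁ κ C₁)
    (hψ : ContDiff ℝ ∞ ψ) (hT : Transversal w c₁ κ (C₁ + 2) lam K B c₂ R ψ)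
    (hs : ∀ x, jetOsc k ρ x (fun z => Real.sin (ψ z)) ≤ η)
    (hcos : ∀ x, jetOsc k ρ x (fun z => Real.cos (ψ z)) ≤ η) :
    ∀ (m : ℕ) (y : ℝ), IsClean w c₁ κ m y → IsFree w c₁ R m y →
      η * jetLoss κ c₂ m ≤ 1 / 8 → RelJet w κ c₂ lam η k ρ ψ m y := by
  intro m
  induction m using Nat.strong_induction_on with
  | _ m ih =>
    intro y hcl hfr hm
    rcases Nat.eq_zero_or_pos m with rfl | hm0
    · exact RelJet.zero y
    · obtain ⟨i, n, rfl, hci, hcn, h1, h2, h3, h4⟩ := hcl.split hrec hm0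
      have gi := isGood_of_transversal hc hrec hT i y hci hfr.left
      have gn := isGood_of_transversal hc hrec hT n _ hcn hfr.right
      have small : ∀ l : ℕ, l ≤ i + 1 + n → η * jetLoss κ c₂ l ≤ 1 / 8 := fun l hl =>
        (mul_le_mul_of_nonneg_left (jetLoss_mono hc.c₂_pos (Nat.cast_nonneg l)
          (by exact_mod_cast hl)) hη).trans hm
      exact relJet_join hρ hη hη' hc hj hψ hs hcos gi gn
        (ih i (by omega) y hci hfr.left (small i (by omega)))
        (ih n (by omega) _ hcn hfr.right (small n (by omega))) h1 h2
        (hT.at_split (hfr i (by omega)) gi gn h1 h2 h3 h4) hm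

/-- If the angle function varies slowly at scale `ρ`, then clean segments have good jets. -/
theorem allJetGood_of_transversal (hρ : 0 ≤ ρ) (hη : 0 ≤ η) (hη' : η ≤ 1 / 200) (hR : 0 < R)
    (hc : Constants κ c₂ K B lam) (hj : JetConstants κ c₂ K lam) (hrec : Recurrent w c₁ κ C₁)
    (hψ : ContDiff ℝ ∞ ψ) (hT : Transversal w c₁ κ (C₁ + 2) lam K B c₂ R ψ)
    (hs : ∀ x, jetOsc k ρ x (fun z => Real.sin (ψ z)) ≤ η)
    (hcos : ∀ x, jetOsc k ρ x (fun z => Real.cos (ψ z)) ≤ η)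
    (hL : η * jetLoss κ c₂ (C₁ * (1 / R)) ≤ 1 / 8) : AllJetGood w c₁ κ lam K R k ρ ψ := by
  intro m y hcl hfr
  have hmC : (m : ℝ) ≤ C₁ * (1 / R) := by
    rw [mul_one_div, le_div_iff₀ hR]
    exact hrec.hit y R m fun i hi => (hfr i hi).le
  have hm : η * jetLoss κ c₂ m ≤ 1 / 8 :=
    (mul_le_mul_of_nonneg_left (jetLoss_mono hc.c₂_pos (Nat.cast_nonneg m) hmC) hη).trans hL
  have g := isGood_of_transversal hc hrec hT m y hcl hfr
  have j := relJet_of_transversal hρ hη hη' hc hj hrec hψ hT hs hcos m y hcl hfr hm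
  have hl : 0 < lam := by linarith [hc.one_le]
  have half : η * (1 - (1 / 2) ^ m) ≤ η := by
    have : (0 : ℝ) ≤ (1 / 2) ^ m := by positivity
    nlinarith
  refine ⟨g.ne_zero hc, ?_, ?_, ?_, fun i _ => ⟨?_, ?_⟩⟩
  · refine j.inv_le.2.trans ?_
    rw [mul_comm]
    have h2 : Real.exp (η * jetLoss κ c₂ m) ≤ 2 := by
      have h3 := Real.exp_le_exp.2 hm
      have := Real.exp_bound_div_one_sub_of_interval (x := 1 / 8) (by norm_num) (by norm_num)
      norm_num at this
      linarith
    exact mul_le_mul h2 (g.inv_le hc) (abs_nonneg _) (by norm_num)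
  · rw [jetNorm_eq]
    linarith [g.end_le' hc, hc.slope_small, j.end_le]
  · rw [jetNorm_eq]
    linarith [g.start_le' hc, hc.slope_small, j.start_le]
  · rw [jetNorm_eq]
    linarith [hs (y + 2 * Real.pi * w * i), Real.abs_sin_le_one (ψ (y + 2 * Real.pi * w * i))]
  · rw [jetNorm_eq]
    linarith [hcos (y + 2 * Real.pi * w * i), Real.abs_cos_le_one (ψ (y + 2 * Real.pi * w * i))]

end JetClean

/-! ### Uniform bounds for the derivatives of the angle functions -/

theorem pow_mul_exp_sqrt_le (p : ℕ) (c : ℝ) {X : ℝ} (hX : 0 ≤ X) :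
    X ^ p * Real.exp (c * Real.sqrt X) ≤ p.factorial * Real.exp (c ^ 2 / 4) * Real.exp (2 * X) := by
  have h1 : X ^ p ≤ p.factorial * Real.exp X := by
    have := Real.pow_div_factorial_le_exp X hX p
    rwa [div_le_iff₀ (by positivity), mul_comm] at this
  have h2 : Real.exp (c * Real.sqrt X) ≤ Real.exp (c ^ 2 / 4) * Real.exp X := by
    rw [← Real.exp_add]
    refine Real.exp_le_exp.2 ?_
    nlinarith [Real.sq_sqrt hX, sq_nonneg (Real.sqrt X - c / 2)]
  calc _ ≤ (p.factorial * Real.exp X) * (Real.exp (c ^ 2 / 4) * Real.exp X) := by gcongr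
    _ = _ := by rw [two_mul, Real.exp_add]; ring

theorem jetOsc_le_of_bounds {k : ℕ} {ρ x B L z s : ℝ} {f : ℝ → ℝ} (hz : 0 ≤ z) (hz1 : z ≤ 1)
    (hs : 0 ≤ s) (hs1 : s ≤ 1) (hρ : ρ = z * s) (hL : s ^ (k + 1) * L ≤ 1)
    (hlow : ∀ r < k, |iteratedDeriv (r + 1) f x| ≤ B) (htop : |iteratedDeriv (k + 1) f x| ≤ L) :
    jetOsc (k + 1) ρ x f ≤ z * (k * B + 1) := by
  have hρ0 : 0 ≤ ρ := by rw [hρ]; positivity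
  have hρz : ρ ≤ z := by rw [hρ]; exact mul_le_of_le_one_right hz hs1
  have fac : ∀ r : ℕ, ρ ^ (r + 1) / (r + 1).factorial ≤ ρ ^ (r + 1) := fun r =>
    div_le_self (by positivity) (by exact_mod_cast Nat.succ_le_of_lt (Nat.factorial_pos _))
  rw [jetOsc, Finset.sum_range_succ]
  have h1 : ∑ r ∈ Finset.range k, ρ ^ (r + 1) / (r + 1).factorial * |iteratedDeriv (r + 1) f x| ≤
      ∑ _r ∈ Finset.range k, z * B := by
    refine Finset.sum_le_sum fun r hr => ?_
    refine mul_le_mul ((fac r).trans ?_) (hlow r (by simpa using hr)) (abs_nonneg _) hz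
    rw [pow_succ]
    exact (mul_le_of_le_one_left hρ0 (pow_le_one₀ hρ0 (hρz.trans hz1))).trans hρz
  have h2 : ρ ^ (k + 1) / (k + 1).factorial * |iteratedDeriv (k + 1) f x| ≤ z := by
    calc _ ≤ ρ ^ (k + 1) * L := mul_le_mul (fac k) htop (abs_nonneg _) (by positivity)
      _ = z ^ (k + 1) * (s ^ (k + 1) * L) := by rw [hρ, mul_pow]; ring
      _ ≤ z * 1 := by
          refine mul_le_mul ?_ hL (mul_nonneg (by positivity) ((abs_nonneg _).trans htop)) hz
          rw [pow_succ]
          exact mul_le_of_le_one_left hz (pow_le_one₀ hz hz1)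
      _ = z := mul_one z
  rw [Finset.sum_const, Finset.card_range, nsmul_eq_mul] at h1
  linarith

theorem jetNorm_le_of_bounds {k : ℕ} {ρ x Q : ℝ} {f : ℝ → ℝ} (hρ : 0 ≤ ρ) (hρ1 : ρ ≤ 1)
    (h : ∀ r ≤ k, |iteratedDeriv r f x| ≤ Q) : jetNorm k ρ x f ≤ (k + 1) * Q := by
  have hQ : 0 ≤ Q := (abs_nonneg _).trans (h 0 (Nat.zero_le k))
  calc jetNorm k ρ x f ≤ ∑ _r ∈ Finset.range (k + 1), Q := by
        refine Finset.sum_le_sum fun r hr => ?_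
        have h1 : ρ ^ r / r.factorial ≤ 1 := (div_le_self (by positivity)
          (by exact_mod_cast Nat.succ_le_of_lt (Nat.factorial_pos r))).trans (pow_le_one₀ hρ hρ1)
        calc _ ≤ 1 * Q := mul_le_mul h1 (h r (by simp at hr; omega)) (abs_nonneg _) zero_le_one
          _ = Q := one_mul Q
    _ = _ := by simp

theorem iteratedDeriv_le_of_jetNorm {k r : ℕ} {ρ x b : ℝ} {f : ℝ → ℝ} (hρ : 0 < ρ) (hρ1 : ρ ≤ 1)
    (hr : r ≤ k) (h : jetNorm k ρ x f ≤ b) :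
    |iteratedDeriv r f x| ≤ k.factorial * (ρ ^ k)⁻¹ * b := by
  have h1 : ρ ^ r / r.factorial * |iteratedDeriv r f x| ≤ b := by
    refine le_trans ?_ h
    exact Finset.single_le_sum (f := fun r => ρ ^ r / r.factorial * |iteratedDeriv r f x|)
      (fun i _ => by positivity) (Finset.mem_range.2 (by omega))
  have hb : 0 ≤ b := le_trans (by positivity) h1
  have h2 : |iteratedDeriv r f x| ≤ r.factorial * (ρ ^ r)⁻¹ * b := by
    rw [div_mul_eq_mul_div, div_le_iff₀ (by positivity)] at h1
    rw [mul_assoc, mul_comm, mul_assoc, ← div_eq_inv_mul, le_div_iff₀ (by positivity)]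
    linarith
  refine h2.trans ?_
  gcongr ?_ * ?_ * b
  · exact_mod_cast Nat.factorial_le hr
  · exact inv_anti₀ (by positivity) (pow_le_pow_of_le_one hρ.le hρ1 hr)

theorem step_bound_le {a c L X e θ s m : ℝ} {p : ℕ} (ha : 0 < a) (hX : 1 ≤ X) (hm : m ≤ X)
    (hL : 1 ≤ L) (hθ : 20 ≤ θ) (he : e = Real.exp (c * Real.sqrt X)) (hs : s ^ p * L = 1) :
    p.factorial * ((a / (X * e) * s) ^ p)⁻¹ *
      ((2 * p + 1) * (48 * Real.exp (-(θ * X))) * ((p + 1) * X ^ (2 * p))) ≤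
    p.factorial * (a⁻¹ ^ p * ((2 * p + 1) * 48 * (p + 1) *
      ((3 * p).factorial * Real.exp ((p * c) ^ 2 / 4)))) * Real.exp (-m) * L := by
  have hX0 : 0 < X := zero_lt_one.trans_le hX
  have he0 : 0 < e := by rw [he]; exact Real.exp_pos _
  have hρ : ((a / (X * e) * s) ^ p)⁻¹ = a⁻¹ ^ p * (X ^ p * e ^ p) * L := by
    rw [mul_pow, mul_inv, inv_eq_of_mul_eq_one_right hs, div_pow, inv_div, inv_pow, mul_pow]
    ring
  have hek : e ^ p = Real.exp (p * c * Real.sqrt X) := by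
    rw [he, ← Real.exp_nat_mul]; ring_nf
  have hpow := pow_mul_exp_sqrt_le (3 * p) (p * c) hX0.le
  rw [← hek] at hpow
  have hfin : Real.exp (2 * X) * Real.exp (-(θ * X)) ≤ Real.exp (-m) := by
    rw [← Real.exp_add]
    exact Real.exp_le_exp.2 (by nlinarith)
  rw [hρ]
  calc _ = p.factorial * (a⁻¹ ^ p * ((2 * p + 1) * 48 * (p + 1) *
        ((X ^ (3 * p) * e ^ p) * Real.exp (-(θ * X))))) * L := by
        rw [show 3 * p = p + 2 * p by ring, pow_add]
        ring
    _ ≤ p.factorial * (a⁻¹ ^ p * ((2 * p + 1) * 48 * (p + 1) *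
        (((3 * p).factorial * Real.exp ((p * c) ^ 2 / 4) * Real.exp (2 * X)) *
          Real.exp (-(θ * X))))) * L := by gcongr
    _ = p.factorial * (a⁻¹ ^ p * ((2 * p + 1) * 48 * (p + 1) *
        ((3 * p).factorial * Real.exp ((p * c) ^ 2 / 4)))) *
          (Real.exp (2 * X) * Real.exp (-(θ * X))) * L := by ring
    _ ≤ _ := by gcongr

section Bounds

variable {w c₁ κ C₁ M₂ lam K B c₀ : ℝ} {R : ℕ → ℝ} {r : ℕ → ℕ} {F : ℕ → ℝ → ℝ} {φ : ℝ → ℝ}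

namespace Scheme

theorem psi_succ_sub (j : ℕ) :
    (fun x => psi w lam r F φ (j + 1) x - psi w lam r F φ j x) =
      fun x => corr w lam r (psi w lam r F φ j) j x * F j x := by
  funext x
  rw [psi]; ring

/-- One step: if the derivatives of order at most `k` are bounded by `b` and the next one by `L`,
then the step changes all of them by at most an exponentially small multiple of `L`. -/
theorem exists_step_bound (hS : Scheme w c₁ κ C₁ M₂ lam K B c₀ R r F φ)
    (hj : JetConstants κ (c₀ / 4) K lam) (k : ℕ) {b : ℝ} (hb : 0 ≤ b) :
    ∃ A, 0 ≤ A ∧ ∀ (j : ℕ) (L : ℝ), 1 ≤ L →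
      (∀ l ≤ k + 1, ∀ x, |iteratedDeriv l (F (j + 1)) x| ≤ (1 / R (j + 1)) ^ (2 * (k + 1))) →
      (∀ l < k, ∀ x, |iteratedDeriv (l + 1) (psi w lam r F φ (j + 1)) x| ≤ b) →
      (∀ x, |iteratedDeriv (k + 1) (psi w lam r F φ (j + 1)) x| ≤ L) →
      ∀ l ≤ k + 1, ∀ x, |iteratedDeriv l (fun x => psi w lam r F φ (j + 1 + 1) x -
        psi w lam r F φ (j + 1) x) x| ≤ A * Real.exp (-((j + 1 : ℕ) : ℝ)) * L := by
  have hC₁ : 0 ≤ C₁ := by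
    have := hS.recurrent.hit 0 0 0 (by simp)
    simpa using this
  have hc₂ := hS.const.c₂_pos
  have hκ := hS.const.κ_pos
  set n : ℝ := ((k + 1 : ℕ) : ℝ) with hn
  have hn1 : 1 ≤ n := by rw [hn]; push_cast; linarith [Nat.cast_nonneg (α := ℝ) k]
  set M := 2 * n * (k * b + 1) with hM
  have hkb : 0 ≤ k * b := by positivity
  have hM1 : 2 ≤ M := by rw [hM]; nlinarith
  set D := 200 + 192 / (c₀ / 4) * C₁ with hD
  have hD1 : 200 ≤ D := by
    have : 0 ≤ 192 / (c₀ / 4) * C₁ := by positivity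
    linarith
  obtain ⟨a, ha0, ha1', ha1⟩ : ∃ a : ℝ, 0 < a ∧ a ≤ 1 ∧ M * a * D = 1 :=
    ⟨(M * D)⁻¹, by positivity, inv_le_one_of_one_le₀ (by nlinarith), by field_simp⟩
  set c := 1 / Real.sqrt κ * Real.sqrt C₁ with hc
  set A := (k + 1).factorial * (a⁻¹ ^ (k + 1) * ((2 * n + 1) * 48 * (n + 1) *
    ((3 * (k + 1)).factorial * Real.exp (((k + 1 : ℕ) * c) ^ 2 / 4)))) with hA
  refine ⟨A, by positivity, fun j L hL hF hlow htop l hl x => ?_⟩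
  have hψ := (hS.trans (j + 1)).1
  rw [psi_succ_sub]
  rcases lt_or_ge (R (j + 1)) (critDist c₁ x) with hx | hx
  · have he : (fun x => corr w lam r (psi w lam r F φ (j + 1)) (j + 1) x * F (j + 1) x)
        =ᶠ[nhds x] fun _ => 0 := by
      filter_upwards [continuous_critDist.continuousAt.eventually (lt_mem_nhds hx)] with z hz
      rw [hS.F_zero _ z hz, mul_zero]
    rw [he.iteratedDeriv_eq]
    have : iteratedDeriv l (fun _ : ℝ => (0 : ℝ)) x = 0 := by simp
    rw [this, abs_zero]
    positivity
  · set X := 1 / R (j + 1) with hX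
    have hX1 : 1 ≤ X := hS.ladder.one_le _
    have hXj : ((j + 1 : ℕ) : ℝ) ≤ X := by linarith [hS.ladder.succ_le (j + 1)]
    -- the scale of the jets is `ρ = z * s`: the factor `z` absorbs the loss along segments of
    -- lengths of size `X`, and `s = L ^ (-1 / (k + 1))` makes the bound `L` of the top derivative
    -- count as `1`; then `ρ⁻¹ ^ (k + 1)` is linear in `L`
    set e := Real.exp (c * Real.sqrt X) with he
    have he1 : 1 ≤ e := Real.one_le_exp (by positivity)
    set z := a / (X * e) with hz
    have hXe : 1 ≤ X * e := by nlinarith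
    have hz0 : 0 < z := by positivity
    have hza : z ≤ a := div_le_self ha0.le hXe
    obtain ⟨s, hs0, hs1, hsL⟩ : ∃ s : ℝ, 0 < s ∧ s ≤ 1 ∧ s ^ (k + 1) * L = 1 := by
      refine ⟨L⁻¹ ^ (((k + 1 : ℕ) : ℝ)⁻¹), by positivity,
        Real.rpow_le_one (by positivity) (inv_le_one_of_one_le₀ hL) (by positivity), ?_⟩
      rw [Real.rpow_inv_natCast_pow (by positivity) (by omega)]
      field_simp
    set ρ := z * s with hρ
    have hρ0 : 0 < ρ := by positivity
    have hρ1 : ρ ≤ 1 := by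
      have := mul_le_mul (hza.trans ha1') hs1 hs0.le zero_le_one
      linarith
    have hosc : ∀ y, jetOsc (k + 1) ρ y (psi w lam r F φ (j + 1)) ≤ z * (k * b + 1) := fun y =>
      jetOsc_le_of_bounds hz0.le (hza.trans ha1') hs0.le hs1 hρ hsL.le
        (fun l hl => hlow l hl y) (htop y)
    -- the oscillation of the trigonometric functions at scale `ρ`
    set η := M * z with hη
    have hη0 : 0 ≤ η := by positivity
    have hηa : η * (X * e) = M * a := by rw [hη, hz]; field_simp
    have hMa : M * a * 200 ≤ 1 := by
      have : 0 ≤ M * a := by positivity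
      nlinarith
    have hη' : η ≤ 1 / 200 := by
      have : η ≤ M * a := by rw [hη]; gcongr
      linarith
    have htrig := fun y => jet_sin_cos (k := k + 1) hρ0.le (x := y) hψ.contDiffAt (by
      have h1 := mul_le_mul_of_nonneg_left (hosc y) (by positivity : 0 ≤ n)
      have h2 : n * (z * (k * b + 1)) = η / 2 := by rw [hη, hM]; ring
      linarith)
    have hle : ∀ y, 2 * ((k + 1 : ℕ) : ℝ) * jetOsc (k + 1) ρ y (psi w lam r F φ (j + 1)) ≤ η := by
      intro y
      have h1 := mul_le_mul_of_nonneg_left (hosc y) (by positivity : 0 ≤ 2 * n)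
      have h2 : 2 * n * (z * (k * b + 1)) = η := by rw [hη, hM]; ring
      linarith
    have hloss : η * jetLoss κ (c₀ / 4) (C₁ * (1 / R (j + 1))) ≤ 1 / 8 := by
      have e1 : jetLoss κ (c₀ / 4) (C₁ * X) = 24 / (c₀ / 4) * C₁ * (X * e) := by
        rw [jetLoss, Real.sqrt_mul hC₁, he, hc]; ring_nf
      rw [← hX, e1]
      have e2 : η * (24 / (c₀ / 4) * C₁ * (X * e)) = M * a * (192 / (c₀ / 4) * C₁) / 8 := by
        rw [← hηa]; ring
      rw [e2]
      have : M * a * (192 / (c₀ / 4) * C₁) ≤ M * a * D := by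
        gcongr
        rw [hD]; linarith
      linarith
    have hall := allJetGood_of_transversal hρ0.le hη0 hη' (hS.ladder.pos (j + 1)) hS.const hj
      hS.recurrent hψ (hS.trans (j + 1)).2 (fun y => (htrig y).1.trans (hle y))
      (fun y => (htrig y).2.trans (hle y)) hloss
    have hcorr := hall.jetLe_corr hρ0.le hS.recurrent hS.ladder hS.dom hψ hx
    have hFj : JetLe (k + 1) ρ x (F (j + 1)) ((n + 1) * X ^ (2 * (k + 1))) :=
      ⟨(hS.F_smooth _).contDiffAt, jetNorm_le_of_bounds hρ0.le hρ1 fun l hl => hF l hl x⟩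
    have hprod := iteratedDeriv_le_of_jetNorm hρ0 hρ1 hl (hcorr.mul hρ0.le hFj).le
    refine hprod.trans ?_
    rw [← hX, hA]
    exact step_bound_le ha0 hX1 hXj hL hS.twenty_le he hsL

theorem sum_exp_neg_le (j : ℕ) : ∑ i ∈ Finset.range j, Real.exp (-(i : ℝ)) ≤ 2 := by
  have h1 : ∀ i : ℕ, Real.exp (-(i : ℝ)) ≤ (1 / 2) ^ i := fun i => by
    rw [← mul_neg_one, Real.exp_nat_mul]
    gcongr
    rw [Real.exp_neg, one_div]
    exact inv_anti₀ (by norm_num) (by linarith [Real.add_one_le_exp 1])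
  have h2 : ∀ j : ℕ, ∑ i ∈ Finset.range j, (1 / 2 : ℝ) ^ i = 2 - 2 * (1 / 2) ^ j := by
    intro j
    induction j with
    | zero => simp
    | succ j ih => rw [Finset.sum_range_succ, ih, pow_succ]; ring
  refine (Finset.sum_le_sum fun i _ => h1 i).trans ?_
  rw [h2]
  have : (0 : ℝ) ≤ (1 / 2) ^ j := by positivity
  linarith

theorem iteratedDeriv_succ_step (hS : Scheme w c₁ κ C₁ M₂ lam K B c₀ R r F φ) (j l : ℕ) (x : ℝ) :
    iteratedDeriv l (fun x => psi w lam r F φ (j + 1) x - psi w lam r F φ j x) x =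
      iteratedDeriv l (psi w lam r F φ (j + 1)) x - iteratedDeriv l (psi w lam r F φ j) x :=
  iteratedDeriv_fun_sub (contDiffAt_nat (hS.trans (j + 1)).1.contDiffAt l)
    (contDiffAt_nat (hS.trans j).1.contDiffAt l)

/-- The derivatives of all the angle functions are bounded uniformly, order by order. -/
theorem exists_uniform_bound (hS : Scheme w c₁ κ C₁ M₂ lam K B c₀ R r F φ)
    (hj : JetConstants κ (c₀ / 4) K lam)
    (hF : ∀ k, ∃ j₀, ∀ j ≥ j₀, ∀ l ≤ k, ∀ x, |iteratedDeriv l (F j) x| ≤ (1 / R j) ^ (2 * k))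
    (hbd : ∀ j l, ∃ M, ∀ x, |iteratedDeriv (l + 1) (psi w lam r F φ j) x| ≤ M) (k : ℕ) :
    ∃ b, 0 ≤ b ∧ ∃ j₀, ∀ j ≥ j₀, ∀ l < k, ∀ x,
      |iteratedDeriv (l + 1) (psi w lam r F φ j) x| ≤ b := by
  induction k with
  | zero => exact ⟨0, le_rfl, 0, fun j _ l hl => absurd hl (Nat.not_lt_zero l)⟩
  | succ k ih =>
    obtain ⟨b, hb, j₀, hb'⟩ := ih
    obtain ⟨A, hA, hstep⟩ := hS.exists_step_bound hj k hb
    obtain ⟨j₁, hF'⟩ := hF (k + 1)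
    set J := max j₀ j₁ + 1 with hJ
    obtain ⟨M, hM⟩ := hbd J k
    -- step `j` multiplies the bound of the top derivative by at most `1 + A * exp (-j)`, and the
    -- product of these factors converges
    set L := fun j : ℕ => max 1 M * Real.exp (A * ∑ i ∈ Finset.range j, Real.exp (-(i : ℝ)))
      with hL
    have hL1 : ∀ j, 1 ≤ L j := fun j => by
      have h1 : 1 ≤ max 1 M := le_max_left _ _
      have h2 : 1 ≤ Real.exp (A * ∑ i ∈ Finset.range j, Real.exp (-(i : ℝ))) :=
        Real.one_le_exp (mul_nonneg hA (Finset.sum_nonneg fun i _ => (Real.exp_pos _).le))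
      simp only [hL]
      nlinarith
    have htop : ∀ j ≥ J, ∀ x, |iteratedDeriv (k + 1) (psi w lam r F φ j) x| ≤ L j := by
      intro j hjJ
      induction j, hjJ using Nat.le_induction with
      | base =>
        intro x
        have h1 : 1 ≤ Real.exp (A * ∑ i ∈ Finset.range J, Real.exp (-(i : ℝ))) :=
          Real.one_le_exp (mul_nonneg hA (Finset.sum_nonneg fun i _ => (Real.exp_pos _).le))
        refine ((hM x).trans (le_max_right 1 M)).trans ?_
        exact le_mul_of_one_le_right (by positivity) h1
      | succ j hjJ ih =>
        intro x
        obtain ⟨i, rfl⟩ : ∃ i, j = i + 1 := ⟨j - 1, by omega⟩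
        have h1 := hstep i (L (i + 1)) (hL1 _) (hF' (i + 1) (by omega)) (hb' (i + 1) (by omega)) ih
          (k + 1) le_rfl x
        rw [hS.iteratedDeriv_succ_step] at h1
        have h2 := abs_sub_abs_le_abs_sub (iteratedDeriv (k + 1) (psi w lam r F φ (i + 1 + 1)) x)
          (iteratedDeriv (k + 1) (psi w lam r F φ (i + 1)) x)
        have h3 := ih x
        have h4 : L (i + 1 + 1) = L (i + 1) * Real.exp (A * Real.exp (-((i + 1 : ℕ) : ℝ))) := by
          simp only [hL]
          rw [Finset.sum_range_succ _ (i + 1), mul_add, Real.exp_add]; ring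
        have h5 := Real.add_one_le_exp (A * Real.exp (-((i + 1 : ℕ) : ℝ)))
        rw [h4]
        nlinarith [hL1 (i + 1)]
    have hLe : ∀ j, L j ≤ max 1 M * Real.exp (A * 2) := fun j => by
      simp only [hL]
      gcongr
      exact sum_exp_neg_le j
    refine ⟨max b (max 1 M * Real.exp (A * 2)), le_max_of_le_left hb, J, fun j hjJ l hl x => ?_⟩
    rcases Nat.lt_succ_iff_lt_or_eq.1 hl with h | rfl
    · exact (hb' j (by omega) l h x).trans (le_max_left _ _)
    · exact ((htop j hjJ x).trans (hLe j)).trans (le_max_right _ _)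

/-- The steps of the construction are summable in every `C^k` norm. -/
theorem exists_step_le (hS : Scheme w c₁ κ C₁ M₂ lam K B c₀ R r F φ)
    (hj : JetConstants κ (c₀ / 4) K lam)
    (hF : ∀ k, ∃ j₀, ∀ j ≥ j₀, ∀ l ≤ k, ∀ x, |iteratedDeriv l (F j) x| ≤ (1 / R j) ^ (2 * k))
    (hbd : ∀ j l, ∃ M, ∀ x, |iteratedDeriv (l + 1) (psi w lam r F φ j) x| ≤ M) (k : ℕ) :
    ∃ A, 0 ≤ A ∧ ∃ j₀, ∀ j ≥ j₀, ∀ l ≤ k, ∀ x,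
      |iteratedDeriv l (fun x => psi w lam r F φ (j + 1) x - psi w lam r F φ j x) x| ≤
        A * Real.exp (-(j : ℝ)) := by
  obtain ⟨b, hb, j₀, hb'⟩ := hS.exists_uniform_bound hj hF hbd (k + 1)
  obtain ⟨A, hA, hstep⟩ := hS.exists_step_bound hj k hb
  obtain ⟨j₁, hF'⟩ := hF (k + 1)
  refine ⟨A * (1 + b), by positivity, max j₀ j₁ + 1, fun j hjJ l hl x => ?_⟩
  obtain ⟨i, rfl⟩ : ∃ i, j = i + 1 := ⟨j - 1, by omega⟩
  refine (hstep i (1 + b) (by linarith) (hF' (i + 1) (by omega))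
    (fun l hl => hb' (i + 1) (by omega) l (by omega))
    (fun x => (hb' (i + 1) (by omega) k (Nat.lt_succ_self k) x).trans (by linarith)) l
    (by omega) x).trans (le_of_eq (by ring))

end Scheme

end Bounds

/-! ### Smooth limits -/

theorem exists_uniform_limit {f : ℕ → ℝ → ℝ} {A : ℝ} {j₀ : ℕ}
    (h : ∀ j ≥ j₀, ∀ x, |f (j + 1) x - f j x| ≤ A * (1 / 2) ^ j) :
    ∃ g, TendstoUniformly f g Filter.atTop := by
  set C := A * (1 / 2) ^ j₀ with hC
  have hd : ∀ x n, dist (f (n + j₀) x) (f (n + 1 + j₀) x) ≤ C * (1 / 2) ^ n := fun x n => by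
    rw [dist_comm, Real.dist_eq, show n + 1 + j₀ = n + j₀ + 1 by ring]
    refine (h (n + j₀) (by omega) x).trans (le_of_eq ?_)
    rw [hC, pow_add]; ring
  have hlim : ∀ x, ∃ l, Filter.Tendsto (fun n => f (n + j₀) x) Filter.atTop (nhds l) := fun x =>
    cauchySeq_tendsto_of_complete (cauchySeq_of_le_geometric (1 / 2) C (by norm_num) (hd x))
  choose g hg using hlim
  refine ⟨g, ?_⟩
  have hb : ∀ x n, dist (f (n + j₀) x) (g x) ≤ C * (1 / 2) ^ n / (1 - 1 / 2) := fun x n =>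
    dist_le_of_le_geometric_of_tendsto (1 / 2) C (by norm_num) (hd x) (hg x) n
  rw [Metric.tendstoUniformly_iff]
  intro ε hε
  have ht : Filter.Tendsto (fun n : ℕ => C * (1 / 2 : ℝ) ^ n / (1 - 1 / 2)) Filter.atTop (nhds 0) := by
    have := ((tendsto_pow_atTop_nhds_zero_of_lt_one (r := (1 / 2 : ℝ)) (by norm_num)
      (by norm_num)).const_mul C).div_const (1 - 1 / 2)
    simpa using this
  obtain ⟨n₀, hn₀⟩ := Filter.eventually_atTop.1 (ht.eventually (gt_mem_nhds hε))
  filter_upwards [Filter.eventually_ge_atTop (n₀ + j₀)] with n hn x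
  obtain ⟨m, rfl⟩ : ∃ m, n = m + j₀ := ⟨n - j₀, by omega⟩
  rw [dist_comm]
  exact (hb x m).trans_lt (hn₀ m (by omega))

theorem exists_smooth_limit {f : ℕ → ℝ → ℝ} (hf : ∀ j, ContDiff ℝ ∞ (f j))
    (h : ∀ r, ∃ A j₀, ∀ j ≥ j₀, ∀ x,
      |iteratedDeriv r (f (j + 1)) x - iteratedDeriv r (f j) x| ≤ A * (1 / 2) ^ j) :
    ∃ g, ContDiff ℝ ∞ g ∧
      ∀ r, TendstoUniformly (fun j => iteratedDeriv r (f j)) (iteratedDeriv r g) Filter.atTop := by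
  have hlim : ∀ r, ∃ g, TendstoUniformly (fun j => iteratedDeriv r (f j)) g Filter.atTop := fun r => by
    obtain ⟨A, j₀, hA⟩ := h r
    exact exists_uniform_limit hA
  choose g hg using hlim
  have hder : ∀ r x, HasDerivAt (g r) (g (r + 1) x) x := fun r x => by
    refine hasDerivAt_of_tendstoUniformly (hg (r + 1)) (Filter.Eventually.of_forall fun j x => ?_)
      (fun x => (hg r).tendsto_at x) x
    rw [iteratedDeriv_succ]
    exact (((hf j).differentiable_iteratedDeriv r (by exact_mod_cast WithTop.coe_lt_top _)) x).hasDerivAt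
  have heq : ∀ r, iteratedDeriv r (g 0) = g r := by
    intro r
    induction r with
    | zero => exact iteratedDeriv_zero
    | succ r ih => rw [iteratedDeriv_succ, ih]; exact funext fun x => (hder r x).deriv
  refine ⟨g 0, ?_, fun r => by rw [heq]; exact hg r⟩
  refine contDiff_of_differentiable_iteratedDeriv fun r _ x => ?_
  rw [heq]
  exact (hder r x).differentiableAt

theorem iteratedDeriv_le_jet {k r : ℕ} {ρ x b : ℝ} {f : ℝ → ℝ} (hρ : 0 < ρ) (hρ1 : ρ ≤ 1)
    (hr : r ≤ k) (h : JetLe k ρ x f b) : |iteratedDeriv r f x| ≤ k.factorial * (ρ ^ k)⁻¹ * b :=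
  iteratedDeriv_le_of_jetNorm hρ hρ1 hr h.le

/-- Differences of sines and cosines, by the formulas that turn them into products. -/
theorem jetLe_sin_cos_sub {k : ℕ} {ρ x M b : ℝ} {f g : ℝ → ℝ} (hρ : 0 ≤ ρ)
    (hf : ContDiffAt ℝ ∞ f x) (hg : ContDiffAt ℝ ∞ g x) (of : jetOsc k ρ x f ≤ M)
    (og : jetOsc k ρ x g ≤ M) (hM : 2 * k * M ≤ 1)
    (hb : jetNorm k ρ x (fun z => f z - g z) ≤ b) :
    JetLe k ρ x (fun z => Real.sin (f z) - Real.sin (g z)) (4 * (2 * k + 1) * b) ∧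
    JetLe k ρ x (fun z => Real.cos (f z) - Real.cos (g z)) (4 * (2 * k + 1) * b) := by
  have dm : ContDiffAt ℝ ∞ (fun z => 1 / 2 * (f z - g z)) x := contDiffAt_const.mul (hf.sub hg)
  have dp : ContDiffAt ℝ ∞ (fun z => 1 / 2 * (f z + g z)) x := contDiffAt_const.mul (hf.add hg)
  have a1 := jetOsc_sub_le (k := k) hρ hf hg
  have a2 := jetOsc_add_le (k := k) hρ hf hg
  have om : jetOsc k ρ x (fun z => 1 / 2 * (f z - g z)) =
      1 / 2 * jetOsc k ρ x (fun z => f z - g z) := by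
    rw [jetOsc_const_mul]; norm_num
  have op : jetOsc k ρ x (fun z => 1 / 2 * (f z + g z)) ≤ M := by
    rw [jetOsc_const_mul]; norm_num; linarith
  have hk : (0 : ℝ) ≤ k := Nat.cast_nonneg k
  have s1 := jet_sin_cos (k := k) hρ dm (by
    have : jetOsc k ρ x (fun z => 1 / 2 * (f z - g z)) ≤ M := by rw [om]; linarith
    have := mul_le_mul_of_nonneg_left this hk
    linarith)
  have s2 := jet_sin_cos (k := k) hρ dp (by
    have := mul_le_mul_of_nonneg_left op hk
    linarith)
  have op2 : 2 * k * jetOsc k ρ x (fun z => 1 / 2 * (f z + g z)) ≤ 1 := by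
    have := mul_le_mul_of_nonneg_left op hk
    linarith
  have c1 : JetLe k ρ x (fun z => Real.sin (1 / 2 * (f z - g z))) ((2 * k + 1) * b) := by
    refine ⟨dm.sin, ?_⟩
    rw [jetNorm_eq] at hb ⊢
    have h1 : |Real.sin (1 / 2 * (f x - g x))| ≤ |f x - g x| := by
      refine Real.abs_sin_le_abs.trans ?_
      rw [abs_mul, abs_of_pos (by norm_num)]
      linarith [abs_nonneg (f x - g x)]
    have h2 := s1.1
    rw [om] at h2
    have h3 : 0 ≤ jetOsc k ρ x (fun z => f z - g z) := jetOsc_nonneg hρ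
    nlinarith [abs_nonneg (f x - g x), mul_nonneg hk (abs_nonneg (f x - g x)), mul_nonneg hk h3,
      mul_le_mul_of_nonneg_left hb hk]
  have c2 : JetLe k ρ x (fun z => Real.cos (1 / 2 * (f z + g z))) 2 := by
    refine ⟨dp.cos, ?_⟩
    rw [jetNorm_eq]
    linarith [s2.2, Real.abs_cos_le_one (1 / 2 * (f x + g x))]
  have c3 : JetLe k ρ x (fun z => Real.sin (1 / 2 * (f z + g z))) 2 := by
    refine ⟨dp.sin, ?_⟩
    rw [jetNorm_eq]
    linarith [s2.1, Real.abs_sin_le_one (1 / 2 * (f x + g x))]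
  constructor
  · refine (((c1.mul hρ c2).const_mul 2).mono (le_of_eq ?_)).congr
      (Filter.Eventually.of_forall fun z => ?_)
    · norm_num; ring
    · beta_reduce
      rw [Real.sin_sub_sin]; ring_nf
  · refine (((c3.mul hρ c1).const_mul (-2)).mono (le_of_eq ?_)).congr
      (Filter.Eventually.of_forall fun z => ?_)
    · norm_num; ring
    · beta_reduce
      rw [Real.cos_sub_cos]; ring_nf

/-- If all derivatives of a sequence of angle functions are bounded and its steps are summable,
then the cocycles converge in the `C^∞` topology. -/
theorem exists_limit_cocycle {p : ℕ → ℝ → ℝ} {lam : ℝ} (hl : lam ≠ 0)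
    (hp : ∀ j, ContDiff ℝ ∞ (p j)) (hper : ∀ j, Function.Periodic (cocycle lam (p j)) (2 * Real.pi))
    (hbd : ∀ k : ℕ, ∃ b, 0 ≤ b ∧ ∃ j₀, ∀ j ≥ j₀, ∀ l < k, ∀ x, |iteratedDeriv (l + 1) (p j) x| ≤ b)
    (hstep : ∀ k : ℕ, ∃ A, 0 ≤ A ∧ ∃ j₀, ∀ j ≥ j₀, ∀ l ≤ k, ∀ x,
      |iteratedDeriv l (fun x => p (j + 1) x - p j x) x| ≤ A * Real.exp (-(j : ℝ))) :
    ∃ D, IsSmoothCocycle D ∧ ∀ k, TendstoCk k (fun j => cocycle lam (p j)) D := by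
  have key : ∀ k, ∃ A j₀, ∀ j ≥ j₀, ∀ x,
      |iteratedDeriv k (fun z => Real.sin (p (j + 1) z)) x -
        iteratedDeriv k (fun z => Real.sin (p j z)) x| ≤ A * (1 / 2) ^ j ∧
      |iteratedDeriv k (fun z => Real.cos (p (j + 1) z)) x -
        iteratedDeriv k (fun z => Real.cos (p j z)) x| ≤ A * (1 / 2) ^ j := by
    intro k
    obtain ⟨b, hb, j₁, hb'⟩ := hbd k
    obtain ⟨A, hA, j₂, hA'⟩ := hstep k
    have hk : (0 : ℝ) ≤ k := Nat.cast_nonneg k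
    set ρ := (1 + 2 * k * (k * b))⁻¹ with hρ
    have hρ0 : 0 < ρ := by positivity
    have hρ1 : ρ ≤ 1 := inv_le_one_of_one_le₀ (by linarith [(by positivity : 0 ≤ 2 * k * (k * b))])
    have hosc : ∀ j ≥ j₁, ∀ x, jetOsc k ρ x (p j) ≤ ρ * (k * b) := by
      intro j hj x
      calc jetOsc k ρ x (p j) ≤ ∑ _r ∈ Finset.range k, ρ * b := by
            refine Finset.sum_le_sum fun r hr => ?_
            refine mul_le_mul ((div_le_self (by positivity) (by
              exact_mod_cast Nat.succ_le_of_lt (Nat.factorial_pos _))).trans ?_)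
              (hb' j hj r (by simpa using hr) x) (abs_nonneg _) hρ0.le
            rw [pow_succ]
            exact mul_le_of_le_one_left hρ0.le (pow_le_one₀ hρ0.le hρ1)
        _ = _ := by rw [Finset.sum_const, Finset.card_range, nsmul_eq_mul]; ring
    have hM : 2 * k * (ρ * (k * b)) ≤ 1 := by
      have : ρ * (1 + 2 * k * (k * b)) = 1 := by rw [hρ]; field_simp
      nlinarith
    refine ⟨k.factorial * (ρ ^ k)⁻¹ * (4 * (2 * k + 1) * ((k + 1) * A)), max j₁ j₂, fun j hj x => ?_⟩
    have h1 := jetLe_sin_cos_sub hρ0.le (hp (j + 1)).contDiffAt (hp j).contDiffAt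
      (hosc (j + 1) (by omega) x) (hosc j (by omega) x) hM
      (jetNorm_le_of_bounds hρ0.le hρ1 fun l hl => hA' j (by omega) l hl x)
    have hexp : Real.exp (-(j : ℝ)) ≤ (1 / 2) ^ j := by
      rw [← mul_neg_one, Real.exp_nat_mul]
      gcongr
      rw [Real.exp_neg, one_div]
      exact inv_anti₀ (by norm_num) (by linarith [Real.add_one_le_exp 1])
    have hfin : k.factorial * (ρ ^ k)⁻¹ * (4 * (2 * k + 1) * ((k + 1) * (A * Real.exp (-(j : ℝ))))) ≤
        k.factorial * (ρ ^ k)⁻¹ * (4 * (2 * k + 1) * ((k + 1) * A)) * (1 / 2) ^ j := by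
      calc _ ≤ k.factorial * (ρ ^ k)⁻¹ * (4 * (2 * k + 1) * ((k + 1) * (A * (1 / 2) ^ j))) := by
            gcongr
        _ = _ := by ring
    have e1 : iteratedDeriv k (fun z => Real.sin (p (j + 1) z) - Real.sin (p j z)) x =
        iteratedDeriv k (fun z => Real.sin (p (j + 1) z)) x -
          iteratedDeriv k (fun z => Real.sin (p j z)) x :=
      iteratedDeriv_fun_sub (contDiffAt_nat (hp (j + 1)).sin.contDiffAt k)
        (contDiffAt_nat (hp j).sin.contDiffAt k)
    have e2 : iteratedDeriv k (fun z => Real.cos (p (j + 1) z) - Real.cos (p j z)) x =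
        iteratedDeriv k (fun z => Real.cos (p (j + 1) z)) x -
          iteratedDeriv k (fun z => Real.cos (p j z)) x :=
      iteratedDeriv_fun_sub (contDiffAt_nat (hp (j + 1)).cos.contDiffAt k)
        (contDiffAt_nat (hp j).cos.contDiffAt k)
    rw [← e1, ← e2]
    exact ⟨(iteratedDeriv_le_jet hρ0 hρ1 le_rfl h1.1).trans hfin,
      (iteratedDeriv_le_jet hρ0 hρ1 le_rfl h1.2).trans hfin⟩
  -- every entry of the cocycle is a multiple of the sine or of the cosine
  have hent : ∀ a b : Fin 2, ∃ g, ContDiff ℝ ∞ g ∧ ∀ r, TendstoUniformly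
      (fun j => iteratedDeriv r fun x => cocycle lam (p j) x a b) (iteratedDeriv r g)
        Filter.atTop := by
    intro a b
    refine exists_smooth_limit (fun j => contDiff_cocycle lam (hp j) a b) fun r => ?_
    obtain ⟨A, j₀, hA⟩ := key r
    have hmul : ∀ (c : ℝ) (f g : ℝ → ℝ) (x B : ℝ), |iteratedDeriv r f x - iteratedDeriv r g x| ≤ B →
        |iteratedDeriv r (fun z => c * f z) x - iteratedDeriv r (fun z => c * g z) x| ≤ |c| * B := by
      intro c f g x B h
      rw [iteratedDeriv_const_mul_field, iteratedDeriv_const_mul_field, ← mul_sub, abs_mul]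
      gcongr
    have hcase : ∃ c : ℝ, (∀ q : ℝ → ℝ, (fun x => cocycle lam q x a b) = fun x => c * Real.sin (q x))
        ∨ (∀ q : ℝ → ℝ, (fun x => cocycle lam q x a b) = fun x => c * Real.cos (q x)) := by
      simp only [cocycle_eq]
      fin_cases a <;> fin_cases b
      · exact ⟨lam, Or.inl fun q => rfl⟩
      · exact ⟨-lam, Or.inr fun q => funext fun x => by simp⟩
      · exact ⟨lam⁻¹, Or.inr fun q => rfl⟩
      · exact ⟨lam⁻¹, Or.inl fun q => rfl⟩
    obtain ⟨c, h | h⟩ := hcase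
    · refine ⟨|c| * A, j₀, fun j hj x => ?_⟩
      rw [h, h, mul_assoc]
      exact hmul c _ _ x _ (hA j hj x).1
    · refine ⟨|c| * A, j₀, fun j hj x => ?_⟩
      rw [h, h, mul_assoc]
      exact hmul c _ _ x _ (hA j hj x).2
  choose g hg hlim using hent
  have hpt : ∀ a b x, Filter.Tendsto (fun j => cocycle lam (p j) x a b) Filter.atTop
      (nhds (g a b x)) := fun a b x => by
    have := (hlim a b 0).tendsto_at x
    simpa only [iteratedDeriv_zero] using this
  refine ⟨fun x => Matrix.of fun a b => g a b x, ⟨fun x => ?_, fun x => ?_, hg⟩,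
    fun k r _ a b => hlim a b r⟩
  · rw [Matrix.det_fin_two]
    refine tendsto_nhds_unique (((hpt 0 0 x).mul (hpt 1 1 x)).sub ((hpt 0 1 x).mul (hpt 1 0 x)))
      (tendsto_const_nhds.congr fun j => ?_)
    rw [← Matrix.det_fin_two, det_cocycle hl]
  · ext a b
    exact tendsto_nhds_unique (hpt a b _) ((hpt a b x).congr fun j => by rw [hper j x])

/-! ### The starting angle function -/

section Start

variable {d : ℕ} {a c₁ δ₀ : ℝ} {φ : ℝ → ℝ}

theorem abs_flat {t : ℝ} (ht : t ≠ 0) (a : ℝ) : |flat a t| = Real.exp (-(1 / |t| ^ a)) := by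
  rw [flat, abs_mul, abs_of_pos (Real.exp_pos _)]
  rcases Real.sign_apply_eq_of_ne_zero t ht with h | h <;> rw [h] <;> simp

theorem IsStart.add_int (h : IsStart d a c₁ δ₀ φ) (x : ℝ) (k : ℤ) :
    φ (x + k * (2 * Real.pi)) = φ x + k * (2 * Real.pi * d) := by
  induction k using Int.induction_on with
  | zero => simp
  | succ k ih =>
    have := h.lift (x + k * (2 * Real.pi))
    push_cast at *
    rw [show x + (k + 1) * (2 * Real.pi) = x + k * (2 * Real.pi) + 2 * Real.pi by ring, this, ih]
    ring
  | pred k ih =>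
    have := h.lift (x + (-k - 1) * (2 * Real.pi))
    push_cast at *
    rw [show x + (-k - 1) * (2 * Real.pi) + 2 * Real.pi = x + -k * (2 * Real.pi) by ring, ih] at this
    linarith

/-- Near the critical points the starting angle function is the flat one modulo `π`. -/
theorem IsStart.near (h : IsStart d a c₁ δ₀ φ) (hδ₁ : δ₀ < Real.pi / 2) (hd : d = 0 ∨ d = 1) {z : ℝ}
    (hz : critDist c₁ z ≤ δ₀) :
    (∃ m : ℤ, φ z = phi0 d a c₁ z + m * Real.pi) ∧
      (0 < critDist c₁ z → |phi0 d a c₁ z| = Real.exp (-(1 / critDist c₁ z ^ a))) := by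
  have hπ := Real.pi_pos
  set t := toIcoMod Real.two_pi_pos (-(Real.pi / 2)) (z - c₁) with ht
  set k := toIcoDiv Real.two_pi_pos (-(Real.pi / 2)) (z - c₁) with hk
  have hmem := toIcoMod_mem_Ico Real.two_pi_pos (-(Real.pi / 2)) (z - c₁)
  have hadd := toIcoMod_add_toIcoDiv_zsmul Real.two_pi_pos (-(Real.pi / 2)) (z - c₁)
  rw [← ht] at hmem hadd
  rw [← hk, zsmul_eq_mul] at hadd
  have hz' : z = c₁ + t + k * (2 * Real.pi) := by linarith
  have hφ := h.add_int (c₁ + t) k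
  rw [← hz'] at hφ
  obtain ⟨j, hj⟩ : ∃ j : ℤ, critDist c₁ z = |t - j * Real.pi| :=
    ⟨round ((z - c₁) / Real.pi) - 2 * k, by
      rw [critDist]; congr 1; push_cast; linarith⟩
  have hjl := abs_le.1 (hj ▸ hz)
  obtain ⟨m1, m2⟩ := hmem
  have j1 : j < 2 := by
    by_contra! hc
    have : (2 : ℝ) ≤ j := by exact_mod_cast hc
    nlinarith
  have j0 : -1 < j := by
    by_contra! hc
    have : (j : ℝ) ≤ -1 := by exact_mod_cast hc
    nlinarith
  obtain rfl | rfl : j = 0 ∨ j = 1 := by omega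
  · have hlt : t < Real.pi / 2 := by
      push_cast at hjl; linarith
    simp only [Int.cast_zero, zero_mul, sub_zero] at hj
    have hp : phi0 d a c₁ z = flat a t := by
      simp only [phi0, ← ht, if_pos hlt]
    have hn := h.near₁ (c₁ + t) (by rw [add_sub_cancel_left, ← hj]; exact hz)
    rw [add_sub_cancel_left] at hn
    refine ⟨⟨2 * k * d, ?_⟩, fun h0 => ?_⟩
    · rw [hφ, hn, hp]; push_cast; ring
    · rw [hj] at h0 ⊢
      rw [hp, abs_flat (abs_pos.1 h0)]
  · have hge : ¬ t < Real.pi / 2 := by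
      push_cast at hjl; linarith
    simp only [Int.cast_one, one_mul] at hj
    have hp : phi0 d a c₁ z = (2 * d - 1) * flat a (t - Real.pi) := by
      simp only [phi0, ← ht, if_neg hge]
    have e : c₁ + t - (c₁ + Real.pi) = t - Real.pi := by ring
    have hn := h.near₂ (c₁ + t) (by rw [e, ← hj]; exact hz)
    rw [e] at hn
    refine ⟨⟨2 * k * d + d, ?_⟩, fun h0 => ?_⟩
    · rw [hφ, hn, hp]; push_cast; ring
    · rw [hj] at h0 ⊢
      rw [hp, abs_mul, abs_flat (abs_pos.1 h0)]
      rcases hd with rfl | rfl <;> norm_num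

theorem mul_abs_le_abs_sin {y : ℝ} (hy : |y| ≤ Real.pi / 2) : 2 / Real.pi * |y| ≤ |Real.sin y| := by
  have h1 := Real.mul_le_sin (abs_nonneg y) hy
  rcases abs_cases y with ⟨h, _⟩ | ⟨h, _⟩
  · rw [h] at h1 ⊢; exact h1.trans (le_abs_self _)
  · rw [h] at h1 ⊢
    rw [Real.sin_neg] at h1
    exact h1.trans (neg_le_abs _)

theorem abs_sin_add_int_mul_pi (x : ℝ) (m : ℤ) : |Real.sin (x + m * Real.pi)| = |Real.sin x| := by
  rw [Real.sin_add_int_mul_pi, abs_mul, abs_zpow, abs_neg, abs_one, one_zpow, one_mul]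

/-- A weakly flat function is bounded below by a function of the flatness `exp (-1 / √t)`. -/
theorem exp_sqrt_le_exp_rpow {t a : ℝ} (ht : 0 < t) (ha₀ : 0 < a) (ha₁ : a < 1 / 10) :
    Real.exp (-1) * Real.exp (-(1 / Real.sqrt t)) ≤ Real.exp (-(1 / t ^ a)) := by
  rw [← Real.exp_add, Real.exp_le_exp]
  have hs : 0 < 1 / Real.sqrt t := by positivity
  rcases le_or_gt t 1 with h | h
  · have h1 : Real.sqrt t ≤ t ^ a := by
      rw [Real.sqrt_eq_rpow]
      exact Real.rpow_le_rpow_of_exponent_ge ht h (by linarith)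
    have h2 := one_div_le_one_div_of_le (Real.sqrt_pos.2 ht) h1
    linarith
  · have h1 : 1 ≤ t ^ a := Real.one_le_rpow h.le ha₀.le
    have h2 : 1 / t ^ a ≤ 1 := by rw [div_le_one (by positivity)]; exact h1
    linarith

theorem IsStart.exists_lower (h : IsStart d a c₁ δ₀ φ) (ha₀ : 0 < a) (ha₁ : a < 1 / 10)
    (hδ₁ : δ₀ < Real.pi / 2) (hd : d = 0 ∨ d = 1) :
    ∃ c₀, 0 < c₀ ∧ c₀ ≤ 1 ∧ ∀ z, 0 < critDist c₁ z →
      c₀ * Real.exp (-(1 / Real.sqrt (critDist c₁ z))) ≤ |Real.sin (φ z)| := by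
  have hπ := Real.pi_pos
  have hπ3 := Real.pi_gt_three
  set ε := Real.exp (-(1 / δ₀ ^ a)) with hε
  refine ⟨min (2 / Real.pi * Real.exp (-1)) (2 / Real.pi * ε), by positivity, ?_, fun z hz => ?_⟩
  · refine (min_le_left _ _).trans ?_
    have h1 : Real.exp (-1) ≤ 1 := Real.exp_le_one_iff.2 (by norm_num)
    have h2 : 2 / Real.pi ≤ 1 := by rw [div_le_one hπ]; linarith
    have := mul_le_mul h2 h1 (Real.exp_pos _).le zero_le_one
    linarith
  · rcases le_or_gt (critDist c₁ z) δ₀ with hzd | hzd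
    · obtain ⟨⟨m, hm⟩, habs⟩ := h.near hδ₁ hd hzd
      have h1 := habs hz
      have h2 : |phi0 d a c₁ z| ≤ 1 := by
        rw [h1, Real.exp_le_one_iff]
        have : 0 < 1 / critDist c₁ z ^ a := by positivity
        linarith
      rw [hm, abs_sin_add_int_mul_pi]
      refine le_trans ?_ (mul_abs_le_abs_sin (by linarith))
      rw [h1]
      calc _ ≤ 2 / Real.pi * Real.exp (-1) * Real.exp (-(1 / Real.sqrt (critDist c₁ z))) := by
            gcongr; exact min_le_left _ _
        _ ≤ _ := by
            rw [mul_assoc]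
            gcongr
            exact exp_sqrt_le_exp_rpow hz ha₀ ha₁
    · have hfar := h.away z (fun hc => absurd (critDist_le_iff.2 hc) (not_le.2 hzd))
      set m := round (φ z / Real.pi) with hm
      have h1 := hfar m
      have h2 : |φ z - m * Real.pi| ≤ Real.pi / 2 := by
        have := abs_sub_round (φ z / Real.pi)
        rw [← hm] at this
        have e : φ z - m * Real.pi = (φ z / Real.pi - m) * Real.pi := by field_simp
        rw [e, abs_mul, abs_of_pos hπ]
        nlinarith
      have h3 := mul_abs_le_abs_sin h2
      have h4 := abs_sin_add_int_mul_pi (φ z - m * Real.pi) m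
      rw [sub_add_cancel] at h4
      rw [h4]
      refine le_trans ?_ h3
      have h5 : Real.exp (-(1 / Real.sqrt (critDist c₁ z))) ≤ 1 := by
        rw [Real.exp_le_one_iff]
        have : 0 ≤ 1 / Real.sqrt (critDist c₁ z) := by positivity
        linarith
      calc _ ≤ 2 / Real.pi * ε * 1 := by
            gcongr; exact min_le_right _ _
        _ ≤ _ := by rw [mul_one]; gcongr

end Start

/-! ### Periodicity -/

section Periodic

variable {w c₁ lam : ℝ} {d : ℕ} {r : ℕ → ℕ} {F : ℕ → ℝ → ℝ} {φ ψ : ℝ → ℝ}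

theorem periodic_cocycle (h : ∀ x, ψ (x + 2 * Real.pi) = ψ x + 2 * Real.pi * d) :
    Function.Periodic (cocycle lam ψ) (2 * Real.pi) := fun x => by
  rw [cocycle_eq, cocycle_eq, h, mul_comm (2 * Real.pi) (d : ℝ), Real.sin_add_nat_mul_two_pi,
    Real.cos_add_nat_mul_two_pi]

theorem periodic_fwd {A : ℝ → Mat} (h : Function.Periodic A (2 * Real.pi)) (m : ℕ) :
    Function.Periodic (fwd w A m) (2 * Real.pi) := fun y => by
  induction m with
  | zero => rfl
  | succ m ih =>
    rw [fwd, fwd, ih, show y + 2 * Real.pi + 2 * Real.pi * w * m =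
      y + 2 * Real.pi * w * m + 2 * Real.pi by ring, h]

theorem periodic_offset (h : Function.Periodic (cocycle lam ψ) (2 * Real.pi)) (m : ℕ) :
    Function.Periodic (offset w lam ψ m) (2 * Real.pi) := fun x => by
  have h1 : ∀ y s : ℝ, fwd w (cocycle lam ψ) m (y + 2 * Real.pi + s) =
      fwd w (cocycle lam ψ) m (y + s) := fun y s => by
    rw [add_right_comm, periodic_fwd h m]
  simp only [offset, dirStart, dirEnd, slopeStart, slopeEnd, growth, sub_eq_add_neg, h1]

theorem psi_add_two_pi (hF : ∀ j, Function.Periodic (F j) (2 * Real.pi))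
    (h : ∀ x, φ (x + 2 * Real.pi) = φ x + 2 * Real.pi * d) (j : ℕ) :
    ∀ x, psi w lam r F φ j (x + 2 * Real.pi) = psi w lam r F φ j x + 2 * Real.pi * d := by
  induction j with
  | zero => exact h
  | succ j ih =>
    intro x
    have hp := fun m => periodic_offset (w := w) (periodic_cocycle (lam := lam) ih) m x
    have hc : corr w lam r (psi w lam r F φ j) j (x + 2 * Real.pi) =
        corr w lam r (psi w lam r F φ j) j x := by
      cases j <;> simp only [corr, hp]
    simp only [psi]
    rw [ih, hc, hF j x]
    ring

theorem exists_bound_iteratedDeriv {f : ℝ → ℝ} {c : ℝ} (hf : ContDiff ℝ ∞ f)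
    (h : ∀ x, f (x + 2 * Real.pi) = f x + c) (l : ℕ) :
    ∃ M, ∀ x, |iteratedDeriv (l + 1) f x| ≤ M := by
  have hper : Function.Periodic (iteratedDeriv (l + 1) f) (2 * Real.pi) := fun x => by
    have hs := congrFun (iteratedDeriv_comp_add_const (l + 1) f (2 * Real.pi)) x
    rw [← hs, show (fun z => f (z + 2 * Real.pi)) = fun z => f z + c from
      funext h, iteratedDeriv_succ', iteratedDeriv_succ']
    congr 1
    funext z
    exact deriv_add_const c
  have hcont : Continuous (iteratedDeriv (l + 1) f) :=
    hf.continuous_iteratedDeriv (l + 1) (by exact_mod_cast le_top)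
  obtain ⟨M, hM⟩ := (hper.isBounded_of_continuous Real.two_pi_pos.ne' hcont).exists_norm_le
  exact ⟨M, fun x => by simpa using hM _ ⟨x, rfl⟩⟩

end Periodic

/-! ### The construction in terms of contracted directions -/

section Angle

variable {w c₁ κ C₁ M₂ lam K B c₀ : ℝ} {R : ℕ → ℝ} {r : ℕ → ℕ} {F : ℕ → ℝ → ℝ} {φ : ℝ → ℝ}
  {N : ℕ} {f : ℕ → ℝ → ℝ} {d : ℕ} {a : ℝ}

theorem rep_eq_of_add_int {θ e : ℝ} {m : ℤ} (h : θ = e + m * Real.pi) (he : |e| < Real.pi / 2) :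
    rep θ = e := by
  rw [rep, toIocMod_eq_iff]
  rw [abs_lt] at he
  exact ⟨⟨he.1, by linarith [he.2]⟩, m, by rw [h, zsmul_eq_mul]⟩

namespace Scheme

theorem one_lt_lam (hS : Scheme w c₁ κ C₁ M₂ lam K B c₀ R r F φ) : 1 < lam := by
  have h8 := hS.dom.eight_le
  have hκ := hS.dom.κ_pos
  refine lt_of_le_of_ne hS.dom.one_le fun h => ?_
  rw [← h, Real.log_one, mul_zero] at h8
  norm_num at h8

theorem one_lt_of_isGood (hS : Scheme w c₁ κ C₁ M₂ lam K B c₀ R r F φ) {ψ : ℝ → ℝ} {m : ℕ} {y : ℝ}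
    (h : IsGood w lam K B ψ m y) : 1 < (lam * growth w lam ψ m y) ^ 2 := by
  have h1 := hS.one_lt_lam
  have h2 := hS.const.lam_ge
  have h3 : 1 ≤ Real.exp (1 / Real.sqrt κ) := Real.one_le_exp (by positivity)
  have h4 : 1 ≤ lam * Real.exp (-K) := by
    have : 0 < lam * Real.exp (-K) := by positivity
    nlinarith
  have h5 := (one_le_pow₀ h4 (n := m)).trans (h.pow_le hS.const)
  rw [← sq_abs, abs_mul, abs_of_pos (by linarith)]
  have h6 : 1 < lam * |growth w lam ψ m y| := by nlinarith
  exact one_lt_pow₀ h6 (by norm_num)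

theorem isGood_future (hS : Scheme w c₁ κ C₁ M₂ lam K B c₀ R r F φ) {k j : ℕ} (hkj : k ≤ j)
    {x : ℝ} (hx : critDist c₁ x ≤ R k) :
    IsGood w lam K B (psi w lam r F φ j) (r k - 1) (x + 2 * Real.pi * w) :=
  hS.isGood (hS.trans j) ((hS.ladder.ret k).clean_future hS.recurrent hx)
    (((hS.ladder.ret k).free_future hx).mono (hS.ladder.antitone hkj))

theorem isGood_past (hS : Scheme w c₁ κ C₁ M₂ lam K B c₀ R r F φ) {k j : ℕ} (hkj : k ≤ j)
    {x : ℝ} (hx : critDist c₁ x ≤ R k) :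
    IsGood w lam K B (psi w lam r F φ j) (r k - 1) (x - 2 * Real.pi * w * (r k - 1 : ℕ)) :=
  hS.isGood (hS.trans j) ((hS.ladder.ret k).clean_past hS.recurrent hx)
    (((hS.ladder.ret k).free_past hx).mono (hS.ladder.antitone hkj))

/-- The angle functions of the scheme for the neighbourhoods, return times and cutoffs from
level `N` on. -/
def angles (w c₁ lam : ℝ) (φ : ℝ → ℝ) (N : ℕ) (f : ℕ → ℝ → ℝ) : ℕ → ℝ → ℝ :=
  psi w lam (fun j => rPlus w c₁ (N + j)) (fun j => f (N + j)) φ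

theorem gapDefined (hS : Scheme w c₁ κ C₁ M₂ lam K B c₀ (fun j => 1 / q w (N + j) ^ 2)
      (fun j => rPlus w c₁ (N + j)) (fun j => f (N + j)) φ)
    (hr : ∀ n, rMinus w c₁ n = rPlus w c₁ n) {k j : ℕ} (hkj : k ≤ j) :
    GapDefined w c₁ lam (N + k) (angles w c₁ lam φ N f j) := by
  intro x hx
  rw [mem_critInt_iff, one_mul] at hx
  have hl : lam ≠ 0 := by linarith [hS.one_lt_lam]
  have hpos := (hS.ladder.ret k).pos
  rw [hr, show rPlus w c₁ (N + k) = rPlus w c₁ (N + k) - 1 + 1 by omega]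
  exact ⟨isHyperbolic_fwd hl _ _ (hS.one_lt_of_isGood (hS.isGood_future hkj hx)),
    isHyperbolic_bwd hl _ _ (hS.one_lt_of_isGood (hS.isGood_past hkj hx))⟩

theorem exists_gap_eq (hS : Scheme w c₁ κ C₁ M₂ lam K B c₀ (fun j => 1 / q w (N + j) ^ 2)
      (fun j => rPlus w c₁ (N + j)) (fun j => f (N + j)) φ)
    (hr : ∀ n, rMinus w c₁ n = rPlus w c₁ n) {k j : ℕ} (hkj : k ≤ j) {x : ℝ}
    (hx : critDist c₁ x ≤ 1 / q w (N + k) ^ 2) :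
    ∃ m : ℤ, gap w c₁ lam (N + k) (angles w c₁ lam φ N f j) x =
      angles w c₁ lam φ N f j x +
        offset w lam (angles w c₁ lam φ N f j) (rPlus w c₁ (N + k) - 1) x + m * Real.pi := by
  have hl : lam ≠ 0 := by linarith [hS.one_lt_lam]
  have hpos := (hS.ladder.ret k).pos
  obtain ⟨m₁, h₁⟩ := contracted_fwd (φ := angles w c₁ lam φ N f j) hl (rPlus w c₁ (N + k) - 1) x
    (hS.one_lt_of_isGood (hS.isGood_future hkj hx))
  obtain ⟨m₂, h₂⟩ := contracted_bwd (φ := angles w c₁ lam φ N f j) hl (rPlus w c₁ (N + k) - 1) x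
    (hS.one_lt_of_isGood (hS.isGood_past hkj hx))
  rw [show rPlus w c₁ (N + k) - 1 + 1 = rPlus w c₁ (N + k) by omega] at h₁ h₂
  refine ⟨m₁ - m₂, ?_⟩
  rw [gap, hr, h₁, h₂, offset]
  push_cast; ring

/-- The construction by contracted directions is the one by offsets: modulo `π` the difference of
the contracted directions is the angle function plus the offset, and the offsets are small. -/
theorem angle_eq (hS : Scheme w c₁ κ C₁ M₂ lam K B c₀ (fun j => 1 / q w (N + j) ^ 2)
      (fun j => rPlus w c₁ (N + j)) (fun j => f (N + j)) φ)
    (hr : ∀ n, rMinus w c₁ n = rPlus w c₁ n)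
    (h0 : ∀ x, critDist c₁ x ≤ 1 / q w N ^ 2 → ∃ m : ℤ, φ x = phi0 d a c₁ x + m * Real.pi) (j : ℕ) :
    angle w d a c₁ lam φ N f j = angles w c₁ lam φ N f (j + 1) := by
  have hπ := Real.pi_gt_three
  induction j with
  | zero =>
    funext x
    simp only [angle, correct, angles, psi]
    rcases le_or_gt (critDist c₁ x) (1 / q w N ^ 2) with hx | hx
    · obtain ⟨m, hm⟩ := hS.exists_gap_eq hr (le_refl 0) (x := x) hx
      obtain ⟨m', hm'⟩ := h0 x hx
      simp only [angles, psi, add_zero] at hm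
      have hsmall := hS.abs_corr_zero_le (hS.trans 0) (x := x) hx
      rw [rep_eq_of_add_int (e := corr w lam (fun j => rPlus w c₁ (N + j)) φ 0 x) (m := -m' - m)]
      · rfl
      · rw [hm, hm']
        simp only [corr, add_zero]
        push_cast; ring
      · have h1 := hS.first
        have h2 := hS.const.c₂_le
        have h3 : Real.exp (-Real.sqrt (10 * (1 / (1 / q w (N + 0) ^ 2)))) ≤ 1 :=
          Real.exp_le_one_iff.2 (by linarith [Real.sqrt_nonneg (10 * (1 / (1 / q w (N + 0) ^ 2)))])
        have h4 := hS.const.c₂_pos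
        have h5 : |corr w lam (fun j => rPlus w c₁ (N + j)) φ 0 x| ≤ 1 / 2 :=
          (hsmall.trans h1).trans (by nlinarith)
        linarith
    · have hz := hS.F_zero 0 x hx
      simp only [add_zero] at hz ⊢
      rw [hz, mul_zero, mul_zero]
  | succ j ih =>
    funext x
    rw [angle, ih, correct]
    change _ = angles w c₁ lam φ N f (j + 1) x + corr w lam (fun j => rPlus w c₁ (N + j))
      (angles w c₁ lam φ N f (j + 1)) (j + 1) x * f (N + (j + 1)) x
    rw [add_assoc N j 1]
    rcases le_or_gt (critDist c₁ x) (1 / q w (N + (j + 1)) ^ 2) with hx | hx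
    · obtain ⟨m, hm⟩ := hS.exists_gap_eq hr (Nat.le_succ j) (x := x)
        (hx.trans (hS.ladder.anti j))
      obtain ⟨m', hm'⟩ := hS.exists_gap_eq hr (le_refl (j + 1)) (x := x) hx
      have hsmall := hS.abs_corr_succ_le (hS.trans (j + 1)) (x := x) hx
      have hE := hS.dom.exp_le (hS.ladder.one_le (j + 1))
      rw [rep_eq_of_add_int (e := corr w lam (fun j => rPlus w c₁ (N + j))
        (angles w c₁ lam φ N f (j + 1)) (j + 1) x) (m := m - m')]
      · rw [hm, hm']
        simp only [corr]
        push_cast; ring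
      · refine lt_of_le_of_lt hsmall ?_
        linarith
    · have hz := hS.F_zero (j + 1) x hx
      rw [hz, mul_zero, mul_zero]

end Scheme

end Angle

/-! ### The choice of the parameters -/

/-- All conditions on `lam` hold for large `lam`. -/
theorem exists_lam {κ c₀ κ₂ C e₁ e₂ : ℝ} (hκ : 0 < κ) (hc₀ : 0 < c₀) (hc₁ : c₀ ≤ 1) (hκ₂ : 0 < κ₂)
    (he₁ : 0 < e₁) (he₂ : 0 < e₂) :
    ∃ K B lam₀ : ℝ, ∀ lam ≥ lam₀, Constants κ (c₀ / 4) K B lam ∧ Dominates lam K κ₂ C ∧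
      20 ≤ rate κ₂ lam ∧ 160 * Real.exp (1 - rate κ₂ lam / 20) ≤ c₀ ∧
      3 * (lam⁻¹ ^ 2 * B) ≤ e₁ ∧
      2 * (lam⁻¹ ^ 2 * B) + 16 * Real.exp (-rate κ₂ lam) ≤ e₂ ∧ JetConstants κ (c₀ / 4) K lam := by
  set K := 2 * (1 / Real.sqrt κ - Real.log (c₀ / 4)) with hK
  set B := 4 / (c₀ / 4) * Real.exp (1 / Real.sqrt κ) with hB
  have hK0 : 0 ≤ K := by
    have h1 : 0 ≤ 1 / Real.sqrt κ := by positivity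
    have h2 := Real.log_nonpos (by positivity : 0 ≤ c₀ / 4) (by linarith)
    linarith
  have tlog : Filter.Tendsto (fun lam => rate κ₂ lam) Filter.atTop Filter.atTop :=
    Real.tendsto_log_atTop.const_mul_atTop hκ₂
  have tinv : Filter.Tendsto (fun lam : ℝ => lam⁻¹ ^ 2 * B) Filter.atTop (nhds 0) := by
    have := (tendsto_inv_atTop_zero (𝕜 := ℝ)).pow 2 |>.mul_const B
    simpa using this
  have tsq : ∀ c : ℝ, 0 < c → Filter.Tendsto (fun lam : ℝ => (lam * c) ^ 2) Filter.atTop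
      Filter.atTop := fun c hc =>
    (Filter.tendsto_pow_atTop (by norm_num)).comp (Filter.tendsto_id.atTop_mul_const hc)
  have texp : Filter.Tendsto (fun lam => 160 * Real.exp (1 - rate κ₂ lam / 20)) Filter.atTop
      (nhds 0) := by
    have h1 : Filter.Tendsto (fun lam => 1 - rate κ₂ lam / 20) Filter.atTop Filter.atBot := by
      simp only [sub_eq_add_neg]
      exact Filter.tendsto_atBot_add_const_left _ _
        (Filter.tendsto_neg_atTop_atBot.comp (tlog.atTop_div_const (by norm_num)))
    simpa using (Real.tendsto_exp_atBot.comp h1).const_mul 160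
  have tfirst : Filter.Tendsto (fun lam => 2 * (lam⁻¹ ^ 2 * B) + 16 * Real.exp (-rate κ₂ lam))
      Filter.atTop (nhds 0) := by
    have h1 := (Real.tendsto_exp_atBot.comp (Filter.tendsto_neg_atTop_atBot.comp tlog)).const_mul 16
    simpa using (tinv.const_mul 2).add h1
  have tbase : Filter.Tendsto (fun lam : ℝ => 3 * (lam⁻¹ ^ 2 * B)) Filter.atTop (nhds 0) := by
    simpa using tinv.const_mul 3
  refine ⟨K, B, ?_⟩
  rw [← Filter.eventually_atTop]
  filter_upwards [Filter.eventually_ge_atTop 1,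
    tinv.eventually (gt_mem_nhds (by norm_num : (0 : ℝ) < 1 / 200)),
    (tsq _ (Real.exp_pos (-K))).eventually_ge_atTop (2 * Real.exp (1 / Real.sqrt κ)),
    (tsq _ (Real.exp_pos (-K))).eventually_ge_atTop (4 * Real.exp (1 / Real.sqrt κ) ^ 2),
    (tsq _ (by positivity : 0 < c₀ / 4)).eventually_ge_atTop (524 * Real.exp (1 / Real.sqrt κ) ^ 2),
    tlog.eventually_ge_atTop 20, tlog.eventually_ge_atTop (2 * C * (K + Real.log 4)),
    texp.eventually (gt_mem_nhds hc₀), tbase.eventually (gt_mem_nhds he₁),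
    tfirst.eventually (gt_mem_nhds he₂)] with lam h1 h2 h3 h4 h5 h6 h7 h8 h9 h10
  refine ⟨⟨hκ, by positivity, by linarith, le_rfl, le_rfl, h1, h3, h2.le⟩,
    ⟨h1, hK0, hκ₂, h7, ?_⟩, h6, h8.le, h9.le, h10.le, ⟨?_, h4⟩⟩
  · rw [rate] at h6; linarith
  · rw [mul_pow] at h5; linarith

theorem IsReturn.mono {w c₁ κ C C' R : ℝ} {r : ℕ} (h : IsReturn w c₁ κ C R r) (hC : C ≤ C') :
    IsReturn w c₁ κ C' R r :=
  ⟨h.pos, h.lower, h.upper.trans hC, h.free_add, h.free_sub, h.near_add, h.near_sub⟩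

theorem ladder_of_le {w c₁ κ C₁ M : ℝ} (hrec : Recurrent w c₁ κ C₁) (hw : Irrational w)
    (hM : ∀ n, q w (n + 1) < M * q w n) {N : ℕ} (hN : 1 ≤ N) (hN' : 2 * M ^ 2 / κ ≤ N) :
    Ladder w c₁ κ (C₁ + 2) (M ^ 2) (fun j => 1 / q w (N + j) ^ 2) fun j => rPlus w c₁ (N + j) := by
  have hq1 := one_le_q hw
  have hq0 : ∀ n, 0 < q w n := fun n => zero_lt_one.trans_le (hq1 n)
  have hle : ∀ j : ℕ, ((N + j : ℕ) : ℝ) ≤ 1 / (1 / q w (N + j) ^ 2) := fun j => by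
    rw [one_div_one_div]
    nlinarith [le_q hw (N + j), hq1 (N + j)]
  refine ⟨hrec.pos, fun j => by have := hq0 (N + j); positivity, fun j => ?_, fun j => ?_,
    fun j => ?_, ?_, fun j => ((isReturn_rPlus hrec hw (N + j)).1.mono (by linarith))⟩
  · have := hq0 (N + j)
    have h2 : q w (N + j) ≤ q w (N + (j + 1)) := q_mono w (N + j)
    gcongr
  · have h1 := hq0 (N + j)
    have h2 : q w (N + (j + 1)) < M * q w (N + j) := hM (N + j)
    have h3 := hq0 (N + (j + 1))
    rw [mul_one_div, div_le_div_iff₀ (by positivity) (by positivity), one_mul, ← mul_pow]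
    exact pow_le_pow_left₀ h3.le h2.le 2
  · refine le_trans ?_ (hle j)
    push_cast
    have : (1 : ℝ) ≤ N := by exact_mod_cast hN
    linarith
  · exact hN'.trans (by simpa using hle 0)

theorem IsCutoff.mem_Icc {w c₁ : ℝ} {N n : ℕ} {f : ℕ → ℝ → ℝ} (h : IsCutoff w c₁ N f) (hn : N ≤ n)
    (x : ℝ) : f n x ∈ Set.Icc (0 : ℝ) 1 := by
  by_cases h1 : x ∈ critInt w c₁ n 1
  · by_cases h2 : x ∈ critInt w c₁ n 10
    · rw [h.one n hn x h2]; norm_num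
    · exact h.mem n hn x ⟨h1, h2⟩
  · rw [h.zero n hn x h1]; norm_num

theorem IsCutoff.exists_deriv_le {w c₁ : ℝ} (hw : Irrational w) {N : ℕ} {f : ℕ → ℝ → ℝ}
    (h : IsCutoff w c₁ N f) (k : ℕ) : ∃ j₀, ∀ j ≥ j₀, ∀ l ≤ k, ∀ x,
      |iteratedDeriv l (f (N + j)) x| ≤ (1 / (1 / q w (N + j) ^ 2)) ^ (2 * k) := by
  -- the bounds on the cutoffs hold up to the order `q_n ^ (1 / 10)`, which is eventually above `k`
  refine ⟨k ^ 10, fun j hj l hl x => ?_⟩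
  have hq := le_q hw (N + j)
  have hq1 := one_le_q hw (N + j)
  have hk : (k : ℝ) ^ 10 ≤ q w (N + j) := by
    refine le_trans ?_ hq
    exact_mod_cast hj.trans (Nat.le_add_left j N)
  have hfl : l ≤ ⌊q w (N + j) ^ (1 / 10 : ℝ)⌋₊ := by
    refine hl.trans (Nat.le_floor ?_)
    have h1 := Real.rpow_le_rpow (by positivity) hk (by norm_num : (0 : ℝ) ≤ 1 / 10)
    rwa [← Real.rpow_natCast, ← Real.rpow_mul (Nat.cast_nonneg k),
      show ((10 : ℕ) : ℝ) * (1 / 10) = 1 by norm_num, Real.rpow_one] at h1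
  refine (h.deriv_le (N + j) (Nat.le_add_right N j) l hfl x).trans ?_
  rw [one_div_one_div, ← pow_mul]
  exact pow_le_pow_right₀ hq1 (by omega)

end FlatCocycle

end

theorem corollary5p1 (w : ℝ) (hw : IsBoundedType w)
    (a : ℝ) (ha₀ : 0 < a) (ha₁ : a < 1 / 10)
    (c₁ : ℝ) (hc₁ : c₁ ∈ Set.Ico 0 Real.pi)
    (δ₀ : ℝ) (hδ₀ : 0 < δ₀) (hδ₁ : δ₀ < Real.pi / 2)
    (d : ℕ) (hd : d = 0 ∨ d = 1) (φ : ℝ → ℝ) (hφ : IsStart d a c₁ δ₀ φ) :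
    ∃ N₀ : ℕ, ∀ N ≥ N₀,
      (∃ f, IsCutoff w c₁ N f) ∧
      ∃ lam₀ : ℝ, ∀ lam ≥ lam₀, ∀ f, IsCutoff w c₁ N f →
        -- the contracted directions used in the construction are well defined
        (GapDefined w c₁ lam N φ ∧
          ∀ j, GapDefined w c₁ lam (N + j) (angle w d a c₁ lam φ N f j) ∧
            GapDefined w c₁ lam (N + j + 1) (angle w d a c₁ lam φ N f j)) ∧
        -- the cocycles are smooth and converge in every C^k topology to a smooth cocycle
        (∀ j, IsSmoothCocycle (cocycle lam (angle w d a c₁ lam φ N f j))) ∧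
        ∃ D : ℝ → Mat, IsSmoothCocycle D ∧
          ∀ k : ℕ, TendstoCk k (fun j => cocycle lam (angle w d a c₁ lam φ N f j)) D := by
  obtain ⟨κ, C₁, hrec⟩ := exists_recurrent hw c₁
  obtain ⟨hirr, M, hM5, hM⟩ := hw
  obtain ⟨c₀, hc₀, hc₀1, hlow⟩ := hφ.exists_lower ha₀ ha₁ hδ₁ hd
  have hM0 : 0 < M := lt_of_lt_of_le (by positivity) hM5
  have hκ := hrec.pos
  refine ⟨max 100 (max ⌈2 * M ^ 2 / κ⌉₊ ⌈1 / δ₀⌉₊), fun N hN => ?_⟩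
  have hN100 : 100 ≤ N := (le_max_left _ _).trans hN
  have hNκ : 2 * M ^ 2 / κ ≤ N := (Nat.le_ceil _).trans (by
    exact_mod_cast ((le_max_left _ _).trans (le_max_right _ _)).trans hN)
  have hNδ : 1 / δ₀ ≤ N := (Nat.le_ceil _).trans (by
    exact_mod_cast ((le_max_right _ _).trans (le_max_right _ _)).trans hN)
  refine ⟨exists_isCutoff hirr c₁ hN100, ?_⟩
  have hL := ladder_of_le hrec hirr hM (by omega) hNκ
  have hqN : 0 < q w N := zero_lt_one.trans_le (one_le_q hirr N)
  obtain ⟨K, B, lam₀, hlam⟩ := exists_lam (κ₂ := κ / (2 * M ^ 2)) (C := C₁ + 2)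
    (e₁ := c₀ / 2 * Real.exp (-(1 / Real.sqrt (1 / q w (N + 0) ^ 2))))
    (e₂ := c₀ / 8 * Real.exp (-Real.sqrt (10 * (1 / (1 / q w (N + 0) ^ 2)))))
    hκ hc₀ hc₀1 (by positivity) (by positivity) (by positivity)
  refine ⟨lam₀, fun lam hl f hf => ?_⟩
  obtain ⟨h1, h2, h3, h4, h5, h6, hjet⟩ := hlam lam hl
  have hS : Scheme w c₁ κ C₁ (M ^ 2) lam K B c₀ (fun j => 1 / q w (N + j) ^ 2)
      (fun j => rPlus w c₁ (N + j)) (fun j => f (N + j)) φ := by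
    refine ⟨hrec, hL, h1, h2, hφ.smooth, hlow, fun j => hf.smooth _ (Nat.le_add_right N j),
      fun j z hz => hf.one _ (Nat.le_add_right N j) z ?_,
      fun j z hz => hf.zero _ (Nat.le_add_right N j) z ?_,
      fun j z => hf.mem_Icc (Nat.le_add_right N j) z, h3, h4, h5, h6⟩
    · rw [mem_critInt_iff]
      refine hz.trans (le_of_eq ?_)
      rw [div_div, mul_comm]
    · rw [mem_critInt_iff, one_mul]
      exact not_le.2 hz
  have hlpos := hS.one_lt_lam
  have hr := fun n => (isReturn_rPlus hrec hirr n).2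
  have hnear : ∀ x, critDist c₁ x ≤ 1 / q w N ^ 2 → ∃ m : ℤ, φ x = phi0 d a c₁ x + m * Real.pi := by
    intro x hx
    refine (hφ.near hδ₁ hd (hx.trans ?_)).1
    have hq1 := one_le_q hirr N
    have hqN' := le_q hirr N
    rw [div_le_comm₀ (by positivity) hδ₀]
    nlinarith
  have hang := hS.angle_eq hr hnear
  have hper := fun j => psi_add_two_pi (w := w) (lam := lam) (r := fun j => rPlus w c₁ (N + j))
    (fun j => hf.periodic _ (Nat.le_add_right N j)) hφ.lift j
  have hsm : ∀ j, IsSmoothCocycle (cocycle lam (Scheme.angles w c₁ lam φ N f j)) := fun j =>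
    ⟨fun x => det_cocycle (by linarith) x, periodic_cocycle (hper j),
      contDiff_cocycle lam (hS.trans j).1⟩
  have hbd := fun j => exists_bound_iteratedDeriv (hS.trans j).1 (hper j)
  have hF := hf.exists_deriv_le hirr
  obtain ⟨D, hD, hconv⟩ := exists_limit_cocycle (by linarith : lam ≠ 0) (fun j => (hS.trans j).1)
    (fun j => periodic_cocycle (hper j)) (hS.exists_uniform_bound hjet hF hbd)
    (hS.exists_step_le hjet hF hbd)
  have hgap := fun (k j : ℕ) (hkj : k ≤ j) => hS.gapDefined hr hkj
  refine ⟨⟨hgap 0 0 le_rfl, fun j => ?_⟩, fun j => ?_, D, hD, fun k s hs i i' => ?_⟩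
  · rw [hang]
    exact ⟨hgap j (j + 1) (Nat.le_succ j), hgap (j + 1) (j + 1) le_rfl⟩
  · rw [hang]
    exact hsm (j + 1)
  · simp only [hang]
    intro u hu
    have hev := hconv k s hs i i' u hu
    exact (Filter.tendsto_add_atTop_nat 1).eventually hev
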